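/- Let $\Bbbk$ be a field of characteristic $0$ and let $\mathrm{Tame}(\Bbbk^3)$ be the group generated by the affine automorphisms of $\Bbbk^3$ and the automorphisms $(x_1+P(x_2,x_3),x_2,x_3)$, with product $fg=f\circ g$. For $\alpha\in\mathbb R_{>0}^3$ and $f\in\mathrm{Tame}(\Bbbk^3)$ let $\nu_{f,[\alpha]}$ be the class, up to multiplication by a positive real, of the monomial valuation $P\mapsto\min\{-\sum_k\alpha_km_k : x^m \text{ is a monomial of } P\circ f\}$, and let $\mathbf X$ be the set of all these classes, on which $\mathrm{Tame}(\Bbbk^3)$ acts by $g\cdot\nu_{f,[\alpha]}=\nu_{gf,[\alpha]}$. Let $\nabla$ be the projectivisation of $\mathbb R^3_{>0}$, with the Euclidean metric in the coordinates $(\log\alpha_1,\log\alpha_2,\log\alpha_3)$ where $\alpha_1\alpha_2\alpha_3=1$, and let $\nabla^+=\{\alpha_1\ge\alpha_2\ge\alpha_3\}\subset\nabla$. The admissible lines are those with equation $\alpha_1=m_2\alpha_2+m_3\alpha_3$, $m_2,m_3\in\mathbb N$ (not both zero), up to permuting the indices. They divide $\nabla^+$ into vertices (intersection points of two distinct admissible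 lines), open edges and open $2$-cells; the open cells of $\mathbf X$ are the sets $\{\nu_{f,[\beta]}:[\beta]\in\sigma\}$ with $f\in\mathrm{Tame}(\Bbbk^3)$ and $\sigma$ an open cell of $\nabla^+$. The link of a vertex of $\mathbf X$ is the metric graph whose vertices are the edges of $\mathbf X$ containing it, and whose edges are the corners at it of the $2$-cells of $\mathbf X$, the length of an edge being the angle of the corner. A cycle is an embedded closed edge path. Let $[\alpha]$ be a vertex of $\nabla^+$ with $\alpha_1>\alpha_2>\alpha_3$ and let $\nu=\nu_{\mathrm{id},[\alpha]}$ (every vertex of $\mathbf X$ with weight in the interior of $\nabla^+$ is a $\mathrm{Tame}(\Bbbk^3)$-translate of such a $\nu$). For $f\in\mathrm{Stab}(\nu)\subset \mathrm{Tame}(\Bbbk^3)$ let $\Gamma_f$ be the link of $\nu$ in the apartment $\mathbf E_f=\{\nu_{f,[\beta]}:[\beta]\in\nabla\}$. If $[\alpha]=[m,p,1]$ with $m,p\in\mathbb N$, let $s_f$ be the point of $\Gamma_f$ over the direction towards $[0,p,1]$, and, for $a\in\mathbb N$ with $pa\le m$, let $\Lambda_f^a$ be the path in $\Gamma_f$ from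 $s_f$ to the direction towards $[m-pa,0,1]$ that lies over $\{\beta_2\le p\beta_3,\ \beta_1\le a\beta_2+(m-pa)\beta_3\}$; let $\Upsilon_f$ be the path in $\Gamma_f$ from $s_f$ to the direction towards $[0,1,0]$ that lies over $\{\beta_2\ge p\beta_3,\ \beta_1\le m\beta_3\}$. Consider the following subgraphs of the link of $\nu$, where always $f_i=h_0h_1\cdots h_i$. (a) $[\alpha]=[m,p,1]$ with $m,p\in\mathbb N$; $h_0=(x_1,x_2-cx_3^p,x_3)$, $h_1=(x_1+x_2^{a'}P'(x_2,x_3),x_2,x_3)$, $h_2=(x_1,x_2+cx_3^p,x_3)$, $h_3=(x_1+x_2^{a}P(x_2,x_3),x_2,x_3)$, where $c\ne0$, $a,a'\in\mathbb N$, the polynomials $P,P'$ are not divisible by $x_2$ (in particular nonzero), $x_2^aP$ and $x_2^{a'}P'$ are homogeneous of degree $m$ for the weights $p,1$ of $x_2,x_3$, and $h_0h_1h_2h_3=\mathrm{id}$. The subgraph is $\Lambda^{a'}_{f_0}\cup\Lambda^{a'}_{f_1}\cup\Lambda^{a}_{f_2}\cup\Lambda^{a}_{f_3}$. (b) $[\alpha]=[m,p,1]$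 with $m=p+\beta$ for integers $0<\beta<p$; $h_0=(x_1,x_2-c'x_3^p,x_3)$, $h_1=(x_1-bcx_2x_3^\beta,x_2,x_3)$, $h_2=(x_1,x_2+(c'-c)x_3^p,x_3)$, $h_3=(x_1+bc'x_2x_3^\beta,x_2,x_3)$, $h_4=(x_1,x_2+cx_3^p,x_3)$, $h_5=(x_1+b(c-c')x_2x_3^\beta,x_2,x_3)$, where $c,c',c'-c,b\neq0$. The subgraph is $\Lambda^1_{f_0}\cup\dots\cup\Lambda^1_{f_5}$. (c) $[\alpha]=[m,p,1]$ with $m=p+\beta$ for integers $0<\beta<p$; $h_0=(x_1-bcx_3^m,x_2-cx_3^p,x_3)$, $h_1=(x_1+bx_2x_3^\beta,x_2,x_3)$, $h_2=(x_1,x_2+cx_3^p,x_3)$, $h_3=(x_1-bx_2x_3^\beta,x_2,x_3)$, where $c,b\ne0$. The subgraph is $(\Upsilon_{f_0}\cup\Lambda^1_{f_0})\cup\Lambda^1_{f_1}\cup\Lambda^1_{f_2}\cup(\Upsilon_{f_3}\cup\Lambda^1_{f_3})$. Then there is $\varepsilon_0>0$, independent of $[\alpha]$, such that for every such $\nu$,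 each cycle of length $<2\pi+\varepsilon_0$ in the link of $\nu$ is equal to one of the following: - $\Gamma_f$ for some $f\in\mathrm{Stab}(\nu)$; - the closure of $(\Gamma_f\cup\Gamma_g)\setminus(\Gamma_f\cap\Gamma_g)$ for some $f,g\in\mathrm{Stab}(\nu)$; - a translate by an element of $\mathrm{Stab}(\nu)$ of one of the subgraphs in (a), (b), (c). -/

import Mathlib

open MvPolynomial

noncomputable section

/-! ### The tame automorphism group of `k³` -/

/-- The group of polynomial automorphisms `f = (f₁, f₂, f₃)` of `k³`, an automorphism being recorded
by the algebra automorphism `P ↦ P ∘ f` of `k[x₁, x₂, x₃]`. Because of the opposite, the product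
`f * g` is the composition `f ∘ g` of maps. The variables `x₁, x₂, x₃` are `X 0, X 1, X 2`. -/
abbrev PolyAut (k : Type*) [Field k] : Type _ :=
  (MvPolynomial (Fin 3) k ≃ₐ[k] MvPolynomial (Fin 3) k)ᵐᵒᵖ

/-- The polynomial `P ∘ f`. -/
def PolyAut.pull {k : Type*} [Field k] (f : PolyAut k) (P : MvPolynomial (Fin 3) k) :
    MvPolynomial (Fin 3) k :=
  f.unop P

/-- The components `(f₁, f₂, f₃)` of `f`; they determine `f`. -/
def PolyAut.coords {k : Type*} [Field k] (f : PolyAut k) : Fin 3 → MvPolynomial (Fin 3) k :=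
  fun i => f.pull (X i)

/-- `Tame(k³)`: generated by the affine automorphisms and by the automorphisms
`(x₁ + P(x₂, x₃), x₂, x₃)`. -/
def tame (k : Type*) [Field k] : Subgroup (PolyAut k) :=
  Subgroup.closure
    ({f | ∀ i, (f.coords i).totalDegree ≤ 1} ∪
      {f | ∃ P : MvPolynomial (Fin 3) k, 0 ∉ P.vars ∧ f.coords = ![X 0 + P, X 1, X 2]})

/-! ### Monomial valuations up to scaling -/

/-- `ν_{id,α}(P)`, the minimum of `- ∑ αₖ mₖ` over the monomials `x^m` of `P` (and `⊤` if `P = 0`). -/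
def monVal {k : Type*} [Field k] (α : Fin 3 → ℝ) (P : MvPolynomial (Fin 3) k) : EReal :=
  P.support.inf fun m => ((-(∑ i, α i * (m i : ℝ)) : ℝ) : EReal)

/-- Two functions on `k[x₁, x₂, x₃]` are equivalent if they differ by a positive real factor. -/
def scaleSetoid (k : Type*) [Field k] : Setoid (MvPolynomial (Fin 3) k → EReal) where
  r μ ν := ∃ c : ℝ, 0 < c ∧ ∀ P, ν P = (c : EReal) * μ P
  iseqv :=
    { refl := fun μ => ⟨1, one_pos, fun P => by simp⟩
      symm := by
        rintro μ ν ⟨c, hc, h⟩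
        refine ⟨c⁻¹, inv_pos.mpr hc, fun P => ?_⟩
        rw [h P, ← mul_assoc, ← EReal.coe_mul, inv_mul_cancel₀ hc.ne']
        simp
      trans := by
        rintro μ ν ξ ⟨c, hc, h⟩ ⟨d, hd, h'⟩
        exact ⟨d * c, mul_pos hd hc, fun P => by rw [h' P, h P, EReal.coe_mul, mul_assoc]⟩ }

/-- Projective classes of functions on `k[x₁, x₂, x₃]`. -/
def ValClass (k : Type*) [Field k] : Type _ := Quotient (scaleSetoid k)

/-- The action `(g • ν)(P) = ν(P ∘ g)` on projective classes. -/
instance (k : Type*) [Field k] : MulAction (PolyAut k) (ValClass k) where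
  smul g := Quotient.map (fun ν P => ν (g.pull P)) (by
    rintro μ ν ⟨c, hc, h⟩
    exact ⟨c, hc, fun P => h _⟩)
  one_smul := by
    rintro ⟨ν⟩
    rfl
  mul_smul := by
    rintro g h ⟨ν⟩
    rfl

/-- The projective class `ν_{f,[α]}` of the monomial valuation `ν_{f,α}(P) = ν_{id,α}(P ∘ f)`.
The space `𝐗` consists of these classes, for `f` in `Tame(k³)` and `α` with positive entries. -/
def valPt {k : Type*} [Field k] (f : PolyAut k) (α : Fin 3 → ℝ) : ValClass k :=
  Quotient.mk (scaleSetoid k) fun P => monVal α (f.pull P)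

/-- The stabiliser of a point in `Tame(k³)`. -/
def tameStab {k : Type*} [Field k] (ν : ValClass k) : Subgroup (PolyAut k) :=
  tame k ⊓ MulAction.stabilizer (PolyAut k) ν

/-! ### The weight space and its cells

The weight space `∇` is the projectivisation of `Π = ℝ_{>0}³`. A subset of `∇` is represented by
the cone over it, that is, by its preimage in `Π`. -/

/-- `Π`. -/
def posWeights : Set (Fin 3 → ℝ) := {α | ∀ i, 0 < α i}

/-- `Π⁺`, the cone over the Weyl chamber `∇⁺`. -/
def chamberWeights : Set (Fin 3 → ℝ) := {α ∈ posWeights | α 1 ≤ α 0 ∧ α 2 ≤ α 1}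

/-- Admissible lines: `α₁ = m₂ α₂ + m₃ α₃` with `m₂, m₃ ∈ ℕ`, up to permuting the coordinates.
(For `m₂ = m₃ = 0` this is the empty set, which has no effect below.) -/
def IsAdmissibleLine (l : Set (Fin 3 → ℝ)) : Prop :=
  ∃ (s : Equiv.Perm (Fin 3)) (m n : ℕ),
    l = {α ∈ posWeights | α (s 0) = m * α (s 1) + n * α (s 2)}

/-- The vertices of `∇⁺`: the intersection points of distinct admissible lines. -/
def vertexWeights : Set (Fin 3 → ℝ) :=
  {α ∈ chamberWeights | ∃ l l', IsAdmissibleLine l ∧ IsAdmissibleLine l' ∧ l ≠ l' ∧ α ∈ l ∧ α ∈ l'}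

/-- The open edges of `∇⁺`: the components of the complement of the vertices in the admissible
lines. -/
def IsOpenEdge (τ : Set (Fin 3 → ℝ)) : Prop :=
  ∃ l, IsAdmissibleLine l ∧ ∃ β ∈ (l ∩ chamberWeights) \ vertexWeights,
    τ = connectedComponentIn ((l ∩ chamberWeights) \ vertexWeights) β

/-- The open `2`-cells of `∇⁺`: the components of the complement of the admissible lines. -/
def IsOpenFace (σ : Set (Fin 3 → ℝ)) : Prop :=
  ∃ β ∈ chamberWeights \ ⋃₀ {l | IsAdmissibleLine l},
    σ = connectedComponentIn (chamberWeights \ ⋃₀ {l | IsAdmissibleLine l}) β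

/-! ### Angles in the weight space -/

/-- The coordinates `(log α₁, log α₂, log α₃)` of the representative of `[α]` with
`α₁ α₂ α₃ = 1`. The metric of `∇` is the Euclidean one in these coordinates. -/
def logCoord (α : Fin 3 → ℝ) : EuclideanSpace ℝ (Fin 3) :=
  WithLp.toLp 2 fun i => Real.log (α i) - (∑ j, Real.log (α j)) / 3

/-- The tangent vector at `[α]` of the projective segment from `[α]` to `[β]`. -/
def direction (α β : Fin 3 → ℝ) : EuclideanSpace ℝ (Fin 3) :=
  deriv (fun t : ℝ => logCoord (α + t • (β - α))) 0

theorem direction_eq {α : Fin 3 → ℝ} (hα : α ∈ posWeights) (β : Fin 3 → ℝ) :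
    direction α β = WithLp.toLp 2 fun i => β i / α i - (∑ j, β j / α j) / 3 := by
  have h1 : ∀ i, HasDerivAt (fun t : ℝ => Real.log ((α + t • (β - α)) i)) (β i / α i - 1) 0 := by
    intro i
    have h0 : HasDerivAt (fun t : ℝ => α i + t * (β i - α i)) (β i - α i) 0 := by
      simpa using ((hasDerivAt_id (0 : ℝ)).mul_const (β i - α i)).const_add (α i)
    have h2 := h0.log (by simpa using (hα i).ne')
    have h3 : (β i - α i) / (α i + 0 * (β i - α i)) = β i / α i - 1 := by
      rw [zero_mul, add_zero, sub_div, div_self (hα i).ne']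
    rw [h3] at h2
    simpa using h2
  have h4 : HasDerivAt
      (fun t : ℝ => fun i : Fin 3 =>
        Real.log ((α + t • (β - α)) i) - (∑ j, Real.log ((α + t • (β - α)) j)) / 3)
      (fun i => β i / α i - (∑ j, β j / α j) / 3) 0 := by
    rw [hasDerivAt_pi]
    intro i
    have h5 := (h1 i).sub ((HasDerivAt.fun_sum (u := Finset.univ) fun j _ => h1 j).div_const 3)
    have h6 : β i / α i - 1 - (∑ j, (β j / α j - 1)) / 3 =
        β i / α i - (∑ j, β j / α j) / 3 := by
      rw [Finset.sum_sub_distrib]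
      simp
      ring
    rw [h6] at h5
    exact h5
  exact ((PiLp.continuousLinearEquiv 2 ℝ (fun _ : Fin 3 => ℝ)).symm.hasFDerivAt.comp_hasDerivAt
    (0 : ℝ) h4).deriv

/-! ### Links in `𝐗` -/

/-- The set `{ν_{f,[β]} : [β] ∈ σ}`. The open cells of `𝐗` are these sets for `f` in `Tame(k³)` and
`σ` an open cell of `∇⁺`. -/
def cell {k : Type*} [Field k] (f : PolyAut k) (σ : Set (Fin 3 → ℝ)) : Set (ValClass k) :=
  valPt f '' σ

/-- The apartment `𝐄_f`. -/
def apartment {k : Type*} [Field k] (f : PolyAut k) : Set (ValClass k) :=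
  cell f posWeights

/-- The edges of the link of `ν = ν_{id,[α]}` in `𝐗` are the corners at `ν` of the `2`-cells of `𝐗`.
Every `2`-cell has at most one corner at `ν`, so a corner is recorded by its open `2`-cell. -/
def linkEdges (k : Type*) [Field k] (α : Fin 3 → ℝ) : Set (Set (ValClass k)) :=
  {c | ∃ f ∈ tameStab (valPt (1 : PolyAut k) α), ∃ σ, IsOpenFace σ ∧ α ∈ closure σ ∧ c = cell f σ}

/-- `c` is an edge of the link of `ν = ν_{id,[α]}` of length `θ` joining the distinct vertices `e`
and `e'` of the link: `c` is an open `2`-cell of `𝐗` with a corner at `ν`, the sides of this corner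
are the open edges `e` and `e'` of `𝐗`, and `θ` is the angle between them. -/
def IsLinkCorner {k : Type*} [Field k] (α : Fin 3 → ℝ) (c e e' : Set (ValClass k)) (θ : ℝ) : Prop :=
  ∃ f ∈ tameStab (valPt (1 : PolyAut k) α), ∃ σ τ τ',
    IsOpenFace σ ∧ IsOpenEdge τ ∧ IsOpenEdge τ' ∧ τ ≠ τ' ∧
    α ∈ closure τ ∧ α ∈ closure τ' ∧ τ ⊆ closure σ ∧ τ' ⊆ closure σ ∧
    c = cell f σ ∧ e = cell f τ ∧ e' = cell f τ' ∧
    ∃ β ∈ τ, ∃ β' ∈ τ', θ = InnerProductGeometry.angle (direction α β) (direction α β')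

/-- `γ` is (the set of edges of) an embedded cycle of length `L` in the link of `ν_{id,[α]}`. -/
def IsLinkCycle {k : Type*} [Field k] (α : Fin 3 → ℝ) (γ : Set (Set (ValClass k))) (L : ℝ) : Prop :=
  ∃ (n : ℕ) (v c : Fin (n + 2) → Set (ValClass k)) (θ : Fin (n + 2) → ℝ),
    Function.Injective v ∧ Function.Injective c ∧
    (∀ i, IsLinkCorner α (c i) (v i) (v (i + 1)) (θ i)) ∧
    γ = Set.range c ∧ L = ∑ i, θ i

/-- (The set of edges of) `Γ_f`, the link of `ν_{id,[α]}` in the apartment `𝐄_f`. -/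
def apartmentLink {k : Type*} [Field k] (α : Fin 3 → ℝ) (f : PolyAut k) : Set (Set (ValClass k)) :=
  {c ∈ linkEdges k α | c ⊆ apartment f}

/-- The translateCycle of a set of edges of the link by `g`. -/
def translateCycle {k : Type*} [Field k] (g : PolyAut k) (γ : Set (Set (ValClass k))) :
    Set (Set (ValClass k)) :=
  (fun c => (fun x => g • x) '' c) '' γ

/-! ### The exceptional cycles

Let `[α] = [m, p, 1]`. The link of `[α]` in `∇⁺` is a circle; let `s` be the direction towards
`[0, p, 1]`. -/

/-- The edges of `Γ_f` that lie over the corners at `[α]` of the `2`-cells contained in `R`. -/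
def linkPath {k : Type*} [Field k] (α : Fin 3 → ℝ) (f : PolyAut k) (R : Set (Fin 3 → ℝ)) :
    Set (Set (ValClass k)) :=
  {c | ∃ σ, IsOpenFace σ ∧ α ∈ closure σ ∧ σ ⊆ R ∧ c = cell f σ}

/-- On the side `β₂ < p β₃`, the sector at `[m, p, 1]` between `s` and the direction towards
`[m - p a, 0, 1]`. -/
def lowerSector (m p a : ℕ) : Set (Fin 3 → ℝ) :=
  {β | β 1 < p * β 2 ∧ β 0 < a * β 1 + ((m : ℝ) - p * a) * β 2}

/-- On the side `β₂ > p β₃`, the sector at `[m, p, 1]` between `s` and the direction towards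
`[a, 1, 0]`. -/
def upperSector (m p a : ℕ) : Set (Fin 3 → ℝ) :=
  {β | p * β 2 < β 1 ∧ β 0 < a * β 1 + ((m : ℝ) - p * a) * β 2}

/-- The cycles of type (a): four paths, in `Γ_{f₀}, Γ_{f₁}, Γ_{f₂}, Γ_{f₃}`, where
`fᵢ = h₀ ⋯ hᵢ` and `f₃ = id`. The polynomials `x₂^a P` and `x₂^a' P'` are nonzero, depend only on
`x₂, x₃`, are homogeneous of degree `m` for the weights `p, 1` of `x₂, x₃`, and the exponents
`a, a'` are the largest possible. -/
def IsCycleA {k : Type*} [Field k] (α : Fin 3 → ℝ) (γ : Set (Set (ValClass k))) : Prop :=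
  ∃ (m p a a' : ℕ) (t : ℝ) (c : k) (P P' : MvPolynomial (Fin 3) k) (h₀ h₁ h₂ h₃ : PolyAut k),
    0 < t ∧ α = t • ![(m : ℝ), (p : ℝ), 1] ∧ c ≠ 0 ∧
    (∀ d ∈ P.support, d 0 = 0 ∧ p * (a + d 1) + d 2 = m) ∧ ¬ X 1 ∣ P ∧
    (∀ d ∈ P'.support, d 0 = 0 ∧ p * (a' + d 1) + d 2 = m) ∧ ¬ X 1 ∣ P' ∧
    h₀.coords = ![X 0, X 1 - C c * X 2 ^ p, X 2] ∧
    h₁.coords = ![X 0 + X 1 ^ a' * P', X 1, X 2] ∧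
    h₂.coords = ![X 0, X 1 + C c * X 2 ^ p, X 2] ∧
    h₃.coords = ![X 0 + X 1 ^ a * P, X 1, X 2] ∧
    h₀ * h₁ * h₂ * h₃ = 1 ∧
    γ = linkPath α h₀ (lowerSector m p a') ∪ linkPath α (h₀ * h₁) (lowerSector m p a') ∪
      linkPath α (h₀ * h₁ * h₂) (lowerSector m p a) ∪
      linkPath α (h₀ * h₁ * h₂ * h₃) (lowerSector m p a)

/-- The cycles of type (b), for `m = p + r` with `0 < r < p`: six paths, in `Γ_{f₀}, …, Γ_{f₅}`,
where `fᵢ = h₀ ⋯ hᵢ` and `f₅ = id`. -/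
def IsCycleB {k : Type*} [Field k] (α : Fin 3 → ℝ) (γ : Set (Set (ValClass k))) : Prop :=
  ∃ (m p r : ℕ) (t : ℝ) (b c c' : k) (h₀ h₁ h₂ h₃ h₄ h₅ : PolyAut k),
    m = p + r ∧ 0 < r ∧ r < p ∧ 0 < t ∧ α = t • ![(m : ℝ), (p : ℝ), 1] ∧
    c ≠ 0 ∧ c' ≠ 0 ∧ c' - c ≠ 0 ∧ b ≠ 0 ∧
    h₀.coords = ![X 0, X 1 - C c' * X 2 ^ p, X 2] ∧
    h₁.coords = ![X 0 - C (b * c) * X 1 * X 2 ^ r, X 1, X 2] ∧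
    h₂.coords = ![X 0, X 1 + C (c' - c) * X 2 ^ p, X 2] ∧
    h₃.coords = ![X 0 + C (b * c') * X 1 * X 2 ^ r, X 1, X 2] ∧
    h₄.coords = ![X 0, X 1 + C c * X 2 ^ p, X 2] ∧
    h₅.coords = ![X 0 + C (b * (c - c')) * X 1 * X 2 ^ r, X 1, X 2] ∧
    γ = linkPath α h₀ (lowerSector m p 1) ∪ linkPath α (h₀ * h₁) (lowerSector m p 1) ∪
      linkPath α (h₀ * h₁ * h₂) (lowerSector m p 1) ∪
      linkPath α (h₀ * h₁ * h₂ * h₃) (lowerSector m p 1) ∪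
      linkPath α (h₀ * h₁ * h₂ * h₃ * h₄) (lowerSector m p 1) ∪
      linkPath α (h₀ * h₁ * h₂ * h₃ * h₄ * h₅) (lowerSector m p 1)

/-- The cycles of type (c), for `m = p + r` with `0 < r < p`: four paths, in
`Γ_{f₀}, Γ_{f₁}, Γ_{f₂}, Γ_{f₃}`, where `fᵢ = h₀ ⋯ hᵢ` and `f₃ = id`; the first and the last one
run from the direction towards `[0, 1, 0]` through `s` to the direction towards `[m - p, 0, 1]`. -/
def IsCycleC {k : Type*} [Field k] (α : Fin 3 → ℝ) (γ : Set (Set (ValClass k))) : Prop :=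
  ∃ (m p r : ℕ) (t : ℝ) (b c : k) (h₀ h₁ h₂ h₃ : PolyAut k),
    m = p + r ∧ 0 < r ∧ r < p ∧ 0 < t ∧ α = t • ![(m : ℝ), (p : ℝ), 1] ∧
    c ≠ 0 ∧ b ≠ 0 ∧
    h₀.coords = ![X 0 - C (b * c) * X 2 ^ m, X 1 - C c * X 2 ^ p, X 2] ∧
    h₁.coords = ![X 0 + C b * X 1 * X 2 ^ r, X 1, X 2] ∧
    h₂.coords = ![X 0, X 1 + C c * X 2 ^ p, X 2] ∧
    h₃.coords = ![X 0 - C b * X 1 * X 2 ^ r, X 1, X 2] ∧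
    γ = linkPath α h₀ (upperSector m p 0 ∪ lowerSector m p 1) ∪
      linkPath α (h₀ * h₁) (lowerSector m p 1) ∪
      linkPath α (h₀ * h₁ * h₂) (lowerSector m p 1) ∪
      linkPath α (h₀ * h₁ * h₂ * h₃) (upperSector m p 0 ∪ lowerSector m p 1)

end

/-! Near [α] use the linear coordinates x, y given by `xCoord` and `yCoord`. As α₁ > α₂ > α₃, an
element f of Stab(ν) is triangular with nonzero diagonal coefficients. It fixes ν_{id,[β]}, for β
near [α], exactly when x - a y ≥ 0 for every monomial x₂^a x₃^b of weight α₁ in f₁, and y ≥ 0 if f₂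
contains a monomial x₃^p of weight α₂ (`mem_stabAt_iff`). The half-planes x - a y ≥ 0 all contain
(1,0) and miss (-1,0), while the line y = 0 passes through both. So the directions at [α] are ranked
from the bottom (-1,0) to the top (1,0) along the two sides y > 0 and y < 0, and stabilisers of
positive rank grow with the rank (`stabAt_le_of_heightAt_le`). The one defect: if α₂ is a multiple
of α₃ (the flagged case), an element fixing the bottom direction need not fix directions with y < 0.

At a local minimum of positive rank a cycle would therefore backtrack. Hence it is a chain of
excursions, each climbing from rank 0 inside one apartment and descending to rank 0 inside another
(`LinkWalk.rankedWalk`, `LinkWalk.exists_excursion`). Each excursion has length at least 2π/3, so a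
short cycle has at most three. In the unflagged case every passage through the bottom changes sides,
and parity leaves only Γ_f and symmetric differences (`LinkWalk.unflagged_cases`). In the flagged
case there remain two excursions on y < 0, or three of which at least two are on y < 0
(`LinkWalk.flagged_cases`). With three, each is nearly as short as possible, so its relative slope a
α₂ / α₁ exceeds 5/6 if y < 0, and is below 1/6 if y > 0.

These remaining cycles are polynomial identities. For [α] = [m,p,1], an apartment at ν is described
by a polynomial R of degree at most m/p and a scalar c (`IsFlagWeight.exists_label`). An excursion
on y < 0 that turns at slope a keeps c and changes R by a polynomial vanishing at c to order exactly
a (`IsFlagWeight.leg_false`). On y > 0 the change has degree exactly a (`IsFlagWeight.leg_true`).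
The bottom preserves R, and changes c between two excursions on y < 0. Two excursions give (a).
Three give F₁ + F₂ + F₃ = 0 with zeros of high order at distinct points, and Wronskian estimates in
the spirit of Mason and Stothers force m < 2p. The F's are then linear, or one of them is constant,
which is (b) or (c). -/

noncomputable section

/-! ### Monomial valuations and weighted degree filtrations -/

section Filtration
variable {k : Type*} [Field k]

/-- `P` has weighted degree at most `d` for the weights `β`. -/
def DegLE (β : Fin 3 → ℝ) (d : ℝ) (P : MvPolynomial (Fin 3) k) : Prop :=
  ∀ m ∈ P.support, ∑ i, β i * (m i : ℝ) ≤ d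

theorem le_monVal_iff (β : Fin 3 → ℝ) (d : ℝ) (P : MvPolynomial (Fin 3) k) :
    ((-d : ℝ) : EReal) ≤ monVal β P ↔ DegLE β d P := by
  simp only [monVal, Finset.le_inf_iff, DegLE, EReal.coe_le_coe_iff, neg_le_neg_iff]

theorem DegLE.mono {β : Fin 3 → ℝ} {d d' : ℝ} {P : MvPolynomial (Fin 3) k} (h : DegLE β d P)
    (hd : d ≤ d') : DegLE β d' P := fun m hm => (h m hm).trans hd

theorem DegLE.add {β : Fin 3 → ℝ} {d : ℝ} {P Q : MvPolynomial (Fin 3) k} (hP : DegLE β d P)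
    (hQ : DegLE β d Q) : DegLE β d (P + Q) := by
  classical
  intro m hm
  rcases Finset.mem_union.1 (support_add hm) with h | h
  exacts [hP m h, hQ m h]

theorem DegLE.mul {β : Fin 3 → ℝ} {d e : ℝ} {P Q : MvPolynomial (Fin 3) k} (hP : DegLE β d P)
    (hQ : DegLE β e Q) : DegLE β (d + e) (P * Q) := by
  classical
  intro m hm
  obtain ⟨a, ha, b, hb, rfl⟩ := Finset.mem_add.1 (support_mul P Q hm)
  have := add_le_add (hP a ha) (hQ b hb)
  rw [← Finset.sum_add_distrib] at this
  simpa [mul_add] using this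

theorem degLE_C (β : Fin 3 → ℝ) (c : k) : DegLE β 0 (C c : MvPolynomial (Fin 3) k) := by
  classical
  intro m hm
  have : m = 0 := by
    by_contra h
    rw [mem_support_iff, coeff_C, if_neg (Ne.symm h)] at hm
    exact hm rfl
  simp [this]

theorem DegLE.pow {β : Fin 3 → ℝ} {d : ℝ} {P : MvPolynomial (Fin 3) k} (hP : DegLE β d P) (n : ℕ) :
    DegLE β (n * d) (P ^ n) := by
  induction n with
  | zero => simpa using degLE_C β (1 : k)
  | succ n ih => simpa [pow_succ, add_mul] using ih.mul hP

theorem degLE_X (β : Fin 3 → ℝ) (i : Fin 3) : DegLE β (β i) (X i : MvPolynomial (Fin 3) k) := by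
  classical
  intro m hm
  rw [support_X, Finset.mem_singleton] at hm
  subst hm
  simp [Finsupp.single_apply]

theorem DegLE.sum {ι : Type*} {β : Fin 3 → ℝ} {d : ℝ} {s : Finset ι}
    {F : ι → MvPolynomial (Fin 3) k} (h : ∀ i ∈ s, DegLE β d (F i)) :
    DegLE β d (∑ i ∈ s, F i) := by
  classical
  induction s using Finset.induction_on with
  | empty => intro m hm; simp at hm
  | insert i s hi ih =>
    rw [Finset.sum_insert hi]
    exact (h i (by simp)).add (ih fun j hj => h j (by simp [hj]))

theorem DegLE.prod {ι : Type*} {β : Fin 3 → ℝ} {s : Finset ι} {d : ι → ℝ}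
    {F : ι → MvPolynomial (Fin 3) k} (h : ∀ i ∈ s, DegLE β (d i) (F i)) :
    DegLE β (∑ i ∈ s, d i) (∏ i ∈ s, F i) := by
  classical
  induction s using Finset.induction_on with
  | empty => simpa using degLE_C β (1 : k)
  | insert i s hi ih =>
    rw [Finset.prod_insert hi, Finset.sum_insert hi]
    exact (h i (by simp)).mul (ih fun j hj => h j (by simp [hj]))

theorem PolyAut.pull_eq_aeval (h : PolyAut k) (P : MvPolynomial (Fin 3) k) :
    h.pull P = aeval h.coords P := by
  have : (h.unop : MvPolynomial (Fin 3) k →ₐ[k] MvPolynomial (Fin 3) k) = aeval h.coords :=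
    MvPolynomial.algHom_ext fun i => by simp [PolyAut.coords, PolyAut.pull]
  exact DFunLike.congr_fun this P

theorem PolyAut.ext_coords {f g : PolyAut k} (h : f.coords = g.coords) : f = g := by
  apply MulOpposite.unop_injective
  apply AlgEquiv.ext
  intro P
  have h1 := f.pull_eq_aeval P
  rw [h, ← g.pull_eq_aeval] at h1
  exact h1

theorem PolyAut.pull_mul (f g : PolyAut k) (P : MvPolynomial (Fin 3) k) :
    (f * g).pull P = g.pull (f.pull P) := rfl

@[simp] theorem PolyAut.pull_one (P : MvPolynomial (Fin 3) k) : (1 : PolyAut k).pull P = P := rfl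

@[simp] theorem PolyAut.pull_inv_pull (f : PolyAut k) (P : MvPolynomial (Fin 3) k) :
    f.pull (f⁻¹.pull P) = P := by
  rw [← PolyAut.pull_mul, inv_mul_cancel, PolyAut.pull_one]

@[simp] theorem PolyAut.pull_pull_inv (f : PolyAut k) (P : MvPolynomial (Fin 3) k) :
    f⁻¹.pull (f.pull P) = P := by
  rw [← PolyAut.pull_mul, mul_inv_cancel, PolyAut.pull_one]

theorem PolyAut.coords_mul (f g : PolyAut k) (i : Fin 3) :
    (f * g).coords i = g.pull (f.coords i) := rfl

theorem DegLE.aeval {β γ : Fin 3 → ℝ} {F : Fin 3 → MvPolynomial (Fin 3) k}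
    (hF : ∀ i, DegLE β (γ i) (F i)) {d : ℝ} {P : MvPolynomial (Fin 3) k} (hP : DegLE γ d P) :
    DegLE β d (aeval F P) := by
  rw [aeval_def, eval₂_eq']
  refine DegLE.sum fun m hm => ?_
  have h1 : DegLE β (∑ i, γ i * (m i : ℝ)) (∏ i, F i ^ m i) :=
    DegLE.prod fun i _ => by simpa [mul_comm] using (hF i).pow (m i)
  have h2 : DegLE β (∑ i, γ i * (m i : ℝ))
      ((algebraMap k (MvPolynomial (Fin 3) k)) (coeff m P) * ∏ i, F i ^ m i) := by
    simpa using (degLE_C β (coeff m P)).mul h1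
  exact h2.mono (hP m hm)

theorem monVal_zero (β : Fin 3 → ℝ) : monVal β (0 : MvPolynomial (Fin 3) k) = ⊤ := by
  simp [monVal]

theorem monVal_eq_coe (β : Fin 3 → ℝ) {P : MvPolynomial (Fin 3) k} (hP : P ≠ 0) :
    ∃ d : ℝ, monVal β P = ((-d : ℝ) : EReal) := by
  obtain ⟨m, -, hm⟩ := Finset.exists_mem_eq_inf P.support (by simpa using hP)
    (fun m => ((-(∑ i, β i * (m i : ℝ)) : ℝ) : EReal))
  exact ⟨_, hm⟩

theorem monVal_le_of_degLE {β γ : Fin 3 → ℝ} {P Q : MvPolynomial (Fin 3) k}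
    (h0 : P = 0 → Q = 0) (h : ∀ d, DegLE β d P → DegLE γ d Q) : monVal β P ≤ monVal γ Q := by
  by_cases hP : P = 0
  · rw [hP, h0 hP, monVal_zero, monVal_zero]
  · obtain ⟨d, hd⟩ := monVal_eq_coe β hP
    rw [hd, le_monVal_iff]
    exact h d ((le_monVal_iff _ _ _).1 hd.ge)

theorem coe_mul_le_iff {c : ℝ} (hc : 0 < c) (d : ℝ) (x : EReal) :
    ((-(c * d) : ℝ) : EReal) ≤ (c : EReal) * x ↔ ((-d : ℝ) : EReal) ≤ x := by
  induction x with
  | bot => rw [EReal.coe_mul_bot_of_pos hc]; simp only [le_bot_iff, EReal.coe_ne_bot]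
  | top => simp only [EReal.coe_mul_top_of_pos hc, le_top]
  | coe x =>
    rw [← EReal.coe_mul, EReal.coe_le_coe_iff, EReal.coe_le_coe_iff]
    constructor <;> intro h <;> nlinarith

theorem valPt_eq_iff {f g : PolyAut k} {β γ : Fin 3 → ℝ} :
    valPt f β = valPt g γ ↔
      ∃ c : ℝ, 0 < c ∧ ∀ P, monVal γ (g.pull P) = (c : EReal) * monVal β (f.pull P) :=
  ⟨fun h => Quotient.exact h, fun h => Quotient.sound h⟩

theorem degLE_iff_of_valPt_eq {f g : PolyAut k} {β γ : Fin 3 → ℝ} (h : valPt f β = valPt g γ) :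
    ∃ c : ℝ, 0 < c ∧ ∀ P d, DegLE γ (c * d) (g.pull P) ↔ DegLE β d (f.pull P) := by
  obtain ⟨c, hc, h⟩ := valPt_eq_iff.1 h
  refine ⟨c, hc, fun P d => ?_⟩
  rw [← le_monVal_iff, ← le_monVal_iff, h, coe_mul_le_iff hc]

theorem smul_valPt (g f : PolyAut k) (β : Fin 3 → ℝ) : g • valPt f β = valPt (g * f) β := rfl

/-- The polynomials of weighted degree at most `d`. -/
def degSubmodule (k : Type*) [Field k] (β : Fin 3 → ℝ) (d : ℝ) :
    Submodule k (MvPolynomial (Fin 3) k) :=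
  restrictSupport k {m | ∑ i, β i * (m i : ℝ) ≤ d}

theorem mem_degSubmodule {β : Fin 3 → ℝ} {d : ℝ} {P : MvPolynomial (Fin 3) k} :
    P ∈ degSubmodule k β d ↔ DegLE β d P := by
  rw [degSubmodule, mem_restrictSupport_iff]
  exact Iff.rfl

/-- Positive weights bound every exponent, so only finitely many monomials occur. Finite dimension
is what lets inverses preserve the filtration. -/
theorem finite_degSubmodule {β : Fin 3 → ℝ} (hβ : β ∈ posWeights) (d : ℝ) :
    Module.Finite k (degSubmodule k β d) := by
  have hfin : {m : Fin 3 →₀ ℕ | ∑ i, β i * (m i : ℝ) ≤ d}.Finite := by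
    refine (Set.finite_Iic
      (Finsupp.equivFunOnFinite.symm fun i => ⌊d / β i⌋₊ : Fin 3 →₀ ℕ)).subset ?_
    intro m hm i
    change m i ≤ ⌊d / β i⌋₊
    refine Nat.le_floor ?_
    rw [le_div_iff₀ (hβ i), mul_comm]
    refine le_trans ?_ hm
    exact Finset.single_le_sum (f := fun i => β i * (m i : ℝ))
      (fun j _ => mul_nonneg (hβ j).le (Nat.cast_nonneg _)) (Finset.mem_univ i)
  have := hfin.to_subtype
  exact Module.Finite.of_basis (basisRestrictSupport k _)

theorem PolyAut.degLE_pull {β : Fin 3 → ℝ} {h : PolyAut k} (hh : ∀ i, DegLE β (β i) (h.coords i))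
    {d : ℝ} {P : MvPolynomial (Fin 3) k} (hP : DegLE β d P) : DegLE β d (h.pull P) := by
  rw [h.pull_eq_aeval]
  exact hP.aeval hh

/-- An automorphism that preserves a finite-dimensional step of the filtration is injective on it,
hence surjective onto it. -/
theorem PolyAut.degLE_inv {β : Fin 3 → ℝ} (hβ : β ∈ posWeights) {h : PolyAut k}
    (hh : ∀ i, DegLE β (β i) (h.coords i)) {d : ℝ} {P : MvPolynomial (Fin 3) k}
    (hP : DegLE β d P) : DegLE β d (h⁻¹.pull P) := by
  have := finite_degSubmodule (k := k) hβ d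
  let φ : degSubmodule k β d →ₗ[k] degSubmodule k β d :=
    (h.unop.toLinearMap).restrict fun P hP =>
      mem_degSubmodule.2 (PolyAut.degLE_pull hh (mem_degSubmodule.1 hP))
  have hinj : Function.Injective φ := by
    intro a b hab
    apply Subtype.ext
    exact h.unop.injective (congrArg Subtype.val hab)
  obtain ⟨Q, hQ⟩ := (LinearMap.injective_iff_surjective.1 hinj) ⟨P, mem_degSubmodule.2 hP⟩
  have h1 : h.pull Q.1 = P := congrArg Subtype.val hQ
  rw [← h1, PolyAut.pull_pull_inv]
  exact mem_degSubmodule.1 Q.2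

theorem PolyAut.pull_eq_zero {h : PolyAut k} {P : MvPolynomial (Fin 3) k} :
    h.pull P = 0 ↔ P = 0 := EmbeddingLike.map_eq_zero_iff (f := h.unop)

theorem valPt_eq_one_of_degLE {β : Fin 3 → ℝ} (hβ : β ∈ posWeights) {h : PolyAut k}
    (hh : ∀ i, DegLE β (β i) (h.coords i)) : valPt h β = valPt 1 β := by
  refine valPt_eq_iff.2 ⟨1, one_pos, fun P => ?_⟩
  rw [EReal.coe_one, one_mul, PolyAut.pull_one]
  refine le_antisymm ?_ ?_
  · exact monVal_le_of_degLE (fun h0 => by simpa [PolyAut.pull_eq_zero] using h0)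
      fun d hd => PolyAut.degLE_pull hh hd
  · refine monVal_le_of_degLE (fun h0 => by simpa [PolyAut.pull_eq_zero] using h0) fun d hd => ?_
    simpa using PolyAut.degLE_inv hβ hh hd

/-- The scaling factor c is not known to be 1. If c ≥ 1, the bound follows by testing on x_i. If c <
1, the same argument bounds the components of the inverse, and `PolyAut.degLE_inv` returns to h. -/
theorem degLE_of_valPt_eq_one {β : Fin 3 → ℝ} (hβ : β ∈ posWeights) {h : PolyAut k}
    (hh : valPt h β = valPt 1 β) (i : Fin 3) : DegLE β (β i) (h.coords i) := by
  obtain ⟨c, hc, h1⟩ := degLE_iff_of_valPt_eq hh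
  simp only [PolyAut.pull_one] at h1
  by_cases hc1 : 1 ≤ c
  · have h2 := (h1 (X i) (β i / c)).1 (by
      rw [mul_div_cancel₀ _ hc.ne']; exact degLE_X β i)
    exact h2.mono (div_le_self (hβ i).le hc1)
  · push Not at hc1
    have h2 : ∀ j, DegLE β (β j) (h⁻¹.coords j) := fun j => by
      have := (h1 (h⁻¹.coords j) (β j)).2 (by
        rw [PolyAut.coords, PolyAut.pull_inv_pull]; exact degLE_X β j)
      exact this.mono (mul_le_of_le_one_left (hβ j).le hc1.le)
    have h3 := PolyAut.degLE_inv hβ h2 (degLE_X β i)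
    rwa [inv_inv] at h3

theorem valPt_eq_one_iff {β : Fin 3 → ℝ} (hβ : β ∈ posWeights) {h : PolyAut k} :
    valPt h β = valPt 1 β ↔ ∀ i, DegLE β (β i) (h.coords i) :=
  ⟨degLE_of_valPt_eq_one hβ, valPt_eq_one_of_degLE hβ⟩

end Filtration

/-! ### Triangularity of the stabiliser and its fixed directions -/

section Stabiliser
variable {k : Type*} [Field k]

/-- The elements of the stabiliser of `ν_{id,[α]}` that fix `ν_{id,[β]}`. -/
def stabAt (k : Type*) [Field k] (α β : Fin 3 → ℝ) : Subgroup (PolyAut k) :=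
  tameStab (valPt (1 : PolyAut k) α) ⊓ MulAction.stabilizer (PolyAut k) (valPt (1 : PolyAut k) β)

/-- The weights in the interior of the chamber. -/
structure StrictWeight (α : Fin 3 → ℝ) : Prop where
  pos : α ∈ posWeights
  lt01 : α 1 < α 0
  lt12 : α 2 < α 1

theorem StrictWeight.lt_of_lt {α : Fin 3 → ℝ} (hα : StrictWeight α) {i j : Fin 3} (h : i < j) :
    α j < α i := by
  have := hα.lt01
  have := hα.lt12
  fin_cases i <;> fin_cases j <;> simp at h ⊢ <;> linarith

theorem degLE_of_mem_tameStab {α : Fin 3 → ℝ} (hα : α ∈ posWeights) {f : PolyAut k}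
    (hf : f ∈ tameStab (valPt 1 α)) (i : Fin 3) : DegLE α (α i) (f.coords i) :=
  degLE_of_valPt_eq_one hα (by simpa [MulAction.mem_stabilizer_iff, smul_valPt] using hf.2) i

theorem mem_stabAt {α β : Fin 3 → ℝ} {f : PolyAut k} (hβ : β ∈ posWeights) :
    f ∈ stabAt k α β ↔ f ∈ tameStab (valPt 1 α) ∧ ∀ i, DegLE β (β i) (f.coords i) := by
  rw [← valPt_eq_one_iff hβ]
  simp [stabAt, Subgroup.mem_inf, MulAction.mem_stabilizer_iff, smul_valPt]

/-- A monomial containing x_j has weight at least α_j. Weight at most α_i thus excludes the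
variables before x_i, and allows x_i only as the monomial x_i itself. This is the source of
triangularity, and it uses that the weights are strictly decreasing. -/
theorem DegLE.exists_eq_add {α : Fin 3 → ℝ} (hα : StrictWeight α) {i : Fin 3}
    {P : MvPolynomial (Fin 3) k} (hP : DegLE α (α i) P) :
    ∃ Q ∈ supported k (Set.Ioi i), P = C (coeff (Finsupp.single i 1) P) * X i + Q := by
  classical
  refine ⟨P - C (coeff (Finsupp.single i 1) P) * X i, ?_, by ring⟩
  rw [mem_supported]
  intro j hj
  rw [Finset.mem_coe, mem_vars_iff_mem_support] at hj
  obtain ⟨m, hm, hjm⟩ := hj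
  rw [mem_support_iff, coeff_sub, coeff_C_mul, coeff_X] at hm
  have hmi : Finsupp.single i 1 ≠ m := by
    rintro rfl
    simp at hm
  rw [if_neg hmi, mul_zero, sub_zero] at hm
  have hle := hP m (mem_support_iff.2 hm)
  have hjm' : 1 ≤ m j := Nat.one_le_iff_ne_zero.2 (Finsupp.mem_support_iff.1 hjm)
  have hnn : ∀ l, 0 ≤ α l * (m l : ℝ) := fun l => mul_nonneg (hα.pos l).le (Nat.cast_nonneg _)
  have hle' : α j ≤ α j * (m j : ℝ) :=
    le_mul_of_one_le_right (hα.pos j).le (by exact_mod_cast hjm')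
  have hj1 : α j ≤ α i := hle'.trans
    ((Finset.single_le_sum (f := fun l => α l * (m l : ℝ)) (fun l _ => hnn l)
      (Finset.mem_univ j)).trans hle)
  by_contra hji
  rw [Set.mem_Ioi, not_lt] at hji
  have hij : j = i := by
    by_contra hne
    exact absurd (hα.lt_of_lt (lt_of_le_of_ne hji hne)) (not_lt.2 hj1)
  subst hij
  apply hmi
  rw [← Finset.add_sum_erase _ _ (Finset.mem_univ j)] at hle
  have h0 : ∑ l ∈ Finset.univ.erase j, α l * (m l : ℝ) = 0 :=
    le_antisymm (by linarith) (Finset.sum_nonneg fun l _ => hnn l)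
  have hmj : m j = 1 := by
    have : α j * (m j : ℝ) ≤ α j * 1 := by rw [h0] at hle; linarith
    have := le_of_mul_le_mul_left this (hα.pos j)
    exact le_antisymm (by exact_mod_cast this) hjm'
  ext l
  by_cases hl : l = j
  · subst hl; simp [hmj]
  · have := (Finset.sum_eq_zero_iff_of_nonneg (fun l _ => hnn l)).1 h0 l (by simp [hl])
    have h2 := (mul_eq_zero.1 this).resolve_left (hα.pos l).ne'
    rw [Finsupp.single_apply, if_neg (Ne.symm hl)]
    exact_mod_cast h2.symm

theorem PolyAut.pull_mem_supported {f : PolyAut k} {s : Set (Fin 3)}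
    (hf : ∀ j ∈ s, f.coords j ∈ supported k s) {P : MvPolynomial (Fin 3) k}
    (hP : P ∈ supported k s) : f.pull P ∈ supported k s := by
  have h1 : (supported k s).map (f.unop : MvPolynomial (Fin 3) k →ₐ[k] MvPolynomial (Fin 3) k) ≤
      supported k s := by
    conv_lhs => rw [supported_eq_adjoin_X]
    rw [AlgHom.map_adjoin, Algebra.adjoin_le_iff]
    rintro _ ⟨_, ⟨j, hj, rfl⟩, rfl⟩
    exact hf j hj
  exact h1 ⟨P, hP, rfl⟩

theorem coeff_single_of_mem_supported {i : Fin 3} {P : MvPolynomial (Fin 3) k}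
    (hP : P ∈ supported k (Set.Ioi i)) : coeff (Finsupp.single i 1) P = 0 := by
  by_contra h
  rw [mem_supported] at hP
  have : i ∈ P.vars := by
    rw [mem_vars_iff_mem_support]
    exact ⟨_, mem_support_iff.2 h, by simp⟩
  exact lt_irrefl _ (Set.mem_Ioi.1 (hP this))

theorem coords_mem_supported {α : Fin 3 → ℝ} (hα : StrictWeight α) {f : PolyAut k}
    (hf : ∀ i, DegLE α (α i) (f.coords i)) {i j : Fin 3} (hj : i < j) :
    f.coords j ∈ supported k (Set.Ioi i) := by
  obtain ⟨Q, hQ, h⟩ := (hf j).exists_eq_add hα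
  rw [h]
  refine add_mem (mul_mem ?_ ?_) ?_
  · exact Subalgebra.algebraMap_mem _ _
  · exact X_mem_supported.2 hj
  · exact supported_mono (Set.Ioi_subset_Ioi hj.le) hQ

/-- Composing the i-th component of f⁻¹ with f gives x_i. By triangularity its coefficient at x_i is
a multiple of the diagonal coefficient of f. -/
theorem coeff_single_coords_ne_zero {α : Fin 3 → ℝ} (hα : StrictWeight α) {f : PolyAut k}
    (hf : ∀ i, DegLE α (α i) (f.coords i)) (i : Fin 3) :
    coeff (Finsupp.single i 1) (f.coords i) ≠ 0 := by
  intro h0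
  have hinv : DegLE α (α i) (f⁻¹.coords i) := PolyAut.degLE_inv hα.pos hf (degLE_X α i)
  obtain ⟨Q, hQ, h⟩ := hinv.exists_eq_add hα
  set b := coeff (Finsupp.single i 1) (f⁻¹.coords i)
  have h1 : f.pull (f⁻¹.coords i) = X i := PolyAut.pull_inv_pull f _
  rw [h, f.pull_eq_aeval, map_add, map_mul, aeval_X, ← f.pull_eq_aeval, ← f.pull_eq_aeval] at h1
  have h2 : f.pull (C b) = C b := by rw [f.pull_eq_aeval, aeval_C]; rfl
  have h3 := congrArg (coeff (Finsupp.single i 1)) h1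
  rw [h2, coeff_add, coeff_C_mul, h0, coeff_single_of_mem_supported
    (PolyAut.pull_mem_supported (fun j hj => coords_mem_supported hα hf hj) hQ)] at h3
  simp at h3

theorem DegLE.le_of_coeff_ne_zero {β : Fin 3 → ℝ} {d : ℝ} {P : MvPolynomial (Fin 3) k}
    (hP : DegLE β d P) {i : Fin 3} (h : coeff (Finsupp.single i 1) P ≠ 0) : β i ≤ d := by
  have := hP _ (mem_support_iff.2 h)
  simpa [Finsupp.single_apply] using this

/-- The nonzero diagonal coefficients of f⁻¹g and of g⁻¹f bound the weights from both sides. So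
apartments through ν are glued only along equal weights, and each cell of the link has a
well-defined type in ∇⁺. -/
theorem valPt_eq_of_mem_tameStab {α β γ : Fin 3 → ℝ} (hα : StrictWeight α) (hγ : γ ∈ posWeights)
    {f g : PolyAut k} (hf : f ∈ tameStab (valPt 1 α))
    (hg : g ∈ tameStab (valPt 1 α)) (h : valPt f β = valPt g γ) :
    (∃ c : ℝ, 0 < c ∧ γ = c • β) ∧ f⁻¹ * g ∈ stabAt k α γ := by
  obtain ⟨c, hc, h1⟩ := degLE_iff_of_valPt_eq h
  have hd := degLE_of_mem_tameStab hα.pos (mul_mem (inv_mem hf) hg)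
  have hd' := degLE_of_mem_tameStab hα.pos (mul_mem (inv_mem hg) hf)
  have h2 : ∀ i, DegLE γ (c * β i) ((f⁻¹ * g).coords i) := fun i => by
    rw [PolyAut.coords_mul, h1, PolyAut.coords, PolyAut.pull_inv_pull]
    exact degLE_X β i
  have h3 : ∀ i, DegLE β (γ i / c) ((g⁻¹ * f).coords i) := fun i => by
    rw [PolyAut.coords_mul, ← h1, PolyAut.coords, PolyAut.pull_inv_pull, mul_div_cancel₀ _ hc.ne']
    exact degLE_X γ i
  have h4 : ∀ i, γ i = c * β i := fun i => by
    refine le_antisymm ((h2 i).le_of_coeff_ne_zero (coeff_single_coords_ne_zero hα hd i)) ?_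
    have := (h3 i).le_of_coeff_ne_zero (coeff_single_coords_ne_zero hα hd' i)
    rw [le_div_iff₀ hc] at this
    linarith
  refine ⟨⟨c, hc, funext fun i => by simp [h4]⟩, ?_⟩
  rw [mem_stabAt hγ]
  exact ⟨mul_mem (inv_mem hf) hg, fun i => by rw [h4]; exact h2 i⟩

theorem valPt_eq_of_inv_mul_mem {α β : Fin 3 → ℝ} {f g : PolyAut k} (h : f⁻¹ * g ∈ stabAt k α β) :
    valPt f β = valPt g β := by
  have h1 : (f⁻¹ * g) • valPt 1 β = valPt 1 β := h.2
  have h2 := congrArg (f • ·) h1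
  simp only [smul_valPt, mul_one, mul_inv_cancel_left] at h2
  exact h2.symm

/-- The weights `β` that satisfy the inequalities which are strict at `α`. -/
structure IsNearby (α β : Fin 3 → ℝ) : Prop where
  pos : β ∈ posWeights
  le0 : ∀ a b : ℕ, a * α 1 + b * α 2 < α 0 → a * β 1 + b * β 2 ≤ β 0
  le1 : ∀ b : ℕ, b * α 2 < α 1 → b * β 2 ≤ β 1

/-- The linear coordinates `x, y` at `[α]`. -/
def xCoord (α β : Fin 3 → ℝ) : ℝ := β 0 - α 0 / α 2 * β 2

/-- The linear coordinates `x, y` at `[α]`. -/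
def yCoord (α β : Fin 3 → ℝ) : ℝ := β 1 - α 1 / α 2 * β 2

theorem xCoord_sub {α : Fin 3 → ℝ} (hα : 0 < α 2) (β : Fin 3 → ℝ) {a b : ℕ}
    (h : a * α 1 + b * α 2 = α 0) :
    xCoord α β - a * yCoord α β = β 0 - (a * β 1 + b * β 2) := by
  rw [xCoord, yCoord, ← h]
  field_simp
  ring

theorem yCoord_eq {α : Fin 3 → ℝ} (hα : 0 < α 2) (β : Fin 3 → ℝ) {b : ℕ} (h : b * α 2 = α 1) :
    yCoord α β = β 1 - b * β 2 := by
  rw [yCoord, ← h]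
  field_simp

/-- The monomial `x₂ ^ a * x₃ ^ b`. -/
def mon (a b : ℕ) : Fin 3 →₀ ℕ := Finsupp.single 1 a + Finsupp.single 2 b

theorem sum_mon (β : Fin 3 → ℝ) (a b : ℕ) :
    ∑ i, β i * ((mon a b i : ℕ) : ℝ) = a * β 1 + b * β 2 := by
  simp [mon, Fin.sum_univ_three, Finsupp.single_apply]
  ring

theorem eq_mon {m : Fin 3 →₀ ℕ} (h : m 0 = 0) : m = mon (m 1) (m 2) := by
  ext i
  fin_cases i <;> simp [mon, h]

/-- Monomials of non-maximal weight at α impose nothing on nearby β, since `IsNearby` keeps their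
inequalities. Only the monomials of exact weight α₁ or α₂ matter, and each cuts out a half-plane. -/
theorem mem_stabAt_iff {α β : Fin 3 → ℝ} (hα : StrictWeight α) (hβ : IsNearby α β) {f : PolyAut k}
    (hf : f ∈ tameStab (valPt 1 α)) :
    f ∈ stabAt k α β ↔
      (∀ a b : ℕ, a * α 1 + b * α 2 = α 0 → coeff (mon a b) (f.coords 0) ≠ 0 →
        0 ≤ xCoord α β - a * yCoord α β) ∧
      (∀ b : ℕ, b * α 2 = α 1 → coeff (mon 0 b) (f.coords 1) ≠ 0 → 0 ≤ yCoord α β) := by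
  have h2 := hα.pos 2
  have hd := degLE_of_mem_tameStab hα.pos hf
  rw [mem_stabAt hβ.pos]
  constructor
  · rintro ⟨-, h⟩
    refine ⟨fun a b hab hc => ?_, fun b hb hc => ?_⟩
    · have := h 0 _ (mem_support_iff.2 hc)
      rw [sum_mon] at this
      rw [xCoord_sub h2 β hab]
      linarith
    · have := h 1 _ (mem_support_iff.2 hc)
      rw [sum_mon] at this
      rw [yCoord_eq h2 β hb]
      simp at this
      linarith
  · rintro ⟨h0, h1⟩
    refine ⟨hf, fun i m hm => ?_⟩
    by_cases hmi : m = Finsupp.single i 1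
    · subst hmi
      simp [Finsupp.single_apply]
    have hm' := hm
    obtain ⟨Q, hQ, hPQ⟩ := (hd i).exists_eq_add hα
    have hmQ : m ∈ Q.support := by
      classical
      rw [hPQ, mem_support_iff, coeff_add, coeff_C_mul, coeff_X, if_neg (Ne.symm hmi), mul_zero,
        zero_add] at hm
      exact mem_support_iff.2 hm
    have hz : ∀ j ≤ i, m j = 0 := by
      intro j hj
      by_contra hne
      have : j ∈ Q.vars := (mem_vars_iff_mem_support j).2 ⟨m, hmQ, by simpa using hne⟩
      exact absurd (mem_supported.1 hQ this) (not_lt.2 hj)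
    have hle := hd i m hm'
    have hmm := eq_mon (hz 0 (Fin.zero_le i))
    rw [hmm, sum_mon] at hle ⊢
    rw [hmm] at hm'
    fin_cases i
    · simp only [Fin.zero_eta] at hle hm' ⊢
      rcases hle.lt_or_eq with hlt | heq
      · exact hβ.le0 _ _ hlt
      · have := h0 _ _ heq (mem_support_iff.1 hm')
        rw [xCoord_sub h2 β heq] at this
        linarith
    · simp only [Fin.mk_one] at hle hm' hz ⊢
      rw [hz 1 le_rfl] at hle hm' ⊢
      rcases hle.lt_or_eq with hlt | heq
      · have := hβ.le1 (m 2) (by simpa using hlt)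
        simpa using this
      · have hh : (m 2 : ℝ) * α 2 = α 1 := by simpa using heq
        have := h1 _ hh (mem_support_iff.1 hm')
        rw [yCoord_eq h2 β hh] at this
        simp
        linarith
    · simp only [Fin.reduceFinMk] at hz ⊢
      rw [hz 1 (by decide), hz 2 le_rfl]
      simpa using (hβ.pos 2).le

end Stabiliser

/-! ### Cells of the Weyl chamber around a vertex -/

section Cells

theorem IsPreconnected.sign_eq {X : Type*} [TopologicalSpace X] {ρ : Set X} (hρ : IsPreconnected ρ)
    {φ : X → ℝ} (hφ : Continuous φ) (h0 : ∀ β ∈ ρ, φ β ≠ 0) {β γ : X} (hβ : β ∈ ρ) (hγ : γ ∈ ρ) :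
    SignType.sign (φ β) = SignType.sign (φ γ) := by
  have key : ∀ β ∈ ρ, ∀ γ ∈ ρ, 0 < φ β → 0 < φ γ := by
    intro β hβ γ hγ h
    by_contra hneg
    obtain ⟨z, hz, hz0⟩ := hρ.intermediate_value hγ hβ hφ.continuousOn ⟨not_lt.1 hneg, h.le⟩
    exact h0 z hz hz0
  rcases (h0 β hβ).lt_or_gt with h | h <;> rcases (h0 γ hγ).lt_or_gt with h' | h'
  · rw [sign_neg h, sign_neg h']
  · exact absurd (key γ hγ β hβ h') (not_lt.2 h.le)
  · exact absurd (key β hβ γ hγ h) (not_lt.2 h'.le)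
  · rw [sign_pos h, sign_pos h']

theorem IsPreconnected.pos_of_mem_closure {X : Type*} [TopologicalSpace X] {ρ : Set X}
    (hρ : IsPreconnected ρ) {φ : X → ℝ} (hφ : Continuous φ) (h0 : ∀ β ∈ ρ, φ β ≠ 0) {α : X}
    (hα : α ∈ closure ρ) (hpos : 0 < φ α) {β : X} (hβ : β ∈ ρ) : 0 < φ β := by
  obtain ⟨γ, hγ, hγρ⟩ := mem_closure_iff.1 hα _ (isOpen_lt continuous_const hφ) hpos
  have := hρ.sign_eq hφ h0 hβ hγρ
  rw [sign_pos (Set.mem_ofPred.1 hγ)] at this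
  exact sign_eq_one_iff.1 this

theorem sign_combo {u v a b : ℝ} (h : SignType.sign u = SignType.sign v) (ha : 0 ≤ a) (hb : 0 ≤ b)
    (hab : a + b = 1) : SignType.sign (a * u + b * v) = SignType.sign u := by
  rcases lt_trichotomy u 0 with hu | hu | hu
  · rw [sign_neg hu] at h ⊢
    have hv := sign_eq_neg_one_iff.1 h.symm
    refine sign_neg ?_
    rcases ha.eq_or_lt with rfl | ha
    · rw [zero_add] at hab; subst hab; linarith
    · nlinarith
  · subst hu
    rw [sign_zero] at h
    rw [sign_eq_zero_iff.1 h.symm]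
    simp
  · rw [sign_pos hu] at h ⊢
    have hv := sign_eq_one_iff.1 h.symm
    refine sign_pos ?_
    rcases ha.eq_or_lt with rfl | ha
    · rw [zero_add] at hab; subst hab; linarith
    · nlinarith

open scoped Classical in
/-- The exponents `a` of `x₂` in the monomials `x₂ ^ a * x₃ ^ b` of weight `α₁`. -/
def critSlopes (α : Fin 3 → ℝ) : Finset ℕ :=
  (Finset.range (⌊α 0 / α 1⌋₊ + 1)).filter fun a => ∃ b : ℕ, a * α 1 + b * α 2 = α 0

theorem mem_critSlopes {α : Fin 3 → ℝ} (hα : α ∈ posWeights) {a : ℕ} :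
    a ∈ critSlopes α ↔ ∃ b : ℕ, a * α 1 + b * α 2 = α 0 := by
  classical
  rw [critSlopes, Finset.mem_filter, Finset.mem_range, and_iff_right_of_imp]
  rintro ⟨b, hb⟩
  refine Nat.lt_succ_of_le (Nat.le_floor ?_)
  rw [le_div_iff₀ (hα 1), ← hb]
  have : 0 ≤ (b : ℝ) * α 2 := mul_nonneg (Nat.cast_nonneg _) (hα 2).le
  linarith

/-- `α₂` is a multiple of `α₃`. -/
def IsFlagged (α : Fin 3 → ℝ) : Prop := ∃ b : ℕ, b * α 2 = α 1

/-- The linear form that vanishes on the admissible line of slope `a` through `[α]`. -/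
def slopeForm (α : Fin 3 → ℝ) (a : ℕ) (β : Fin 3 → ℝ) : ℝ := xCoord α β - a * yCoord α β

theorem continuous_yCoord (α : Fin 3 → ℝ) : Continuous (yCoord α) := by
  unfold yCoord; fun_prop

theorem continuous_slopeForm (α : Fin 3 → ℝ) (a : ℕ) : Continuous (slopeForm α a) := by
  unfold slopeForm xCoord yCoord; fun_prop

theorem yCoord_combo (α β γ : Fin 3 → ℝ) (s t : ℝ) :
    yCoord α (s • β + t • γ) = s * yCoord α β + t * yCoord α γ := by
  simp [yCoord]; ring

theorem slopeForm_combo (α β γ : Fin 3 → ℝ) (a : ℕ) (s t : ℝ) :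
    slopeForm α a (s • β + t • γ) = s * slopeForm α a β + t * slopeForm α a γ := by
  simp [slopeForm, xCoord, yCoord]; ring

/-- `β` and `γ` lie on the same sides of all admissible lines through `[α]`. -/
def SameSign (α β γ : Fin 3 → ℝ) : Prop :=
  (∀ a ∈ critSlopes α, SignType.sign (slopeForm α a β) = SignType.sign (slopeForm α a γ)) ∧
    (IsFlagged α → SignType.sign (yCoord α β) = SignType.sign (yCoord α γ))

theorem SameSign.symm {α β γ : Fin 3 → ℝ} (h : SameSign α β γ) : SameSign α γ β :=
  ⟨fun a ha => (h.1 a ha).symm, fun hf => (h.2 hf).symm⟩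

theorem SameSign.trans {α β γ δ : Fin 3 → ℝ} (h : SameSign α β γ) (h' : SameSign α γ δ) :
    SameSign α β δ :=
  ⟨fun a ha => (h.1 a ha).trans (h'.1 a ha), fun hf => (h.2 hf).trans (h'.2 hf)⟩

theorem SameSign.combo {α β γ : Fin 3 → ℝ} (h : SameSign α β γ) {s t : ℝ} (hs : 0 ≤ s)
    (ht : 0 ≤ t) (hst : s + t = 1) : SameSign α (s • β + t • γ) β :=
  ⟨fun a ha => by rw [slopeForm_combo, sign_combo (h.1 a ha) hs ht hst],
    fun hf => by rw [yCoord_combo, sign_combo (h.2 hf) hs ht hst]⟩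

theorem sameSign_smul {α β : Fin 3 → ℝ} {c : ℝ} (hc : 0 < c) : SameSign α (c • β) β := by
  have h1 : ∀ u : ℝ, SignType.sign (c * u) = SignType.sign u := fun u => by
    rw [sign_mul, sign_pos hc, one_mul]
  refine ⟨fun a _ => ?_, fun _ => ?_⟩
  · rw [← h1 (slopeForm α a β)]
    congr 1
    simp [slopeForm, xCoord, yCoord]; ring
  · rw [← h1 (yCoord α β)]
    congr 1
    simp [yCoord]; ring

/-- The admissible line of slope `a` through `[α]`. -/
def slopeLine (α : Fin 3 → ℝ) (a : ℕ) : Set (Fin 3 → ℝ) := {β ∈ posWeights | slopeForm α a β = 0}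

/-- The line through `[α]` on which `β₂ / β₃` is constant. -/
def flagLine (α : Fin 3 → ℝ) : Set (Fin 3 → ℝ) := {β ∈ posWeights | yCoord α β = 0}

theorem isAdmissibleLine_slopeLine {α : Fin 3 → ℝ} (hα : α ∈ posWeights) {a : ℕ}
    (ha : a ∈ critSlopes α) : IsAdmissibleLine (slopeLine α a) := by
  obtain ⟨b, hb⟩ := (mem_critSlopes hα).1 ha
  refine ⟨1, a, b, ?_⟩
  ext β
  simp only [slopeLine, Set.mem_ofPred_eq, slopeForm, xCoord_sub (hα 2) β hb,
    Equiv.Perm.coe_one, id]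
  rw [sub_eq_zero]

theorem isAdmissibleLine_flagLine {α : Fin 3 → ℝ} (hα : α ∈ posWeights) (h : IsFlagged α) :
    IsAdmissibleLine (flagLine α) := by
  obtain ⟨b, hb⟩ := h
  refine ⟨Equiv.swap 0 1, 0, b, ?_⟩
  ext β
  have h2 : (Equiv.swap (0 : Fin 3) 1) 2 = 2 := by decide
  simp [flagLine, Set.mem_ofPred_eq, yCoord_eq (hα 2) β hb, sub_eq_zero, h2]

/-- Because α₁ > α₂ > α₃ > 0, a coordinate cannot be a combination in which a larger one occurs.
This leaves α₁ in terms of the other two, or α₂ as a multiple of α₃. -/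
theorem admissibleLine_through {α : Fin 3 → ℝ} (hα : StrictWeight α) {l : Set (Fin 3 → ℝ)}
    (hl : IsAdmissibleLine l) (hαl : α ∈ l) :
    (∃ a ∈ critSlopes α, l = slopeLine α a) ∨ (IsFlagged α ∧ l = flagLine α) := by
  obtain ⟨s, m, n, rfl⟩ := hl
  obtain ⟨-, h⟩ := hαl
  have hp := hα.pos
  have key : ∀ i : Fin 3, s i = 0 ∨ s i = 1 ∨ s i = 2 := fun i => by
    generalize s i = j; fin_cases j <;> simp
  have h01 : s 0 ≠ s 1 := s.injective.ne (by decide)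
  have h02 : s 0 ≠ s 2 := s.injective.ne (by decide)
  have h12 : s 1 ≠ s 2 := s.injective.ne (by decide)
  have hm : m = 0 ∨ 1 ≤ (m : ℝ) := by
    rcases Nat.eq_zero_or_pos m with h | h
    · exact Or.inl h
    · exact Or.inr (by exact_mod_cast h)
  have hn : n = 0 ∨ 1 ≤ (n : ℝ) := by
    rcases Nat.eq_zero_or_pos n with h | h
    · exact Or.inl h
    · exact Or.inr (by exact_mod_cast h)
  have p0 := hp 0
  have p1 := hp 1
  have p2 := hp 2
  have q1 := hα.lt01
  have q2 := hα.lt12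
  have mn : (0 : ℝ) ≤ m := Nat.cast_nonneg _
  have nn : (0 : ℝ) ≤ n := Nat.cast_nonneg _
  have slope : ∀ a b : ℕ, (a : ℝ) * α 1 + b * α 2 = α 0 →
      {β ∈ posWeights | β 0 = a * β 1 + b * β 2} = slopeLine α a ∧ a ∈ critSlopes α := by
    intro a b hab
    refine ⟨?_, (mem_critSlopes hp).2 ⟨b, hab⟩⟩
    ext β
    simp only [slopeLine, Set.mem_ofPred_eq, slopeForm, xCoord_sub p2 β hab]
    rw [sub_eq_zero]
  have flag : ∀ b : ℕ, (b : ℝ) * α 2 = α 1 →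
      {β ∈ posWeights | β 1 = b * β 2} = flagLine α := by
    intro b hb
    ext β
    simp only [flagLine, Set.mem_ofPred_eq, yCoord_eq p2 β hb, sub_eq_zero]
  rcases key 0 with e0 | e0 | e0 <;> rcases key 1 with e1 | e1 | e1 <;>
    rcases key 2 with e2 | e2 | e2 <;> simp only [e0, e1, e2, ne_eq, not_true] at h01 h02 h12 h ⊢
  · exact Or.inl ⟨m, (slope m n h.symm).2, (slope m n h.symm).1⟩
  · rw [add_comm] at h
    have := slope n m h.symm
    refine Or.inl ⟨n, this.2, ?_⟩
    rw [← this.1]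
    simp only [add_comm]
  · rcases hm with rfl | hm
    · simp only [Nat.cast_zero, zero_mul, zero_add] at h ⊢
      exact Or.inr ⟨⟨n, h.symm⟩, flag n h.symm⟩
    · nlinarith
  · rcases hn with rfl | hn
    · simp only [Nat.cast_zero, zero_mul, add_zero] at h ⊢
      exact Or.inr ⟨⟨m, h.symm⟩, flag m h.symm⟩
    · nlinarith
  · exfalso
    rcases hm with rfl | hm
    · rcases hn with rfl | hn
      · simp at h; linarith
      · simp at h; nlinarith
    · nlinarith
  · exfalso
    rcases hm with rfl | hm
    · rcases hn with rfl | hn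
      · simp at h; linarith
      · simp at h; nlinarith
    · nlinarith

/-- Admissible lines are locally finite: near α the coefficients m, n are bounded, and each of the
finitely many lines missing α misses a neighbourhood. -/
theorem eventually_admissible_through {α : Fin 3 → ℝ} (hα : α ∈ posWeights) :
    ∀ᶠ β : Fin 3 → ℝ in nhds α, ∀ (s : Equiv.Perm (Fin 3)) (m n : ℕ),
      β (s 0) = m * β (s 1) + n * β (s 2) → α (s 0) = m * α (s 1) + n * α (s 2) := by
  rw [Filter.eventually_all]
  intro s
  have hev : ∀ i, ∀ᶠ β : Fin 3 → ℝ in nhds α, α i / 2 < β i ∧ β i < 2 * α i := fun i =>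
    (continuous_apply i).continuousAt.eventually
      (Ioo_mem_nhds (by linarith [hα i]) (by linarith [hα i]))
  -- The coordinates of β are within a factor 2 of those of α, so a coefficient is at most 2 α(s 0)
  -- / (α(s i) / 2); this explains the 4.
  obtain ⟨K, hK⟩ := exists_nat_gt (max (4 * α (s 0) / α (s 1)) (4 * α (s 0) / α (s 2)))
  have hev2 : ∀ᶠ β : Fin 3 → ℝ in nhds α, ∀ mn ∈ Finset.range K ×ˢ Finset.range K,
      β (s 0) = mn.1 * β (s 1) + mn.2 * β (s 2) →
        α (s 0) = mn.1 * α (s 1) + mn.2 * α (s 2) := by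
    rw [Filter.eventually_all_finset]
    rintro ⟨m, n⟩ -
    by_cases h : α (s 0) = m * α (s 1) + n * α (s 2)
    · exact Filter.Eventually.of_forall fun _ _ => h
    · have : IsOpen {β : Fin 3 → ℝ | β (s 0) ≠ (m : ℝ) * β (s 1) + (n : ℝ) * β (s 2)} :=
        isOpen_ne_fun (by fun_prop) (by fun_prop)
      filter_upwards [this.mem_nhds h] with β hβ hβ'
      exact absurd hβ' hβ
  filter_upwards [hev (s 0), hev (s 1), hev (s 2), hev2] with β h0 h1 h2 h3 m n hmn
  have bound : ∀ (i : Fin 3) (m : ℕ), 4 * α (s 0) / α i < K → α i / 2 < β i →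
      m * β i ≤ β (s 0) → m < K := by
    intro i m hi hb hm
    rw [div_lt_iff₀ (hα i)] at hi
    by_contra hlt
    have hKm : (K : ℝ) ≤ m := by exact_mod_cast not_lt.1 hlt
    have hi0 := hα i
    have : (K : ℝ) * (α i / 2) ≤ m * β i :=
      mul_le_mul hKm hb.le (by linarith) (Nat.cast_nonneg _)
    linarith
  have p1 : 0 ≤ (m : ℝ) * β (s 1) :=
    mul_nonneg (Nat.cast_nonneg _) (by linarith [hα (s 1)])
  have p2 : 0 ≤ (n : ℝ) * β (s 2) :=
    mul_nonneg (Nat.cast_nonneg _) (by linarith [hα (s 2)])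
  exact h3 (m, n) (Finset.mem_product.2
    ⟨Finset.mem_range.2 (bound _ m ((le_max_left _ _).trans_lt hK) h1.1 (by linarith)),
      Finset.mem_range.2 (bound _ n ((le_max_right _ _).trans_lt hK) h2.1 (by linarith))⟩) hmn

theorem exists_ball_through {α : Fin 3 → ℝ} (hα : α ∈ posWeights) :
    ∃ ε > 0, ∀ β ∈ Metric.ball α ε, ∀ l, IsAdmissibleLine l → β ∈ l → α ∈ l := by
  obtain ⟨ε, hε, h⟩ := Metric.eventually_nhds_iff.1 (eventually_admissible_through hα)
  refine ⟨ε, hε, ?_⟩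
  rintro β hβ l ⟨s, m, n, rfl⟩ ⟨-, hl⟩
  exact ⟨hα, h hβ s m n hl⟩

theorem convex_chamberWeights : Convex ℝ chamberWeights := by
  rintro β ⟨hβ, h1, h2⟩ γ ⟨hγ, h1', h2'⟩ s t hs ht hst
  have hlin : ∀ i, (s • β + t • γ) i = s * β i + t * γ i := fun i => by simp
  refine ⟨fun i => ?_, ?_, ?_⟩
  · rw [hlin]
    rcases hs.eq_or_lt with rfl | hs
    · rw [zero_add] at hst; subst hst; simpa using hγ i
    · have := hβ i
      have := hγ i
      positivity
  · rw [hlin, hlin]; nlinarith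
  · rw [hlin, hlin]; nlinarith

theorem smul_mem_admissibleLine {α : Fin 3 → ℝ} {l : Set (Fin 3 → ℝ)} (hl : IsAdmissibleLine l)
    {c : ℝ} (hc : 0 < c) (h : α ∈ l) : c • α ∈ l := by
  obtain ⟨s, m, n, rfl⟩ := hl
  refine ⟨fun i => mul_pos hc (h.1 i), ?_⟩
  simp only [Pi.smul_apply, smul_eq_mul, h.2]
  ring

theorem smul_mem_vertexWeights {α : Fin 3 → ℝ} (h : α ∈ vertexWeights) {c : ℝ} (hc : 0 < c) :
    c • α ∈ vertexWeights := by
  obtain ⟨⟨hp, h1, h2⟩, l, l', hl, hl', hne, hm, hm'⟩ := h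
  refine ⟨⟨fun i => mul_pos hc (hp i), ?_, ?_⟩, l, l', hl, hl', hne,
    smul_mem_admissibleLine hl hc hm, smul_mem_admissibleLine hl' hc hm'⟩
  · exact mul_le_mul_of_nonneg_left h1 hc.le
  · exact mul_le_mul_of_nonneg_left h2 hc.le

theorem eq_smul_of_coord_eq_zero {α β : Fin 3 → ℝ} (hα : 0 < α 2) (hx : xCoord α β = 0)
    (hy : yCoord α β = 0) : β = (β 2 / α 2) • α := by
  rw [xCoord, sub_eq_zero] at hx
  rw [yCoord, sub_eq_zero] at hy
  ext i
  fin_cases i <;> simp [hx, hy] <;> field_simp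

/-- The properties that open edges and open faces with `[α]` in their closure have in common. -/
structure IsCellAt (α : Fin 3 → ℝ) (ρ : Set (Fin 3 → ℝ)) : Prop where
  preconn : IsPreconnected ρ
  mem_closure : α ∈ closure ρ
  sub : ρ ⊆ chamberWeights
  dich : ∀ l, IsAdmissibleLine l → ρ ⊆ l ∨ ∀ β ∈ ρ, β ∉ l

theorem IsCellAt.nonempty {α : Fin 3 → ℝ} {ρ : Set (Fin 3 → ℝ)} (h : IsCellAt α ρ) : ρ.Nonempty :=
  closure_nonempty_iff.1 ⟨α, h.mem_closure⟩

/-- A strict inequality at α belongs to a line not through α. The cell has α in its closure, so it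
is not contained in this line. It is therefore disjoint from it, and connectedness carries the sign
at α to the whole cell. -/
theorem IsCellAt.isNearby {α : Fin 3 → ℝ} {ρ : Set (Fin 3 → ℝ)} (h : IsCellAt α ρ)
    {β : Fin 3 → ℝ} (hβ : β ∈ ρ) : IsNearby α β := by
  have key : ∀ (s : Equiv.Perm (Fin 3)) (m n : ℕ), m * α (s 1) + n * α (s 2) < α (s 0) →
      m * β (s 1) + n * β (s 2) < β (s 0) := by
    intro s m n hlt
    have hc : Continuous fun β : Fin 3 → ℝ => β (s 0) - (m * β (s 1) + n * β (s 2)) := by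
      fun_prop
    have h0 : ∀ γ ∈ ρ, γ (s 0) - (m * γ (s 1) + n * γ (s 2)) ≠ 0 := by
      intro γ hγ h0
      rcases h.dich _ ⟨s, m, n, rfl⟩ with hl | hl
      · have hsub : ρ ⊆ {β : Fin 3 → ℝ | β (s 0) - (m * β (s 1) + n * β (s 2)) = 0} :=
          fun γ hγ => sub_eq_zero.2 (hl hγ).2
        have := closure_minimal hsub (isClosed_eq hc continuous_const) h.mem_closure
        rw [Set.mem_ofPred_eq] at this
        linarith
      · exact hl γ hγ ⟨(h.sub hγ).1, sub_eq_zero.1 h0⟩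
    have := h.preconn.pos_of_mem_closure hc h0 h.mem_closure (by linarith) hβ
    linarith
  refine ⟨(h.sub hβ).1, fun a b hab => (key 1 a b hab).le, fun b hb => ?_⟩
  have h2 : (Equiv.swap (0 : Fin 3) 1) 2 = 2 := by decide
  have := key (Equiv.swap 0 1) 0 b (by simpa [h2] using hb)
  simpa [h2] using this.le

theorem IsCellAt.sameSign {α : Fin 3 → ℝ} (hα : α ∈ posWeights) {ρ : Set (Fin 3 → ℝ)}
    (h : IsCellAt α ρ) {β γ : Fin 3 → ℝ} (hβ : β ∈ ρ) (hγ : γ ∈ ρ) : SameSign α β γ := by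
  refine ⟨fun a ha => ?_, fun hf => ?_⟩
  · rcases h.dich _ (isAdmissibleLine_slopeLine hα ha) with hl | hl
    · rw [(hl hβ).2, (hl hγ).2]
    · exact h.preconn.sign_eq (continuous_slopeForm α a)
        (fun δ hδ h0 => hl δ hδ ⟨(h.sub hδ).1, h0⟩) hβ hγ
  · rcases h.dich _ (isAdmissibleLine_flagLine hα hf) with hl | hl
    · rw [(hl hβ).2, (hl hγ).2]
    · exact h.preconn.sign_eq (continuous_yCoord α)
        (fun δ hδ h0 => hl δ hδ ⟨(h.sub hδ).1, h0⟩) hβ hγ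

theorem IsOpenFace.isCellAt {α : Fin 3 → ℝ} {σ : Set (Fin 3 → ℝ)} (h : IsOpenFace σ)
    (hα : α ∈ closure σ) : IsCellAt α σ := by
  obtain ⟨β, hβ, rfl⟩ := h
  have hsub := connectedComponentIn_subset (chamberWeights \ ⋃₀ {l | IsAdmissibleLine l}) β
  exact ⟨isPreconnected_connectedComponentIn, hα, fun γ hγ => (hsub hγ).1,
    fun l hl => Or.inr fun γ hγ hγl => (hsub hγ).2 ⟨l, hl, hγl⟩⟩

theorem isClosed_admissible (s : Equiv.Perm (Fin 3)) (m n : ℕ) :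
    IsClosed {α : Fin 3 → ℝ | α (s 0) = m * α (s 1) + n * α (s 2)} :=
  isClosed_eq (by fun_prop) (by fun_prop)

theorem IsOpenEdge.exists_line {α : Fin 3 → ℝ} (hα : α ∈ posWeights) {τ : Set (Fin 3 → ℝ)}
    (h : IsOpenEdge τ) (hατ : α ∈ closure τ) :
    ∃ l, IsAdmissibleLine l ∧ α ∈ l ∧ τ ⊆ (l ∩ chamberWeights) \ vertexWeights ∧
      IsPreconnected τ ∧
      ∀ β ∈ τ, τ = connectedComponentIn ((l ∩ chamberWeights) \ vertexWeights) β := by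
  obtain ⟨l, hl, β, hβ, rfl⟩ := h
  have hsub := connectedComponentIn_subset ((l ∩ chamberWeights) \ vertexWeights) β
  refine ⟨l, hl, ?_, hsub, isPreconnected_connectedComponentIn,
    fun γ hγ => connectedComponentIn_eq hγ⟩
  obtain ⟨s, m, n, rfl⟩ := hl
  exact ⟨hα, closure_minimal (fun γ hγ => (hsub hγ).1.1.2) (isClosed_admissible s m n) hατ⟩

theorem IsOpenEdge.isCellAt {α : Fin 3 → ℝ} (hα : α ∈ posWeights) {τ : Set (Fin 3 → ℝ)}
    (h : IsOpenEdge τ) (hατ : α ∈ closure τ) : IsCellAt α τ := by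
  obtain ⟨l, hl, -, hsub, hpre, -⟩ := h.exists_line hα hατ
  refine ⟨hpre, hατ, fun γ hγ => (hsub hγ).1.2, fun l' hl' => ?_⟩
  by_cases hll : l = l'
  · exact Or.inl fun γ hγ => hll ▸ (hsub hγ).1.1
  · exact Or.inr fun γ hγ hγ' =>
      (hsub hγ).2 ⟨(hsub hγ).1.2, l, l', hl, hl', hll, (hsub hγ).1.1, hγ'⟩

/-- `β` is on no admissible line through `[α]`. -/
def IsSectorPt (α β : Fin 3 → ℝ) : Prop :=
  (∀ a ∈ critSlopes α, slopeForm α a β ≠ 0) ∧ (IsFlagged α → yCoord α β ≠ 0)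

/-- `β` is on an admissible line through `[α]`, but not over `[α]`. -/
def IsRayPt (α β : Fin 3 → ℝ) : Prop :=
  ((∃ a ∈ critSlopes α, slopeForm α a β = 0) ∨ (IsFlagged α ∧ yCoord α β = 0)) ∧
    ¬ (xCoord α β = 0 ∧ yCoord α β = 0)

theorem IsOpenFace.isSectorPt {α : Fin 3 → ℝ} (hα : α ∈ posWeights) {σ : Set (Fin 3 → ℝ)}
    (h : IsOpenFace σ) {β : Fin 3 → ℝ} (hβ : β ∈ σ) : IsSectorPt α β := by
  obtain ⟨γ, hγ, rfl⟩ := h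
  have hsub := connectedComponentIn_subset (chamberWeights \ ⋃₀ {l | IsAdmissibleLine l}) γ hβ
  exact ⟨fun a ha h0 => hsub.2 ⟨_, isAdmissibleLine_slopeLine hα ha, hsub.1.1, h0⟩,
    fun hf h0 => hsub.2 ⟨_, isAdmissibleLine_flagLine hα hf, hsub.1.1, h0⟩⟩

theorem IsOpenEdge.isRayPt {α : Fin 3 → ℝ} (hα : StrictWeight α) (hv : α ∈ vertexWeights)
    {τ : Set (Fin 3 → ℝ)} (h : IsOpenEdge τ) (hατ : α ∈ closure τ) {β : Fin 3 → ℝ} (hβ : β ∈ τ) :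
    IsRayPt α β := by
  obtain ⟨l, hl, hαl, hsub, -, -⟩ := h.exists_line hα.pos hατ
  refine ⟨?_, ?_⟩
  · rcases admissibleLine_through hα hl hαl with ⟨a, ha, rfl⟩ | ⟨hf, rfl⟩
    · exact Or.inl ⟨a, ha, (hsub hβ).1.1.2⟩
    · exact Or.inr ⟨hf, (hsub hβ).1.1.2⟩
  · rintro ⟨hx, hy⟩
    rw [eq_smul_of_coord_eq_zero (hα.pos 2) hx hy] at hβ
    exact (hsub hβ).2 (smul_mem_vertexWeights hv
      (div_pos (by
        have := (hsub hβ).1.1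
        rw [← eq_smul_of_coord_eq_zero (hα.pos 2) hx hy] at this
        obtain ⟨s, m, n, rfl⟩ := hl
        exact this.1 2) (hα.pos 2)))

/-- Join a point of each face, both close to α. The segment meets no line through α because the
signs agree, and no other line because of local finiteness. -/
theorem IsOpenFace.eq_of_sameSign {α : Fin 3 → ℝ} (hα : StrictWeight α)
    {σ σ' : Set (Fin 3 → ℝ)} (h : IsOpenFace σ) (h' : IsOpenFace σ') (hc : α ∈ closure σ)
    (hc' : α ∈ closure σ') {β β' : Fin 3 → ℝ} (hβ : β ∈ σ) (hβ' : β' ∈ σ')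
    (hs : SameSign α β β') : σ = σ' := by
  obtain ⟨ε, hε, hball⟩ := exists_ball_through hα.pos
  obtain ⟨γ, hγ, hγε⟩ := Metric.mem_closure_iff.1 hc ε hε
  obtain ⟨γ', hγ', hγε'⟩ := Metric.mem_closure_iff.1 hc' ε hε
  have hcell := h.isCellAt hc
  have hcell' := h'.isCellAt hc'
  have hss : SameSign α γ γ' :=
    ((hcell.sameSign hα.pos hγ hβ).trans hs).trans (hcell'.sameSign hα.pos hβ' hγ')
  have hpt := h.isSectorPt hα.pos hγ
  have hsub : segment ℝ γ γ' ⊆ chamberWeights \ ⋃₀ {l | IsAdmissibleLine l} := by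
    intro z hz
    refine ⟨convex_chamberWeights.segment_subset (hcell.sub hγ) (hcell'.sub hγ') hz, ?_⟩
    rintro ⟨l, hl, hzl⟩
    have hzb : z ∈ Metric.ball α ε := (convex_ball α ε).segment_subset
      (by rwa [Metric.mem_ball, dist_comm]) (by rwa [Metric.mem_ball, dist_comm]) hz
    obtain ⟨s, t, hs0, ht0, hst, rfl⟩ := hz
    have hsz := hss.combo hs0 ht0 hst
    rcases admissibleLine_through hα hl (hball _ hzb l hl hzl) with ⟨a, ha, rfl⟩ | ⟨hf, rfl⟩
    · have := hsz.1 a ha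
      rw [hzl.2, sign_zero] at this
      exact hpt.1 a ha (sign_eq_zero_iff.1 this.symm)
    · have := hsz.2 hf
      rw [hzl.2, sign_zero] at this
      exact hpt.2 hf (sign_eq_zero_iff.1 this.symm)
  obtain ⟨δ, -, rfl⟩ := h
  obtain ⟨δ', -, rfl⟩ := h'
  have := (convex_segment γ γ').isPreconnected.subset_connectedComponentIn
    (left_mem_segment ℝ γ γ') hsub (right_mem_segment ℝ γ γ')
  rw [connectedComponentIn_eq hγ, connectedComponentIn_eq hγ', connectedComponentIn_eq this]

/-- The argument for faces, inside one line. If the segment met a second line, that line would pass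
through α, and the common signs would put an endpoint on it too, making a point of an open edge a
vertex. -/
theorem IsOpenEdge.eq_of_sameSign {α : Fin 3 → ℝ} (hα : StrictWeight α)
    {τ τ' : Set (Fin 3 → ℝ)} (h : IsOpenEdge τ) (h' : IsOpenEdge τ') (hc : α ∈ closure τ)
    (hc' : α ∈ closure τ') {β β' : Fin 3 → ℝ} (hβ : β ∈ τ) (hβ' : β' ∈ τ')
    (hs : SameSign α β β') : τ = τ' := by
  obtain ⟨ε, hε, hball⟩ := exists_ball_through hα.pos
  obtain ⟨γ, hγ, hγε⟩ := Metric.mem_closure_iff.1 hc ε hε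
  obtain ⟨γ', hγ', hγε'⟩ := Metric.mem_closure_iff.1 hc' ε hε
  have hcell := h.isCellAt hα.pos hc
  have hcell' := h'.isCellAt hα.pos hc'
  have hss : SameSign α γ γ' :=
    ((hcell.sameSign hα.pos hγ hβ).trans hs).trans (hcell'.sameSign hα.pos hβ' hγ')
  obtain ⟨l, hl, hαl, hτ, -, hτc⟩ := h.exists_line hα.pos hc
  obtain ⟨l', hl', hαl', hτ', -, hτc'⟩ := h'.exists_line hα.pos hc'
  have transfer : ∀ l'' δ δ', IsAdmissibleLine l'' → α ∈ l'' → δ' ∈ posWeights →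
      SameSign α δ δ' → δ ∈ l'' → δ' ∈ l'' := by
    intro l'' δ δ' hl'' hα'' hδ' hsd hδ
    rcases admissibleLine_through hα hl'' hα'' with ⟨a, ha, rfl⟩ | ⟨hf, rfl⟩
    · have := hsd.1 a ha
      rw [hδ.2, sign_zero] at this
      exact ⟨hδ', sign_eq_zero_iff.1 this.symm⟩
    · have := hsd.2 hf
      rw [hδ.2, sign_zero] at this
      exact ⟨hδ', sign_eq_zero_iff.1 this.symm⟩
  have hll : l = l' := by
    by_contra hne
    exact (hτ hγ).2 ⟨(hτ hγ).1.2, l, l', hl, hl', hne, (hτ hγ).1.1,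
      transfer l' γ' γ hl' hαl' (hcell.sub hγ).1 hss.symm (hτ' hγ').1.1⟩
  subst hll
  have hsub : segment ℝ γ γ' ⊆ (l ∩ chamberWeights) \ vertexWeights := by
    intro z hz
    have hzc := convex_chamberWeights.segment_subset (hcell.sub hγ) (hcell'.sub hγ') hz
    have hzb : z ∈ Metric.ball α ε := (convex_ball α ε).segment_subset
      (by rwa [Metric.mem_ball, dist_comm]) (by rwa [Metric.mem_ball, dist_comm]) hz
    obtain ⟨s, t, hs0, ht0, hst, rfl⟩ := hz
    have hsz := hss.combo hs0 ht0 hst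
    have hzl := transfer l _ _ hl hαl hzc.1 hsz.symm (hτ hγ).1.1
    refine ⟨⟨hzl, hzc⟩, ?_⟩
    rintro ⟨-, l₁, l₂, hl₁, hl₂, hne, hz₁, hz₂⟩
    have conc : ∀ l₃, IsAdmissibleLine l₃ → l ≠ l₃ → s • γ + t • γ' ∉ l₃ := fun l₃ hl₃ hn hz₃ =>
      (hτ hγ).2 ⟨(hτ hγ).1.2, l, l₃, hl, hl₃, hn, (hτ hγ).1.1,
        transfer l₃ _ _ hl₃ (hball _ hzb _ hl₃ hz₃) (hcell.sub hγ).1 hsz hz₃⟩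
    by_cases h1 : l = l₁
    · exact conc l₂ hl₂ (h1 ▸ hne) hz₂
    · exact conc l₁ hl₁ h1 hz₁
  have := (convex_segment γ γ').isPreconnected.subset_connectedComponentIn
    (left_mem_segment ℝ γ γ') hsub (right_mem_segment ℝ γ γ')
  rw [hτc γ hγ, hτc' γ' hγ', connectedComponentIn_eq this]

end Cells

/-! ### The rank of a direction in the line arrangement -/

section Heights

open scoped Classical in
/-- The rank of the direction `(x, y)` among the cells of the arrangement of the lines `x = a y`,
`a ∈ D`, and, if `fl`, of the line `y = 0`, counted on both sides from the direction `(-1, 0)`. -/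
def hgt (D : Finset ℕ) (fl : Prop) (x y : ℝ) : ℕ :=
  (D.filter fun a : ℕ => 0 < x - a * y).card + (D.filter fun a : ℕ => 0 ≤ x - a * y).card +
    if fl then (if y = 0 then (if 0 < x then 2 else 0) else 1) else 0

open scoped Classical in
/-- The rank of the direction `(1, 0)`. -/
def topHgt (D : Finset ℕ) (fl : Prop) : ℕ := 2 * D.card + if fl then 2 else 0

variable {D : Finset ℕ} {fl : Prop} {x y x' y' : ℝ}

theorem sub_mul_mul_le {c c' : ℝ} (hy : y * c' = y' * c) (h : x * c' ≤ x' * c) (a : ℕ) :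
    (x - a * y) * c' ≤ (x' - a * y') * c := by
  have : (a : ℝ) * (y * c') = a * (y' * c) := by rw [hy]
  nlinarith

theorem nonneg_imp_of_mul_le {c c' : ℝ} (hc : 0 < c) (hc' : 0 < c') (hy : y * c' = y' * c)
    (h : x * c' ≤ x' * c) (a : ℕ) :
    (0 ≤ x - a * y → 0 ≤ x' - a * y') ∧ (0 < x - a * y → 0 < x' - a * y') := by
  have := sub_mul_mul_le hy h a
  refine ⟨fun h => ?_, fun h => ?_⟩
  · exact nonneg_of_mul_nonneg_left ((mul_nonneg h hc'.le).trans this) hc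
  · exact pos_of_mul_pos_left ((mul_pos h hc').trans_le this) hc.le

/-- On one side of y = 0 the directions are linearly ordered by x / |y|, and every form x - a y
respects this order. So one implication holds for all a simultaneously. -/
theorem nonneg_imp_or (h : 0 < y * y') :
    (∀ a : ℕ, (0 ≤ x - a * y → 0 ≤ x' - a * y') ∧ (0 < x - a * y → 0 < x' - a * y')) ∨
    (∀ a : ℕ, (0 ≤ x' - a * y' → 0 ≤ x - a * y) ∧ (0 < x' - a * y' → 0 < x - a * y)) := by
  have hy0 : y ≠ 0 := by rintro rfl; simp at h
  have hy0' : y' ≠ 0 := by rintro rfl; simp at h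
  have hyy : y * |y'| = y' * |y| := by
    rcases pos_and_pos_or_neg_and_neg_of_mul_pos h with ⟨h1, h2⟩ | ⟨h1, h2⟩
    · rw [abs_of_pos h1, abs_of_pos h2, mul_comm]
    · rw [abs_of_neg h1, abs_of_neg h2]; ring
  rcases le_total (x * |y'|) (x' * |y|) with hle | hle
  · exact Or.inl (nonneg_imp_of_mul_le (abs_pos.2 hy0) (abs_pos.2 hy0') hyy hle)
  · exact Or.inr (nonneg_imp_of_mul_le (abs_pos.2 hy0') (abs_pos.2 hy0) hyy.symm hle)

theorem sign_eq_sign_iff {u v : ℝ} :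
    SignType.sign u = SignType.sign v ↔ ((0 < u ↔ 0 < v) ∧ (0 ≤ u ↔ 0 ≤ v)) := by
  have key : ∀ w : ℝ, (w < 0 ∧ SignType.sign w = -1 ∧ ¬ 0 < w ∧ ¬ 0 ≤ w) ∨
      (SignType.sign w = 0 ∧ ¬ 0 < w ∧ 0 ≤ w) ∨ (SignType.sign w = 1 ∧ 0 < w ∧ 0 ≤ w) := fun w => by
    rcases lt_trichotomy w 0 with h | rfl | h
    · exact Or.inl ⟨h, sign_neg h, h.not_gt, h.not_ge⟩
    · exact Or.inr (Or.inl ⟨sign_zero, lt_irrefl _, le_rfl⟩)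
    · exact Or.inr (Or.inr ⟨sign_pos h, h, h.le⟩)
  rcases key u with h | h | h <;> rcases key v with h' | h' | h' <;> simp [h, h']

/-- The two sets counted by the rank can only grow; if the rank does not, they are unchanged, and so
are all signs. -/
theorem hgt_le_of_imp
    (h : ∀ a : ℕ, (0 ≤ x - a * y → 0 ≤ x' - a * y') ∧ (0 < x - a * y → 0 < x' - a * y'))
    (hy : y ≠ 0) (hy' : y' ≠ 0) :
    hgt D fl x y ≤ hgt D fl x' y' ∧
      (hgt D fl x' y' ≤ hgt D fl x y → ∀ a ∈ D,
        SignType.sign (x - a * y) = SignType.sign (x' - a * y')) := by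
  classical
  have h1 : (D.filter fun a : ℕ => 0 < x - a * y) ⊆ D.filter fun a : ℕ => 0 < x' - a * y' :=
    Finset.monotone_filter_right D fun a _ => (h a).2
  have h2 : (D.filter fun a : ℕ => 0 ≤ x - a * y) ⊆ D.filter fun a : ℕ => 0 ≤ x' - a * y' :=
    Finset.monotone_filter_right D fun a _ => (h a).1
  have c1 := Finset.card_le_card h1
  have c2 := Finset.card_le_card h2
  simp only [hgt, if_neg hy, if_neg hy']
  refine ⟨by gcongr, fun hle a ha => ?_⟩
  have e1 := Finset.eq_of_subset_of_card_le h1 (by omega)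
  have e2 := Finset.eq_of_subset_of_card_le h2 (by omega)
  have m1 := congrArg (a ∈ ·) e1
  have m2 := congrArg (a ∈ ·) e2
  simp only [Finset.mem_filter, ha, true_and, eq_iff_iff] at m1 m2
  exact sign_eq_sign_iff.2 ⟨m1, m2⟩

theorem sign_eq_of_hgt_eq (h : 0 < y * y') (he : hgt D fl x y = hgt D fl x' y') :
    ∀ a ∈ D, SignType.sign (x - a * y) = SignType.sign (x' - a * y') := by
  have hy0 : y ≠ 0 := by rintro rfl; simp at h
  have hy0' : y' ≠ 0 := by rintro rfl; simp at h
  rcases nonneg_imp_or (x := x) (x' := x') h with hd | hd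
  · exact (hgt_le_of_imp hd hy0 hy0').2 he.ge
  · exact fun a ha => ((hgt_le_of_imp hd hy0' hy0).2 he.le a ha).symm

theorem nonneg_of_hgt_le (h : 0 < y * y') (he : hgt D fl x y ≤ hgt D fl x' y') :
    ∀ a ∈ D, 0 ≤ x - a * y → 0 ≤ x' - a * y' := by
  have hy0 : y ≠ 0 := by rintro rfl; simp at h
  have hy0' : y' ≠ 0 := by rintro rfl; simp at h
  rcases nonneg_imp_or (x := x) (x' := x') h with hd | hd
  · exact fun a _ => (hd a).1
  · exact fun a ha => ((sign_eq_sign_iff.1 ((hgt_le_of_imp hd hy0' hy0).2 he a ha)).2).2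

theorem hgt_of_y_eq_zero_of_pos (hx : 0 < x) : hgt D fl x 0 = topHgt D fl := by
  classical
  simp [hgt, topHgt, hx, hx.le]
  ring

theorem hgt_of_y_eq_zero_of_neg (hx : x < 0) : hgt D fl x 0 = 0 := by
  classical
  simp [hgt, hx.not_gt, hx.not_ge]

theorem y_ne_zero_of_hgt (h0 : ¬(x = 0 ∧ y = 0)) (h1 : 0 < hgt D fl x y)
    (h2 : hgt D fl x y < topHgt D fl) : y ≠ 0 := by
  rintro rfl
  have hx : x ≠ 0 := fun h => h0 ⟨h, rfl⟩
  rcases hx.lt_or_gt with h | h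
  · rw [hgt_of_y_eq_zero_of_neg h] at h1
    exact lt_irrefl _ h1
  · rw [hgt_of_y_eq_zero_of_pos h] at h2
    exact lt_irrefl _ h2

theorem hgt_le_topHgt : hgt D fl x y ≤ topHgt D fl := by
  classical
  have h1 := Finset.card_filter_le D fun a : ℕ => 0 < x - a * y
  have h2 := Finset.card_filter_le D fun a : ℕ => 0 ≤ x - a * y
  unfold hgt topHgt
  split_ifs <;> omega

theorem of_hgt_eq_topHgt (h : hgt D fl x y = topHgt D fl) :
    (∀ a ∈ D, 0 < x - a * y) ∧ (fl → y = 0 ∧ 0 < x) := by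
  classical
  have h1 := Finset.card_filter_le D fun a : ℕ => 0 < x - a * y
  have h2 := Finset.card_filter_le D fun a : ℕ => 0 ≤ x - a * y
  unfold hgt topHgt at h
  constructor
  · have h3 : (D.filter fun a : ℕ => 0 < x - a * y).card = D.card := by
      split_ifs at h <;> omega
    exact Finset.card_filter_eq_iff.1 h3
  · intro hf
    rw [if_pos hf, if_pos hf] at h
    split_ifs at h with h3 h4
    · exact ⟨h3, h4⟩
    · omega
    · omega

theorem of_hgt_eq_zero (h : hgt D fl x y = 0) :
    (∀ a ∈ D, x - a * y < 0) ∧ (fl → y = 0 ∧ x ≤ 0) := by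
  classical
  unfold hgt at h
  have h2 : (D.filter fun a : ℕ => 0 ≤ x - a * y).card = 0 := by omega
  have h3 : (if fl then (if y = 0 then (if 0 < x then 2 else 0) else 1) else 0) = 0 := by omega
  refine ⟨fun a ha => ?_, fun hf => ?_⟩
  · rw [Finset.card_eq_zero, Finset.filter_eq_empty_iff] at h2
    exact not_le.1 (h2 ha)
  · rw [if_pos hf] at h3
    split_ifs at h3 with h4 h5
    · exact ⟨h4, not_lt.1 h5⟩

/-- `(x, y)` and `(x', y')` lie on the same sides of all lines of the arrangement. -/
def SameSignXY (D : Finset ℕ) (fl : Prop) (x y x' y' : ℝ) : Prop :=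
  (∀ a ∈ D, SignType.sign (x - a * y) = SignType.sign (x' - a * y')) ∧
    (fl → SignType.sign y = SignType.sign y')

theorem mul_pos_of_pos_iff (hy : y ≠ 0) (hy' : y' ≠ 0) (h : 0 < y ↔ 0 < y') : 0 < y * y' := by
  rcases hy.lt_or_gt with h1 | h1
  · exact mul_pos_of_neg_of_neg h1 (hy'.lt_or_gt.resolve_right fun h2 => h1.not_gt (h.2 h2))
  · exact mul_pos h1 (h.1 h1)

theorem sign_eq_of_pos_iff (hy : y ≠ 0) (hy' : y' ≠ 0) (h : 0 < y ↔ 0 < y') :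
    SignType.sign y = SignType.sign y' := by
  refine sign_eq_sign_iff.2 ⟨h, ?_⟩
  rw [le_iff_lt_or_eq, le_iff_lt_or_eq, h]
  simp [hy.symm, hy'.symm]

/-- Rank and side determine the cell. The side is needed only strictly between bottom and top, since
each extreme rank belongs to a single cell. -/
theorem sameSignXY_of_hgt_eq (h0 : ¬(x = 0 ∧ y = 0)) (h0' : ¬(x' = 0 ∧ y' = 0))
    (he : hgt D fl x y = hgt D fl x' y')
    (hs : 0 < hgt D fl x y → hgt D fl x y < topHgt D fl → (0 < y ↔ 0 < y')) :
    SameSignXY D fl x y x' y' := by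
  rcases Nat.eq_zero_or_pos (hgt D fl x y) with hz | hz
  · have h1 := of_hgt_eq_zero hz
    have h2 := of_hgt_eq_zero (he ▸ hz)
    refine ⟨fun a ha => by rw [sign_neg (h1.1 a ha), sign_neg (h2.1 a ha)], fun hf => ?_⟩
    rw [(h1.2 hf).1, (h2.2 hf).1]
  rcases hgt_le_topHgt.eq_or_lt with ht | ht
  · have h1 := of_hgt_eq_topHgt ht
    have h2 := of_hgt_eq_topHgt (he ▸ ht)
    refine ⟨fun a ha => by rw [sign_pos (h1.1 a ha), sign_pos (h2.1 a ha)], fun hf => ?_⟩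
    rw [(h1.2 hf).1, (h2.2 hf).1]
  have hy := y_ne_zero_of_hgt h0 hz ht
  have hy' := y_ne_zero_of_hgt h0' (he ▸ hz) (he ▸ ht)
  exact ⟨sign_eq_of_hgt_eq (mul_pos_of_pos_iff hy hy' (hs hz ht)) he,
    fun _ => sign_eq_of_pos_iff hy hy' (hs hz ht)⟩

theorem hgt_eq_of_sameSignXY (hD : D.Nonempty) (h : SameSignXY D fl x y x' y') :
    hgt D fl x y = hgt D fl x' y' := by
  classical
  have h1 : (D.filter fun a : ℕ => 0 < x - a * y) = D.filter fun a : ℕ => 0 < x' - a * y' :=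
    Finset.filter_congr fun a ha => (sign_eq_sign_iff.1 (h.1 a ha)).1
  have h2 : (D.filter fun a : ℕ => 0 ≤ x - a * y) = D.filter fun a : ℕ => 0 ≤ x' - a * y' :=
    Finset.filter_congr fun a ha => (sign_eq_sign_iff.1 (h.1 a ha)).2
  unfold hgt
  rw [h1, h2]
  congr 1
  by_cases hf : fl
  · have h3 := h.2 hf
    by_cases hy : y = 0
    · have hy' : y' = 0 := by
        rw [hy, sign_zero] at h3
        exact sign_eq_zero_iff.1 h3.symm
      -- For y = 0 the sign of x is that of any slope form, so at least one slope is needed.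
      obtain ⟨a, ha⟩ := hD
      have := (sign_eq_sign_iff.1 (h.1 a ha)).1
      rw [hy, hy', mul_zero, sub_zero, sub_zero] at this
      simp only [hf, hy, hy', if_true, this]
    · have hy' : y' ≠ 0 := by
        rintro rfl
        rw [sign_zero] at h3
        exact hy (sign_eq_zero_iff.1 h3)
      simp only [hf, hy, hy', if_true, if_false]
  · simp only [hf, if_false]

/-- Without the line y = 0, the side must be recovered from the slopes. Two distinct slopes with
forms of opposite weak sign determine the sign of y, because (b - a) y ≥ 0. -/
theorem exists_nonneg_nonpos (hD : fl ∨ 2 ≤ D.card) (hf : ¬fl) (h1 : 0 < hgt D fl x y)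
    (h2 : hgt D fl x y < topHgt D fl) :
    ∃ a ∈ D, ∃ b ∈ D, a ≠ b ∧ 0 ≤ x - a * y ∧ x - b * y ≤ 0 := by
  classical
  have hcard := hD.resolve_left hf
  unfold hgt at h1 h2
  unfold topHgt at h2
  rw [if_neg hf] at h1 h2
  rw [if_neg hf] at h2
  have hsub : (D.filter fun a : ℕ => 0 < x - a * y) ⊆ D.filter fun a : ℕ => 0 ≤ x - a * y :=
    Finset.monotone_filter_right D fun a _ => le_of_lt
  have hc := Finset.card_le_card hsub
  have hc2 := Finset.card_filter_le D fun a : ℕ => 0 < x - a * y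
  obtain ⟨a, ha⟩ : (D.filter fun a : ℕ => 0 ≤ x - a * y).Nonempty :=
    Finset.card_pos.1 (by omega)
  rw [Finset.mem_filter] at ha
  obtain ⟨b, hb, hb'⟩ : ∃ b ∈ D, ¬ 0 < x - b * y := by
    by_contra hcon
    push Not at hcon
    rw [Finset.filter_true_of_mem hcon] at hc h2
    omega
  by_cases hab : a = b
  · subst hab
    obtain ⟨c, hc, hca⟩ := Finset.exists_mem_ne (by omega : 1 < D.card) a
    rcases le_total 0 (x - c * y) with h | h
    · exact ⟨c, hc, a, ha.1, hca, h, not_lt.1 hb'⟩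
    · exact ⟨a, ha.1, c, hc, hca.symm, ha.2, h⟩
  · exact ⟨a, ha.1, b, hb, hab, ha.2, not_lt.1 hb'⟩

theorem pos_iff_of_sub_nonneg {a b : ℕ} (hab : a ≠ b) (hy : y ≠ 0) (ha : 0 ≤ x - a * y)
    (hb : x - b * y ≤ 0) : 0 < y ↔ a < b := by
  have h : 0 ≤ ((b : ℝ) - a) * y := by linarith
  rcases hab.lt_or_gt with h1 | h1
  · have : (0 : ℝ) < b - a := sub_pos.2 (by exact_mod_cast h1)
    simp only [h1, iff_true]
    exact lt_of_le_of_ne (nonneg_of_mul_nonneg_right h this) hy.symm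
  · have : (b : ℝ) - a < 0 := sub_neg.2 (by exact_mod_cast h1)
    simp only [h1.not_gt, iff_false, not_lt]
    nlinarith

theorem pos_iff_of_sameSignXY (hD : fl ∨ 2 ≤ D.card) (h0 : ¬(x = 0 ∧ y = 0))
    (h0' : ¬(x' = 0 ∧ y' = 0)) (h : SameSignXY D fl x y x' y')
    (h1 : 0 < hgt D fl x y) (h2 : hgt D fl x y < topHgt D fl)
    (he : hgt D fl x y = hgt D fl x' y') : 0 < y ↔ 0 < y' := by
  by_cases hf : fl
  · exact (sign_eq_sign_iff.1 (h.2 hf)).1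
  obtain ⟨a, ha, b, hb, hab, hx, hx'⟩ := exists_nonneg_nonpos hD hf h1 h2
  rw [pos_iff_of_sub_nonneg hab (y_ne_zero_of_hgt h0 h1 h2) hx hx',
    pos_iff_of_sub_nonneg hab (y_ne_zero_of_hgt h0' (he ▸ h1) (he ▸ h2))
      ((sign_eq_sign_iff.1 (h.1 a ha)).2.1 hx)
      (not_lt.1 fun h3 => hx'.not_gt ((sign_eq_sign_iff.1 (h.1 b hb)).1.2 h3))]

/-- The direction `(x', y')` is in the closure of the cell of `(x, y)`. -/
def WeakSignXY (D : Finset ℕ) (fl : Prop) (x y x' y' : ℝ) : Prop :=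
  (∀ a ∈ D, (0 < x - a * y → 0 ≤ x' - a * y') ∧ (x - a * y < 0 → x' - a * y' ≤ 0)) ∧
    (fl → (0 < y → 0 ≤ y') ∧ (y < 0 → y' ≤ 0))

open scoped Classical in
theorem hgt_of_sector (hs : ∀ a ∈ D, x - a * y ≠ 0) (hfl : fl → y ≠ 0) :
    hgt D fl x y = 2 * (D.filter fun a : ℕ => 0 < x - a * y).card + if fl then 1 else 0 := by
  have h1 : (D.filter fun a : ℕ => 0 ≤ x - a * y) = D.filter fun a : ℕ => 0 < x - a * y :=
    Finset.filter_congr fun a ha => ⟨fun h => lt_of_le_of_ne h (hs a ha).symm, le_of_lt⟩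
  unfold hgt
  rw [h1]
  by_cases hf : fl
  · simp only [hf, if_true, hfl hf, if_false]; ring
  · simp only [hf, if_false]; ring

open scoped Classical in
-- For y ≠ 0 only one slope form can vanish, so the two counts in the rank differ by exactly one.
theorem hgt_of_ray (hy : y ≠ 0) {a₀ : ℕ} (ha₀ : a₀ ∈ D) (h : x - a₀ * y = 0) :
    hgt D fl x y = 2 * (D.filter fun a : ℕ => 0 < x - a * y).card + 1 + (if fl then 1 else 0) ∧
      (D.filter fun a : ℕ => 0 ≤ x - a * y) = insert a₀ (D.filter fun a : ℕ => 0 < x - a * y) := by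
  have h1 : (D.filter fun a : ℕ => 0 ≤ x - a * y) =
      insert a₀ (D.filter fun a : ℕ => 0 < x - a * y) := by
    ext a
    simp only [Finset.mem_filter, Finset.mem_insert]
    constructor
    · rintro ⟨ha, hle⟩
      rcases hle.eq_or_lt with h2 | h2
      · left
        have : ((a : ℝ) - a₀) * y = 0 := by linarith
        have := (mul_eq_zero.1 this).resolve_right hy
        exact_mod_cast sub_eq_zero.1 this
      · exact Or.inr ⟨ha, h2⟩
    · rintro (rfl | ⟨ha, h2⟩)
      · exact ⟨ha₀, h.ge⟩
      · exact ⟨ha, h2.le⟩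
  refine ⟨?_, h1⟩
  unfold hgt
  rw [h1, Finset.card_insert_of_notMem (fun hm => (Finset.mem_filter.1 hm).2.ne' h)]
  simp only [if_neg hy]
  ring

/-- A ray bounding a sector lies on just one line of the arrangement, and all other strict signs
survive weakly. Hence ranks along a path in the link change by one at each step, and sides change
only through the bottom or the top. -/
theorem hgt_adjacent (hD : D.Nonempty) (hs : ∀ a ∈ D, x - a * y ≠ 0) (hfl : fl → y ≠ 0)
    (h0 : ¬(x' = 0 ∧ y' = 0)) (hr : (∃ a ∈ D, x' - a * y' = 0) ∨ (fl ∧ y' = 0))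
    (hw : WeakSignXY D fl x y x' y') :
    (hgt D fl x' y' = hgt D fl x y + 1 ∨ hgt D fl x y = hgt D fl x' y' + 1) ∧
      (0 < hgt D fl x y → hgt D fl x y < topHgt D fl → 0 < hgt D fl x' y' →
        hgt D fl x' y' < topHgt D fl → (0 < y ↔ 0 < y')) := by
  classical
  constructor
  · by_cases hy' : y' = 0
    · subst hy'
      have hx : x' ≠ 0 := fun h => h0 ⟨h, rfl⟩
      have hf : fl := by
        rcases hr with ⟨a, -, ha⟩ | h
        · simp at ha; exact absurd ha hx
        · exact h.1
      rw [hgt_of_sector hs hfl, if_pos hf]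
      rcases hx.lt_or_gt with h | h
      · right
        rw [hgt_of_y_eq_zero_of_neg h, Finset.filter_false_of_mem]
        · simp
        · intro a ha hpos
          have := (hw.1 a ha).1 hpos
          simp at this
          linarith
      · left
        rw [hgt_of_y_eq_zero_of_pos h, Finset.filter_true_of_mem]
        · simp [topHgt, hf]
        · intro a ha
          by_contra hneg
          have := (hw.1 a ha).2 (lt_of_le_of_ne (not_lt.1 hneg) (hs a ha))
          simp at this
          linarith
    · obtain ⟨a₀, ha₀, hz⟩ := hr.resolve_right fun h => hy' h.2
      obtain ⟨e1, e2⟩ := hgt_of_ray (fl := fl) hy' ha₀ hz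
      rw [hgt_of_sector hs hfl, e1]
      have s1 : (D.filter fun a : ℕ => 0 < x' - a * y') ⊆ D.filter fun a : ℕ => 0 < x - a * y := by
        intro a ha
        rw [Finset.mem_filter] at ha ⊢
        refine ⟨ha.1, ?_⟩
        by_contra hneg
        have := (hw.1 a ha.1).2 (lt_of_le_of_ne (not_lt.1 hneg) (hs a ha.1))
        linarith [ha.2]
      have s2 : (D.filter fun a : ℕ => 0 < x - a * y) ⊆
          insert a₀ (D.filter fun a : ℕ => 0 < x' - a * y') := by
        rw [← e2]
        intro a ha
        rw [Finset.mem_filter] at ha ⊢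
        exact ⟨ha.1, (hw.1 a ha.1).1 ha.2⟩
      have c1 := Finset.card_le_card s1
      have c2 := Finset.card_le_card s2
      rw [Finset.card_insert_of_notMem (fun hm => (Finset.mem_filter.1 hm).2.ne' hz)] at c2
      omega
  · intro h1 h2 h3 h4
    have hy' := y_ne_zero_of_hgt h0 h3 h4
    have h00 : ¬(x = 0 ∧ y = 0) := by
      rintro ⟨rfl, rfl⟩
      obtain ⟨a, ha⟩ := hD
      exact hs a ha (by simp)
    have hy := y_ne_zero_of_hgt h00 h1 h2
    by_cases hf : fl
    · obtain ⟨w1, w2⟩ := hw.2 hf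
      refine ⟨fun h => lt_of_le_of_ne (w1 h) hy'.symm, fun h => ?_⟩
      by_contra hneg
      exact absurd (w2 (lt_of_le_of_ne (not_lt.1 hneg) hy)) (not_le.2 h)
    · rw [hgt_of_sector hs hfl, if_neg hf] at h1 h2
      simp only [topHgt, if_neg hf] at h2
      obtain ⟨a, ha⟩ : (D.filter fun a : ℕ => 0 < x - a * y).Nonempty :=
        Finset.card_pos.1 (by omega)
      rw [Finset.mem_filter] at ha
      obtain ⟨b, hb, hb'⟩ : ∃ b ∈ D, ¬ 0 < x - b * y := by
        by_contra hcon
        push Not at hcon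
        rw [Finset.filter_true_of_mem hcon] at h2
        omega
      have hab : a ≠ b := by rintro rfl; exact hb' ha.2
      have hb'' := lt_of_le_of_ne (not_lt.1 hb') (hs b hb)
      rw [pos_iff_of_sub_nonneg hab hy ha.2.le hb''.le,
        pos_iff_of_sub_nonneg hab hy' ((hw.1 a ha.1).1 ha.2) ((hw.1 b hb).2 hb'')]

/-- The inequalities at `(x, y)` imply the inequalities at `(x', y')`. -/
def AllowedLE (D : Finset ℕ) (fl : Prop) (x y x' y' : ℝ) : Prop :=
  (∀ a ∈ D, 0 ≤ x - a * y → 0 ≤ x' - a * y') ∧ (fl → 0 ≤ y → 0 ≤ y')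

theorem allowedLE_of_top (h : hgt D fl x' y' = topHgt D fl) : AllowedLE D fl x y x' y' :=
  ⟨fun a ha _ => ((of_hgt_eq_topHgt h).1 a ha).le, fun hf _ => ((of_hgt_eq_topHgt h).2 hf).1.ge⟩

/-- Positive rank is essential: y ≥ 0 holds at the bottom direction (-1,0) but fails just above it
on the side y < 0. The top needs no side condition, since all inequalities hold there. -/
theorem allowedLE_of_hgt_le (h0 : ¬(x = 0 ∧ y = 0)) (h0' : ¬(x' = 0 ∧ y' = 0))
    (hpos : 0 < hgt D fl x y) (hle : hgt D fl x y ≤ hgt D fl x' y')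
    (hs : hgt D fl x' y' < topHgt D fl → (0 < y ↔ 0 < y')) : AllowedLE D fl x y x' y' := by
  rcases (hgt_le_topHgt (D := D) (fl := fl) (x := x') (y := y')).eq_or_lt with ht | ht
  · exact allowedLE_of_top ht
  have hy := y_ne_zero_of_hgt h0 hpos (hle.trans_lt ht)
  have hy' := y_ne_zero_of_hgt h0' (hpos.trans_le hle) ht
  refine ⟨nonneg_of_hgt_le (mul_pos_of_pos_iff hy hy' (hs ht)) hle, fun _ h => ?_⟩
  exact ((hs ht).1 (lt_of_le_of_ne h hy.symm)).le

theorem allowedLE_of_bot (h : hgt D fl x y = 0) (hs : fl → 0 ≤ y') : AllowedLE D fl x y x' y' :=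
  ⟨fun a ha h' => absurd h' (not_le.2 ((of_hgt_eq_zero h).1 a ha)), fun hf _ => hs hf⟩

end Heights

/-! ### Closed walks without local minima of positive height -/

section RankedWalk

/-- A periodic walk `j ↦ [g j, S j]` in a graph of cosets, with a height function `h` that has no
local minima of positive height, along which the stabilisers `S j` of positive height grow with
the height. -/
structure RankedWalk {G : Type*} [Group G] (T M : ℕ) (h : ℕ → ℕ) (g : ℕ → G)
    (S : ℕ → Subgroup G) : Prop where
  pos : 0 < T
  per : ∀ j, h (j + T) = h j
  le : ∀ j, h j ≤ M
  step : ∀ j, h (j + 1) = h j + 1 ∨ h j = h (j + 1) + 1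
  nomin : ∀ j, h j = h (j + 1) + 1 → h (j + 2) = h (j + 1) + 1 → h (j + 1) = 0
  link : ∀ j, (g j)⁻¹ * g (j + 1) ∈ S (j + 1)
  up : ∀ j, h (j + 1) = h j + 1 → 0 < h j → S j ≤ S (j + 1)
  down : ∀ j, h j = h (j + 1) + 1 → 0 < h (j + 1) → S (j + 1) ≤ S j

variable {G : Type*} [Group G] {T M : ℕ} {h : ℕ → ℕ} {g : ℕ → G} {S : ℕ → Subgroup G}

theorem RankedWalk.exists_eq_zero (W : RankedWalk T M h g S) : ∃ j, h j = 0 := by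
  obtain ⟨j, hj⟩ : ∃ j, ∀ i, h j ≤ h i := by
    obtain ⟨_, ⟨j, rfl⟩, hj⟩ := WellFounded.has_min (wellFounded_lt (α := ℕ)) (Set.range h) ⟨h 0, 0, rfl⟩
    exact ⟨j, fun i => not_lt.1 (hj _ ⟨i, rfl⟩)⟩
  have hT := W.pos
  -- Shifting by a period gives the minimum a predecessor.
  obtain ⟨l, hl⟩ : ∃ l, l + 1 = j + T := ⟨j + T - 1, by omega⟩
  have e : h (l + 1) = h j := by rw [hl, W.per]
  refine ⟨l + 1, W.nomin l ?_ ?_⟩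
  · rcases W.step l with h1 | h1
    · have := hj l
      omega
    · exact h1
  · rcases W.step (l + 1) with h1 | h1
    · exact h1
    · have := hj (l + 1 + 1)
      omega

/-- Boundedness ends the climb, and a new climb before height 0 would create a forbidden minimum. As
stabilisers grow with the height, the transition elements of the ascent accumulate, so every coset
met there is represented by g at its start. The descent is the same read backwards. -/
theorem RankedWalk.exists_excursion (W : RankedWalk T M h g S) {j₀ : ℕ} (h₀ : h j₀ = 0) :
    ∃ d, 0 < d ∧ d ≤ M ∧ (∀ i ≤ d, h (j₀ + i) = i) ∧ (∀ i ≤ d, h (j₀ + d + i) + i = d) ∧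
      (∀ i ≤ d, (g j₀)⁻¹ * g (j₀ + i) ∈ S (j₀ + i)) ∧
      (∀ i ≤ d, (g (j₀ + d + i))⁻¹ * g (j₀ + 2 * d - 1) ∈ S (j₀ + d + i)) := by
  classical
  -- The least such d is the height at which the uninterrupted climb stops.
  have hex : ∃ d, h (j₀ + d + 1) ≠ d + 1 := ⟨M, fun hM => by have := W.le (j₀ + M + 1); omega⟩
  set d := Nat.find hex
  have hd : h (j₀ + d + 1) ≠ d + 1 := Nat.find_spec hex
  have hup : ∀ i ≤ d, h (j₀ + i) = i := by
    intro i hi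
    rcases i with _ | i
    · exact h₀
    · exact not_not.1 (Nat.find_min hex (show i < d by omega))
  have hstep : h (j₀ + d) = h (j₀ + d + 1) + 1 := by
    rcases W.step (j₀ + d) with h1 | h1
    · rw [hup d le_rfl] at h1
      exact absurd h1 hd
    · exact h1
  have hdpos : 0 < d := by
    rw [hup d le_rfl] at hstep
    omega
  have hdown : ∀ i ≤ d, h (j₀ + d + i) + i = d := by
    intro i
    induction i using Nat.strong_induction_on with
    | _ i ih =>
      intro hi
      rcases i with _ | _ | i
      · exact hup d le_rfl
      · rw [hup d le_rfl] at hstep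
        exact hstep.symm
      · have h1 := ih i (by omega) (by omega)
        have h2 := ih (i + 1) (by omega) (by omega)
        rcases W.step (j₀ + d + (i + 1)) with h3 | h3
        · have := W.nomin (j₀ + d + i) (by rw [add_assoc _ i 1]; omega) h3
          rw [add_assoc _ i 1] at this
          omega
        · have e : j₀ + d + (i + 1) + 1 = j₀ + d + (i + 1 + 1) := by ring
          rw [e] at h3
          omega
  refine ⟨d, hdpos, by rw [← hup d le_rfl]; exact W.le _, hup, hdown, ?_, ?_⟩
  · intro i
    induction i with
    | zero => intro _; simp
    | succ i ih =>
      intro hi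
      have h1 := ih (by omega)
      have h2 := W.link (j₀ + i)
      rw [← add_assoc]
      have h3 : (g j₀)⁻¹ * g (j₀ + i) ∈ S (j₀ + i + 1) := by
        -- Monotonicity of the stabilisers is not assumed at height 0, but there the accumulated
        -- element is 1.
        rcases Nat.eq_zero_or_pos i with rfl | hpos
        · simp
        · refine W.up _ ?_ (by rw [hup i (by omega)]; exact hpos) h1
          rw [add_assoc, hup i (by omega), hup (i + 1) hi]
      have := mul_mem h3 h2
      rwa [mul_assoc, mul_inv_cancel_left] at this
  -- The reference is the last position before height 0: the element crossing the end of the descent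
  -- is controlled only by the stabiliser at that end. Here l is the height of the position.
  · have key : ∀ l ≤ d, (g (j₀ + d + (d - l)))⁻¹ * g (j₀ + 2 * d - 1) ∈ S (j₀ + d + (d - l)) := by
      intro l
      induction l with
      | zero =>
        intro _
        have h1 := W.link (j₀ + 2 * d - 1)
        have e : j₀ + 2 * d - 1 + 1 = j₀ + d + (d - 0) := by omega
        rw [e] at h1
        have := inv_mem h1
        rwa [mul_inv_rev, inv_inv] at this
      | succ l ih =>
        intro hl
        rcases Nat.eq_zero_or_pos l with rfl | hpos
        · have e : j₀ + 2 * d - 1 = j₀ + d + (d - (0 + 1)) := by omega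
          rw [e, inv_mul_cancel]
          exact one_mem _
        · have h1 := ih (by omega)
          have h2 := W.link (j₀ + d + (d - (l + 1)))
          have e : j₀ + d + (d - (l + 1)) + 1 = j₀ + d + (d - l) := by omega
          rw [e] at h2
          have h3 := mul_mem h2 h1
          rw [mul_assoc, mul_inv_cancel_left] at h3
          have h4 := hdown (d - l) (by omega)
          have h5 := hdown (d - (l + 1)) (by omega)
          have h6 := W.down (j₀ + d + (d - (l + 1))) (by rw [e]; omega) (by rw [e]; omega)
          rw [e] at h6
          exact h6 h3
    intro i hi
    have := key (d - i) (by omega)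
    rwa [Nat.sub_sub_self hi] at this

end RankedWalk

/-! ### Cycles in the link as ranked walks -/

section LinkWalk

theorem critSlopes_of_mem_vertexWeights {α : Fin 3 → ℝ} (hα : StrictWeight α)
    (hv : α ∈ vertexWeights) :
    (IsFlagged α ∨ 2 ≤ (critSlopes α).card) ∧ (critSlopes α).Nonempty := by
  obtain ⟨-, l, l', hl, hl', hne, hm, hm'⟩ := hv
  rcases admissibleLine_through hα hl hm with ⟨a, ha, rfl⟩ | ⟨hf, rfl⟩ <;>
    rcases admissibleLine_through hα hl' hm' with ⟨b, hb, rfl⟩ | ⟨hf', rfl⟩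
  · have hab : a ≠ b := by rintro rfl; exact hne rfl
    refine ⟨Or.inr ?_, a, ha⟩
    exact Finset.one_lt_card.2 ⟨a, ha, b, hb, hab⟩
  · exact ⟨Or.inl hf', a, ha⟩
  · exact ⟨Or.inl hf, b, hb⟩
  · exact absurd rfl hne

/-- The rank of the direction from `[α]` towards `[β]`. -/
def heightAt (α β : Fin 3 → ℝ) : ℕ :=
  hgt (critSlopes α) (IsFlagged α) (xCoord α β) (yCoord α β)

/-- The maximal rank of a direction at `[α]`. -/
def topAt (α : Fin 3 → ℝ) : ℕ := topHgt (critSlopes α) (IsFlagged α)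

/-- `[β]` differs from `[α]`. -/
def IsOffPt (α β : Fin 3 → ℝ) : Prop := ¬(xCoord α β = 0 ∧ yCoord α β = 0)

theorem IsSectorPt.isOffPt {α β : Fin 3 → ℝ} (hD : (critSlopes α).Nonempty)
    (h : IsSectorPt α β) : IsOffPt α β := by
  rintro ⟨hx, hy⟩
  obtain ⟨a, ha⟩ := hD
  exact h.1 a ha (by simp [slopeForm, hx, hy])

variable {k : Type*} [Field k]

theorem stabAt_le_of_allowedLE {α β γ : Fin 3 → ℝ} (hα : StrictWeight α) (hβ : IsNearby α β)
    (hγ : IsNearby α γ)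
    (h : AllowedLE (critSlopes α) (IsFlagged α) (xCoord α β) (yCoord α β) (xCoord α γ)
      (yCoord α γ)) : stabAt k α β ≤ stabAt k α γ := by
  intro f hf
  have hm := ((mem_stabAt hβ.pos).1 hf).1
  obtain ⟨h0, h1⟩ := (mem_stabAt_iff hα hβ hm).1 hf
  exact (mem_stabAt_iff hα hγ hm).2 ⟨fun a b hab hc =>
    h.1 a ((mem_critSlopes hα.pos).2 ⟨b, hab⟩) (h0 a b hab hc),
    fun b hb hc => h.2 ⟨b, hb⟩ (h1 b hb hc)⟩

theorem SameSign.allowedLE {α β γ : Fin 3 → ℝ} (h : SameSign α β γ) :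
    AllowedLE (critSlopes α) (IsFlagged α) (xCoord α β) (yCoord α β) (xCoord α γ)
      (yCoord α γ) :=
  ⟨fun a ha => (sign_eq_sign_iff.1 (h.1 a ha)).2.1, fun hf => (sign_eq_sign_iff.1 (h.2 hf)).2.1⟩

theorem cell_eq_cell {α : Fin 3 → ℝ} (hα : StrictWeight α) {ρ : Set (Fin 3 → ℝ)}
    (hρ : IsCellAt α ρ) {f g : PolyAut k} {β : Fin 3 → ℝ} (hβ : β ∈ ρ)
    (h : f⁻¹ * g ∈ stabAt k α β) : cell f ρ = cell g ρ :=
  Set.image_congr fun _ hγ => valPt_eq_of_inv_mul_mem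
    (stabAt_le_of_allowedLE hα (hρ.isNearby hβ) (hρ.isNearby hγ)
      (hρ.sameSign hα.pos hβ hγ).allowedLE h)

/-- The direction of `β'` is in the closure of the cell of the direction of `β`. -/
def WeakSign (α β β' : Fin 3 → ℝ) : Prop :=
  WeakSignXY (critSlopes α) (IsFlagged α) (xCoord α β) (yCoord α β) (xCoord α β') (yCoord α β')

theorem WeakSign.congr_right {α β γ γ' : Fin 3 → ℝ} (h : WeakSign α β γ) (hs : SameSign α γ γ') :
    WeakSign α β γ' := by
  have key : ∀ {u v : ℝ}, SignType.sign u = SignType.sign v → (0 ≤ u → 0 ≤ v) ∧ (u ≤ 0 → v ≤ 0) := by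
    intro u v huv
    obtain ⟨h1, h2⟩ := sign_eq_sign_iff.1 huv
    exact ⟨h2.1, fun h => not_lt.1 fun h' => (h1.2 h').not_ge h⟩
  refine ⟨fun a ha => ⟨fun h0 => (key (hs.1 a ha)).1 ((h.1 a ha).1 h0),
    fun h0 => (key (hs.1 a ha)).2 ((h.1 a ha).2 h0)⟩, fun hf => ⟨fun h0 => (key (hs.2 hf)).1
      ((h.2 hf).1 h0), fun h0 => (key (hs.2 hf)).2 ((h.2 hf).2 h0)⟩⟩

theorem weakSign_of_subset_closure {α : Fin 3 → ℝ} (hα : α ∈ posWeights) {ρ τ : Set (Fin 3 → ℝ)}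
    (hρ : IsCellAt α ρ) (h : τ ⊆ closure ρ) {β γ : Fin 3 → ℝ} (hβ : β ∈ ρ) (hγ : γ ∈ τ) :
    WeakSign α β γ := by
  have key : ∀ φ : (Fin 3 → ℝ) → ℝ, Continuous φ → (∀ δ ∈ ρ, 0 ≤ φ δ) → 0 ≤ φ γ := by
    intro φ hφ h0
    exact closure_minimal (t := {δ | 0 ≤ φ δ}) h0 (isClosed_le continuous_const hφ) (h hγ)
  have hs : ∀ δ ∈ ρ, SameSign α β δ := fun δ hδ => hρ.sameSign hα hβ hδ
  refine ⟨fun a ha => ⟨fun h0 => ?_, fun h0 => ?_⟩, fun hf => ⟨fun h0 => ?_, fun h0 => ?_⟩⟩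
  · exact key _ (continuous_slopeForm α a) fun δ hδ =>
      ((sign_eq_sign_iff.1 ((hs δ hδ).1 a ha)).1.1 h0).le
  · have := key _ (continuous_slopeForm α a).neg fun δ hδ => by
      have := (hs δ hδ).1 a ha
      have h0' : slopeForm α a β < 0 := h0
      rw [sign_neg h0'] at this
      exact neg_nonneg.2 (sign_eq_neg_one_iff.1 this.symm).le
    exact neg_nonneg.1 this
  · exact key _ (continuous_yCoord α) fun δ hδ =>
      ((sign_eq_sign_iff.1 ((hs δ hδ).2 hf)).1.1 h0).le
  · have := key _ (continuous_yCoord α).neg fun δ hδ => by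
      have := (hs δ hδ).2 hf
      rw [sign_neg h0] at this
      exact neg_nonneg.2 (sign_eq_neg_one_iff.1 this.symm).le
    exact neg_nonneg.1 this

/-- A cycle in the link of `ν_{id,[α]}`, as a periodic sequence: the directions `q (2 i)` are
vertices and the directions `q (2 i + 1)` are interior points of edges of the apartment of
`f i`. -/
structure LinkWalk (α : Fin 3 → ℝ) (N : ℕ) (f : ℕ → PolyAut k) (σ : ℕ → Set (Fin 3 → ℝ))
    (q : ℕ → Fin 3 → ℝ) (w : ℕ → ℝ) : Prop where
  two_le : 2 ≤ N
  mem : ∀ i, f i ∈ tameStab (valPt (1 : PolyAut k) α)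
  face : ∀ i, IsOpenFace (σ i)
  mem_closure : ∀ i, α ∈ closure (σ i)
  mem_face : ∀ i, q (2 * i + 1) ∈ σ i
  ray : ∀ i, IsRayPt α (q (2 * i))
  ray_near : ∀ i, IsNearby α (q (2 * i))
  per_f : ∀ i, f (i + N) = f i
  per_σ : ∀ i, σ (i + N) = σ i
  per_q : ∀ j, q (j + 2 * N) = q j
  per_w : ∀ i, w (i + N) = w i
  link : ∀ i, (f i)⁻¹ * f (i + 1) ∈ stabAt k α (q (2 * i + 2))
  weak_left : ∀ i, WeakSign α (q (2 * i + 1)) (q (2 * i))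
  weak_right : ∀ i, WeakSign α (q (2 * i + 1)) (q (2 * i + 2))
  pass : ∀ i, ¬ SameSign α (q (2 * i)) (q (2 * i + 2))
  distinct : ∀ i, SameSign α (q (2 * i + 1)) (q (2 * i + 3)) →
    (f i)⁻¹ * f (i + 1) ∉ stabAt k α (q (2 * i + 3))
  angle : ∀ i, ∃ p, SameSign α p (q (2 * i + 2)) ∧ IsOffPt α p ∧
    w i = InnerProductGeometry.angle (direction α (q (2 * i))) (direction α p)

/-- Each corner comes with its own chart f. A shared vertex of the link is described in the charts
of both neighbouring corners, and comparing the descriptions shows that the change of chart fixes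
its direction. Embeddedness becomes `pass` and `distinct`. -/
theorem exists_linkWalk {α : Fin 3 → ℝ} (hα : StrictWeight α) (hv : α ∈ vertexWeights)
    {γ : Set (Set (ValClass k))} {L : ℝ} (h : IsLinkCycle α γ L) :
    ∃ (N : ℕ) (f : ℕ → PolyAut k) (σ : ℕ → Set (Fin 3 → ℝ)) (q : ℕ → Fin 3 → ℝ) (w : ℕ → ℝ),
      LinkWalk α N f σ q w ∧ γ = Set.range (fun i => cell (f i) (σ i)) ∧
        L = ∑ i ∈ Finset.range N, w i := by
  obtain ⟨n, v, c, θ, -, hc, hcorner, rfl, rfl⟩ := h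
  choose f hf σ τ τ' hσ hτ hτ' hne hατ hατ' hτσ hτσ' hcf hvf hvf' β hβ β' hβ' hθ using hcorner
  have hασ : ∀ i, α ∈ closure (σ i) := fun i =>
    closure_minimal (hτσ i) isClosed_closure (hατ i)
  have hcell := fun i => (hσ i).isCellAt (hασ i)
  have hcellτ := fun i => (hτ i).isCellAt hα.pos (hατ i)
  have hcellτ' := fun i => (hτ' i).isCellAt hα.pos (hατ' i)
  choose ζ hζ using fun i => (hcell i).nonempty
  let I : ℕ → Fin (n + 2) := fun i => Fin.ofNat (n + 2) i
  have hI1 : ∀ i, I (i + 1) = I i + 1 := fun i => by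
    apply Fin.ext
    simp [I, Fin.val_add, Fin.ofNat]
  have hIN : ∀ i, I (i + (n + 2)) = I i := fun i => by
    apply Fin.ext
    simp [I, Fin.ofNat]
  have hIv : ∀ i : Fin (n + 2), I i = i := fun i => by
    apply Fin.ext
    simp [I, Fin.ofNat, Nat.mod_eq_of_lt i.2]
  let q : ℕ → Fin 3 → ℝ := fun j => if j % 2 = 0 then β (I (j / 2)) else ζ (I (j / 2))
  have q0 : ∀ i, q (2 * i) = β (I i) := fun i => by simp [q]
  have q1 : ∀ i, q (2 * i + 1) = ζ (I i) := fun i => by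
    have : (2 * i + 1) / 2 = i := by omega
    simp [q, this]
  have q2 : ∀ i, q (2 * i + 2) = β (I i + 1) := fun i => by
    rw [show 2 * i + 2 = 2 * (i + 1) by ring, q0, hI1]
  have q3 : ∀ i, q (2 * i + 3) = ζ (I i + 1) := fun i => by
    rw [show 2 * i + 3 = 2 * (i + 1) + 1 by ring, q1, hI1]
  -- The end of corner i and the start of corner i + 1 are the same edge of 𝐗, written in two
  -- charts.
  have hnext : ∀ i, (∃ δ ∈ τ' i, SameSign α δ (β (i + 1))) ∧
      (f i)⁻¹ * f (i + 1) ∈ stabAt k α (β (i + 1)) := by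
    intro i
    have h1 : valPt (f (i + 1)) (β (i + 1)) ∈ cell (f i) (τ' i) := by
      rw [← hvf', hvf]
      exact ⟨_, hβ _, rfl⟩
    obtain ⟨δ, hδ, hδe⟩ := h1
    obtain ⟨⟨s, hs, hs'⟩, h2⟩ := valPt_eq_of_mem_tameStab hα
      ((hcellτ (i + 1)).sub (hβ _)).1 (hf i) (hf (i + 1)) hδe
    exact ⟨⟨δ, hδ, hs' ▸ (sameSign_smul hs).symm⟩, h2⟩
  refine ⟨n + 2, fun i => f (I i), fun i => σ (I i), q, fun i => θ (I i), ?_, ?_, ?_⟩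
  · refine
      { two_le := by omega
        mem := fun i => hf _
        face := fun i => hσ _
        mem_closure := fun i => hασ _
        mem_face := fun i => by rw [q1]; exact hζ _
        ray := fun i => by rw [q0]; exact (hτ _).isRayPt hα hv (hατ _) (hβ _)
        ray_near := fun i => by rw [q0]; exact (hcellτ _).isNearby (hβ _)
        per_f := fun i => by rw [hIN]
        per_σ := fun i => by rw [hIN]
        per_q := fun j => ?_
        per_w := fun i => by rw [hIN]
        link := fun i => by rw [hI1, q2]; exact (hnext _).2
        weak_left := fun i => by
          rw [q0, q1]
          exact weakSign_of_subset_closure hα.pos (hcell _) (hτσ _) (hζ _) (hβ _)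
        weak_right := fun i => by
          rw [q1, q2]
          obtain ⟨δ, hδ, hδs⟩ := (hnext (I i)).1
          exact (weakSign_of_subset_closure hα.pos (hcell _) (hτσ' _) (hζ _) hδ).congr_right hδs
        pass := fun i hs => by
          rw [q0, q2] at hs
          obtain ⟨δ, hδ, hδs⟩ := (hnext (I i)).1
          exact hne (I i) ((hτ _).eq_of_sameSign hα (hτ' _) (hατ _) (hατ' _) (hβ _) hδ
            (hs.trans hδs.symm))
        distinct := fun i hs hmem => by
          rw [q1, q3] at hs
          rw [hI1, q3] at hmem
          have h1 := (hσ (I i)).eq_of_sameSign hα (hσ (I i + 1)) (hασ _) (hασ _) (hζ _) (hζ _) hs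
          have h2 : c (I i) = c (I i + 1) := by
            rw [hcf, hcf, h1]
            exact cell_eq_cell hα (hcell _) (hζ _) hmem
          have h3 := hc h2
          simp at h3
        angle := fun i => by
          rw [q0, q2]
          obtain ⟨δ, hδ, hδs⟩ := (hnext (I i)).1
          exact ⟨β' (I i), ((hcellτ' _).sameSign hα.pos (hβ' _) hδ).trans hδs,
            ((hτ' _).isRayPt hα hv (hατ' _) (hβ' _)).2, hθ _⟩ }
    have e1 : (j + 2 * (n + 2)) % 2 = j % 2 := by omega
    have e2 : (j + 2 * (n + 2)) / 2 = j / 2 + (n + 2) := by omega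
    simp only [q, e1, e2, hIN]
  · ext x
    constructor
    · rintro ⟨i, rfl⟩
      exact ⟨i, by simp only [hIv, ← hcf]⟩
    · rintro ⟨i, rfl⟩
      exact ⟨I i, hcf _⟩
  · rw [Finset.sum_range]
    exact Finset.sum_congr rfl fun i _ => by rw [hIv]

variable {α : Fin 3 → ℝ} {N : ℕ} {f : ℕ → PolyAut k} {σ : ℕ → Set (Fin 3 → ℝ)}
    {q : ℕ → Fin 3 → ℝ} {w : ℕ → ℝ}

theorem LinkWalk.sector (W : LinkWalk α N f σ q w) (hα : α ∈ posWeights) (i : ℕ) :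
    IsSectorPt α (q (2 * i + 1)) := (W.face i).isSectorPt hα (W.mem_face i)

theorem LinkWalk.isOffPt (W : LinkWalk α N f σ q w) (hα : α ∈ posWeights)
    (hD : (critSlopes α).Nonempty) (j : ℕ) : IsOffPt α (q j) := by
  obtain ⟨i, rfl | rfl⟩ := Nat.even_or_odd' j
  · exact (W.ray i).2
  · exact (W.sector hα i).isOffPt hD

theorem LinkWalk.isNearby (W : LinkWalk α N f σ q w) (j : ℕ) : IsNearby α (q j) := by
  obtain ⟨i, rfl | rfl⟩ := Nat.even_or_odd' j
  · exact W.ray_near i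
  · exact ((W.face i).isCellAt (W.mem_closure i)).isNearby (W.mem_face i)

theorem LinkWalk.adjacent (W : LinkWalk α N f σ q w) (hα : α ∈ posWeights)
    (hD : (critSlopes α).Nonempty) (j : ℕ) :
    (heightAt α (q (j + 1)) = heightAt α (q j) + 1 ∨
      heightAt α (q j) = heightAt α (q (j + 1)) + 1) ∧
    (0 < heightAt α (q j) → heightAt α (q j) < topAt α → 0 < heightAt α (q (j + 1)) →
      heightAt α (q (j + 1)) < topAt α → (0 < yCoord α (q j) ↔ 0 < yCoord α (q (j + 1)))) := by
  obtain ⟨i, rfl | rfl⟩ := Nat.even_or_odd' j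
  · have h := hgt_adjacent hD (W.sector hα i).1 (W.sector hα i).2 (W.ray i).2 (W.ray i).1
      (W.weak_left i)
    exact ⟨h.1.symm, fun h1 h2 h3 h4 => (h.2 h3 h4 h1 h2).symm⟩
  · have e : 2 * i + 1 + 1 = 2 * (i + 1) := by ring
    have h := hgt_adjacent hD (W.sector hα i).1 (W.sector hα i).2 (W.ray (i + 1)).2
      (W.ray (i + 1)).1 (by have := W.weak_right i; exact this)
    rw [e]
    exact h

theorem sameSign_of_heightAt {β γ : Fin 3 → ℝ} (hβ : IsOffPt α β) (hγ : IsOffPt α γ)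
    (he : heightAt α β = heightAt α γ)
    (hs : 0 < heightAt α β → heightAt α β < topAt α → (0 < yCoord α β ↔ 0 < yCoord α γ)) :
    SameSign α β γ :=
  sameSignXY_of_hgt_eq hβ hγ he hs

/-- At a minimum of positive rank both neighbours have the same rank and side, hence the same type.
If the minimum is a sector, its two boundary rays would coincide, against `pass`. If it is a ray,
the change of chart fixes the ray and so also the next sector, which makes two consecutive edges
equal, against `distinct`. -/
theorem LinkWalk.rankedWalk (W : LinkWalk α N f σ q w) (hα : StrictWeight α)
    (hD : (critSlopes α).Nonempty) :
    RankedWalk (2 * N) (topAt α) (fun j => heightAt α (q j)) (fun j => f (j / 2))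
      (fun j => stabAt k α (q j)) := by
  have hoff := W.isOffPt hα.pos hD
  have hadj := W.adjacent hα.pos hD
  have hle : ∀ j, heightAt α (q j) ≤ topAt α := fun j => hgt_le_topHgt
  have hup : ∀ j, heightAt α (q (j + 1)) = heightAt α (q j) + 1 → 0 < heightAt α (q j) →
      stabAt k α (q j) ≤ stabAt k α (q (j + 1)) := by
    intro j h1 h2
    refine stabAt_le_of_allowedLE hα (W.isNearby _) (W.isNearby _)
      (allowedLE_of_hgt_le (hoff _) (hoff _) h2 (by rw [← heightAt, ← heightAt]; omega) fun h3 => ?_)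
    have h3' : heightAt α (q (j + 1)) < topAt α := h3
    exact (hadj j).2 h2 (by omega) (by omega) h3'
  have hdown : ∀ j, heightAt α (q j) = heightAt α (q (j + 1)) + 1 →
      0 < heightAt α (q (j + 1)) → stabAt k α (q (j + 1)) ≤ stabAt k α (q j) := by
    intro j h1 h2
    refine stabAt_le_of_allowedLE hα (W.isNearby _) (W.isNearby _)
      (allowedLE_of_hgt_le (hoff _) (hoff _) h2 (by rw [← heightAt, ← heightAt]; omega) fun h3 => ?_)
    have h3' : heightAt α (q j) < topAt α := h3
    exact ((hadj j).2 (by omega) h3' h2 (by omega)).symm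
  have hss : ∀ j, heightAt α (q j) = heightAt α (q (j + 1)) + 1 →
      heightAt α (q (j + 2)) = heightAt α (q (j + 1)) + 1 → 0 < heightAt α (q (j + 1)) →
      SameSign α (q j) (q (j + 2)) := by
    intro j h1 h2 h3
    have h4 := hle j
    refine sameSign_of_heightAt (hoff _) (hoff _) (by omega) fun h5 h6 => ?_
    rw [(hadj j).2 h5 h6 h3 (by omega)]
    exact (hadj (j + 1)).2 h3 (by omega) (by rw [show j + 1 + 1 = j + 2 from rfl]; omega)
      (by rw [show j + 1 + 1 = j + 2 from rfl]; omega)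
  refine ⟨by have := W.two_le; omega, fun j => by rw [W.per_q], hle, fun j => (hadj j).1, ?_, ?_,
    hup, hdown⟩
  · intro j h1 h2
    by_contra h3
    have h3 := Nat.pos_of_ne_zero h3
    have hs := hss j h1 h2 h3
    obtain ⟨i, rfl | rfl⟩ := Nat.even_or_odd' j
    · exact W.pass i hs
    · refine W.distinct i hs ?_
      exact hup (2 * i + 2) h2 h3 (W.link i)
  · intro j
    obtain ⟨i, rfl | rfl⟩ := Nat.even_or_odd' j
    · have e1 : 2 * i / 2 = i := by omega
      have e2 : (2 * i + 1) / 2 = i := by omega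
      simp only [e1, e2, inv_mul_cancel]
      exact one_mem _
    · have e1 : (2 * i + 1) / 2 = i := by omega
      have e2 : (2 * i + 1 + 1) / 2 = i + 1 := by omega
      simp only [e1, e2]
      exact W.link i

end LinkWalk

/-! ### Excursions and the apartments that contain them -/

section Excursion

variable {k : Type*} [Field k] {α : Fin 3 → ℝ} {N : ℕ} {f : ℕ → PolyAut k}
  {σ : ℕ → Set (Fin 3 → ℝ)} {q : ℕ → Fin 3 → ℝ} {w : ℕ → ℝ}

/-- The edges of `Γ_g` of rank at most `H` on the side `b`. -/
def arm (α : Fin 3 → ℝ) (g : PolyAut k) (b : Prop) (H : ℕ) : Set (Set (ValClass k)) :=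
  {c | ∃ ρ, IsOpenFace ρ ∧ α ∈ closure ρ ∧ c = cell g ρ ∧ ∃ z ∈ ρ, heightAt α z ≤ H ∧
    (0 < heightAt α z → heightAt α z < topAt α → (0 < yCoord α z ↔ b))}

theorem not_sameSign_of_ray_of_sector {z r : Fin 3 → ℝ} (hz : IsSectorPt α z)
    (hr : IsRayPt α r) : ¬ SameSign α z r := by
  intro h
  rcases hr.1 with ⟨a, ha, h0⟩ | ⟨hf, h0⟩
  · have := h.1 a ha
    rw [h0, sign_zero] at this
    exact hz.1 a ha (sign_eq_zero_iff.1 this)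
  · have := h.2 hf
    rw [h0, sign_zero] at this
    exact hz.2 hf (sign_eq_zero_iff.1 this)

/-- A part of a cycle that rises from a direction of rank `0` to a direction of rank `d` and then
descends to a direction of rank `0`. -/
structure Excursion (α : Fin 3 → ℝ) (f : ℕ → PolyAut k) (σ : ℕ → Set (Fin 3 → ℝ))
    (q : ℕ → Fin 3 → ℝ) (j d : ℕ) : Prop where
  pos : 0 < d
  le_top : d ≤ topAt α
  up : ∀ i ≤ d, heightAt α (q (j + i)) = i
  down : ∀ i ≤ d, heightAt α (q (j + d + i)) + i = d
  mem_turn : (f (j / 2))⁻¹ * f ((j + 2 * d - 1) / 2) ∈ stabAt k α (q (j + d))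
  side_up : ∀ i ≤ d, 0 < i → i < topAt α → (0 < yCoord α (q (j + i)) ↔ 0 < yCoord α (q (j + 1)))
  side_eq : d < topAt α → (0 < yCoord α (q (j + 1)) ↔ 0 < yCoord α (q (j + 2 * d - 1)))
  same : (d < topAt α ∨ (0 < yCoord α (q (j + 1)) ↔ 0 < yCoord α (q (j + 2 * d - 1)))) →
    SameSign α (q (j + d - 1)) (q (j + d + 1)) ∧ Even (j + d) ∧
      (f (j / 2))⁻¹ * f ((j + 2 * d - 1) / 2) ∉ stabAt k α (q (j + d - 1))
  cells : {c | ∃ i, j ≤ 2 * i + 1 ∧ 2 * i + 1 ≤ j + 2 * d ∧ c = cell (f i) (σ i)} =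
    arm α (f (j / 2)) (0 < yCoord α (q (j + 1))) d ∪
      arm α (f ((j + 2 * d - 1) / 2)) (0 < yCoord α (q (j + 2 * d - 1))) d

/-- This turns `RankedWalk.exists_excursion` into a statement about cells: the ascent lies in the
first apartment and the descent in the last one. If the neighbours of the turn have the same type,
embeddedness forces a turn at a ray, and the two apartments already differ one rank below. -/
theorem LinkWalk.exists_excursion (W : LinkWalk α N f σ q w) (hα : StrictWeight α)
    (hD : (critSlopes α).Nonempty) {j : ℕ} (h₀ : heightAt α (q j) = 0) :
    ∃ d, Excursion α f σ q j d := by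
  obtain ⟨d, hd, hdt, hup, hdown, hm, hm'⟩ := (W.rankedWalk hα hD).exists_excursion h₀
  have hoff := W.isOffPt hα.pos hD
  have hadj := W.adjacent hα.pos hD
  have hright : ∀ i ≤ d, heightAt α (q (j + 2 * d - i)) = i := fun i hi => by
    have := hdown (d - i) (by omega)
    rw [show j + d + (d - i) = j + 2 * d - i by omega] at this
    omega
  have hside : ∀ i ≤ d, 0 < i → i < topAt α →
      (0 < yCoord α (q (j + i)) ↔ 0 < yCoord α (q (j + 1))) := by
    intro i
    induction i with
    | zero => intro _ h; exact absurd h (lt_irrefl 0)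
    | succ i ih =>
      intro h1 _ h2
      rcases Nat.eq_zero_or_pos i with rfl | hpos
      · exact Iff.rfl
      · rw [← ih (by omega) hpos (by omega), ← add_assoc]
        have e1 := hup i (by omega)
        have e2 := hup (i + 1) h1
        rw [← add_assoc] at e2
        exact ((hadj (j + i)).2 (by omega) (by omega) (by omega) (by omega)).symm
  have hside' : ∀ i ≤ d, 0 < i → i < topAt α →
      (0 < yCoord α (q (j + 2 * d - i)) ↔ 0 < yCoord α (q (j + 2 * d - 1))) := by
    intro i
    induction i with
    | zero => intro _ h; exact absurd h (lt_irrefl 0)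
    | succ i ih =>
      intro h1 _ h2
      rcases Nat.eq_zero_or_pos i with rfl | hpos
      · exact Iff.rfl
      · rw [← ih (by omega) hpos (by omega)]
        have e1 := hright i (by omega)
        have e2 := hright (i + 1) h1
        have e3 : j + 2 * d - i = j + 2 * d - (i + 1) + 1 := by omega
        rw [e3] at e1 ⊢
        exact (hadj (j + 2 * d - (i + 1))).2 (by omega) (by omega) (by omega) (by omega)
  have hse : d < topAt α → (0 < yCoord α (q (j + 1)) ↔ 0 < yCoord α (q (j + 2 * d - 1))) := by
    intro h
    rw [← hside d le_rfl hd h, ← hside' d le_rfl hd h, show j + 2 * d - d = j + d by omega]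
  have hcellmem : ∀ i z, z ∈ σ i → SameSign α z (q (2 * i + 1)) := fun i z hz =>
    ((W.face i).isCellAt (W.mem_closure i)).sameSign hα.pos hz (W.mem_face i)
  refine ⟨d, hd, hdt, hup, hdown, ?_, hside, hse, ?_, ?_⟩
  · have h1 := hm d le_rfl
    have h2 := hm' 0 (Nat.zero_le _)
    have := mul_mem h1 h2
    simpa [mul_assoc] using this
  · intro h
    have hss : SameSign α (q (j + d - 1)) (q (j + d + 1)) := by
      have e1 := hup (d - 1) (by omega)
      have e2 := hright (d - 1) (by omega)
      rw [show j + (d - 1) = j + d - 1 by omega] at e1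
      rw [show j + 2 * d - (d - 1) = j + d + 1 by omega] at e2
      refine sameSign_of_heightAt (hoff _) (hoff _) (e1.trans e2.symm) fun h1 h2 => ?_
      have s1 := hside (d - 1) (by omega) (by omega) (by omega)
      have s2 := hside' (d - 1) (by omega) (by omega) (by omega)
      rw [show j + (d - 1) = j + d - 1 by omega] at s1
      rw [show j + 2 * d - (d - 1) = j + d + 1 by omega] at s2
      rw [s1, s2]
      exact h.elim hse id
    -- Odd positions are sectors; a turn inside one would identify its two boundary rays.
    have heven : Even (j + d) := by
      by_contra hodd
      obtain ⟨i, hi⟩ := Nat.not_even_iff_odd.1 hodd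
      refine W.pass i ?_
      rwa [show j + d - 1 = 2 * i by omega, show j + d + 1 = 2 * i + 2 by omega] at hss
    refine ⟨hss, heven, fun hmem => ?_⟩
    obtain ⟨i, hi⟩ : ∃ i, j + d - 1 = 2 * i + 1 := by
      obtain ⟨r, hr⟩ := heven
      exact ⟨r - 1, by omega⟩
    have hi' : j + d + 1 = 2 * i + 3 := by omega
    have m1 := hm (d - 1) (by omega)
    rw [show j + (d - 1) = 2 * i + 1 by omega, show (2 * i + 1) / 2 = i by omega] at m1
    have m2 := hm' 1 (by omega)
    rw [hi', show (2 * i + 3) / 2 = i + 1 by omega] at m2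
    rw [hi, hi'] at hss
    rw [hi] at hmem
    have m3 := stabAt_le_of_allowedLE hα (W.isNearby _) (W.isNearby _) hss.allowedLE
      (mul_mem (inv_mem m1) hmem)
    have m4 := mul_mem m3 (inv_mem m2)
    refine W.distinct i hss ?_
    convert m4 using 1
    group
  · ext c
    constructor
    · rintro ⟨i, h1, h2, rfl⟩
      by_cases h3 : 2 * i + 1 ≤ j + d
      · left
        have m1 := hm (2 * i + 1 - j) (by omega)
        have e1 := hup (2 * i + 1 - j) (by omega)
        have s1 := hside (2 * i + 1 - j) (by omega)
        rw [show j + (2 * i + 1 - j) = 2 * i + 1 by omega] at m1 e1 s1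
        rw [show (2 * i + 1) / 2 = i by omega] at m1
        refine ⟨σ i, W.face i, W.mem_closure i, ?_, q (2 * i + 1), W.mem_face i, by omega,
          fun h4 h5 => s1 (by omega) (by omega)⟩
        exact (cell_eq_cell hα ((W.face i).isCellAt (W.mem_closure i)) (W.mem_face i) m1).symm
      · right
        have m1 := hm' (2 * i + 1 - j - d) (by omega)
        have e1 := hright (j + 2 * d - (2 * i + 1)) (by omega)
        have s1 := hside' (j + 2 * d - (2 * i + 1)) (by omega)
        rw [show j + 2 * d - (j + 2 * d - (2 * i + 1)) = 2 * i + 1 by omega] at e1 s1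
        rw [show j + d + (2 * i + 1 - j - d) = 2 * i + 1 by omega,
          show (2 * i + 1) / 2 = i by omega] at m1
        refine ⟨σ i, W.face i, W.mem_closure i, ?_, q (2 * i + 1), W.mem_face i, by omega,
          fun h4 h5 => s1 (by omega) (by omega)⟩
        exact cell_eq_cell hα ((W.face i).isCellAt (W.mem_closure i)) (W.mem_face i) m1
    · have find : ∀ {ρ z l}, IsOpenFace ρ → α ∈ closure ρ → z ∈ ρ → SameSign α z (q l) →
          ∃ i, l = 2 * i + 1 ∧ ρ = σ i := by
        intro ρ z l hρ hc hz hs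
        obtain ⟨i, rfl | rfl⟩ := Nat.even_or_odd' l
        · exact absurd hs (not_sameSign_of_ray_of_sector (hρ.isSectorPt hα.pos hz) (W.ray i))
        · exact ⟨i, rfl, hρ.eq_of_sameSign hα (W.face i) hc (W.mem_closure i) hz (W.mem_face i) hs⟩
      rintro (⟨ρ, hρ, hc, rfl, z, hz, hle, hs⟩ | ⟨ρ, hρ, hc, rfl, z, hz, hle, hs⟩)
      · have e1 := hup _ hle
        obtain ⟨i, hi, rfl⟩ := find hρ hc hz (sameSign_of_heightAt
          ((hρ.isSectorPt hα.pos hz).isOffPt hD) (hoff (j + heightAt α z)) e1.symm fun h1 h2 => by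
            rw [hs h1 h2, hside _ hle h1 h2])
        have m1 := hm _ hle
        rw [hi, show (2 * i + 1) / 2 = i by omega] at m1
        exact ⟨i, by omega, by omega, cell_eq_cell hα (hρ.isCellAt hc) (W.mem_face i) m1⟩
      · have e1 := hright _ hle
        obtain ⟨i, hi, rfl⟩ := find hρ hc hz (sameSign_of_heightAt
          ((hρ.isSectorPt hα.pos hz).isOffPt hD) (hoff (j + 2 * d - heightAt α z)) e1.symm
          fun h1 h2 => by rw [hs h1 h2, hside' _ hle h1 h2])
        have m1 := hm' (d - heightAt α z) (by omega)
        rw [show j + d + (d - heightAt α z) = 2 * i + 1 by omega,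
          show (2 * i + 1) / 2 = i by omega] at m1
        exact ⟨i, by omega, by omega,
          (cell_eq_cell hα (hρ.isCellAt hc) (W.mem_face i) m1).symm⟩

end Excursion

/-! ### Angle estimates in the weight space -/

section Angles

variable {α : Fin 3 → ℝ}

theorem direction_eq_coord (hα : α ∈ posWeights) (β : Fin 3 → ℝ) :
    direction α β = WithLp.toLp 2
      ![(2 * (xCoord α β / α 0) - yCoord α β / α 1) / 3,
        (2 * (yCoord α β / α 1) - xCoord α β / α 0) / 3,
        -(xCoord α β / α 0 + yCoord α β / α 1) / 3] := by
  have h0 := (hα 0).ne'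
  have h1 := (hα 1).ne'
  have h2 := (hα 2).ne'
  rw [direction_eq hα]
  congr 1
  ext i
  fin_cases i <;> simp [Fin.sum_univ_three, xCoord, yCoord] <;> field_simp <;> ring

/-- In X = x / α₁ and Y = y / α₂ the metric is 2(X² - XY + Y²)/3, independently of α. This is why
the bounds, and with them ε₀, are uniform. -/
theorem inner_direction (hα : α ∈ posWeights) (β γ : Fin 3 → ℝ) :
    inner ℝ (direction α β) (direction α γ) =
      (2 * (xCoord α β / α 0) * (xCoord α γ / α 0) + 2 * (yCoord α β / α 1) * (yCoord α γ / α 1) -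
        (xCoord α β / α 0) * (yCoord α γ / α 1) - (xCoord α γ / α 0) * (yCoord α β / α 1)) / 3 := by
  rw [direction_eq_coord hα, direction_eq_coord hα]
  simp [PiLp.inner_apply, Fin.sum_univ_three]
  ring

theorem direction_eq_smul (hα : α ∈ posWeights) {β γ : Fin 3 → ℝ} {c : ℝ}
    (hx : xCoord α γ = c * xCoord α β) (hy : yCoord α γ = c * yCoord α β) :
    direction α γ = c • direction α β := by
  rw [direction_eq_coord hα, direction_eq_coord hα, hx, hy, ← WithLp.toLp_smul]
  congr 1
  ext i
  fin_cases i <;> simp <;> ring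

theorem direction_ne_zero (hα : α ∈ posWeights) {β : Fin 3 → ℝ} (h : IsOffPt α β) :
    direction α β ≠ 0 := by
  intro h0
  have h1 := inner_direction hα β β
  rw [h0, inner_zero_left] at h1
  set X := xCoord α β / α 0 with hX
  set Y := yCoord α β / α 1 with hY
  have hX0 : X = 0 := by
    nlinarith [sq_nonneg (X - Y), sq_nonneg (X - 2 * Y), sq_nonneg X, sq_nonneg Y, sq_nonneg (2 * X - Y)]
  have hY0 : Y = 0 := by nlinarith [sq_nonneg Y]
  rw [hX, div_eq_zero_iff] at hX0
  rw [hY, div_eq_zero_iff] at hY0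
  exact h ⟨hX0.resolve_right (hα 0).ne', hY0.resolve_right (hα 1).ne'⟩

theorem arccos_le_angle {V : Type*} [NormedAddCommGroup V] [InnerProductSpace ℝ V] {u v : V}
    (hu : u ≠ 0) (hv : v ≠ 0) {r : ℝ}
    (h : inner ℝ u v ≤ r * Real.sqrt (inner ℝ u u * inner ℝ v v)) :
    Real.arccos r ≤ InnerProductGeometry.angle u v := by
  unfold InnerProductGeometry.angle
  apply Real.antitone_arccos
  have hpos : 0 < ‖u‖ * ‖v‖ := mul_pos (norm_pos_iff.2 hu) (norm_pos_iff.2 hv)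
  rw [div_le_iff₀ hpos]
  rwa [real_inner_self_eq_norm_sq, real_inner_self_eq_norm_sq, ← mul_pow,
    Real.sqrt_sq hpos.le] at h

theorem le_mul_sqrt {p r A : ℝ} (hr : 0 ≤ r) (h : 0 ≤ p → p ^ 2 ≤ r ^ 2 * A) :
    p ≤ r * Real.sqrt A := by
  rcases le_total p 0 with hp | hp
  · exact hp.trans (mul_nonneg hr (Real.sqrt_nonneg _))
  · rw [← Real.sqrt_sq hr, ← Real.sqrt_mul (sq_nonneg r)]
    exact Real.le_sqrt_of_sq_le (h hp)

/-- The slope of an admissible line, in the coordinates `xCoord α β / α 0`, `yCoord α β / α 1`. -/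
def relSlope (α : Fin 3 → ℝ) (a : ℕ) : ℝ := a * α 1 / α 0

theorem relSlope_mem (hα : α ∈ posWeights) {a : ℕ} (ha : a ∈ critSlopes α) :
    0 ≤ relSlope α a ∧ relSlope α a ≤ 1 := by
  obtain ⟨b, hb⟩ := (mem_critSlopes hα).1 ha
  have h0 := hα 0
  have h1 := hα 1
  have h2 := hα 2
  refine ⟨by unfold relSlope; positivity, ?_⟩
  rw [relSlope, div_le_one h0, ← hb]
  have : 0 ≤ (b : ℝ) * α 2 := by positivity
  linarith

theorem xCoord_div_of_slopeForm (hα : α ∈ posWeights) {a : ℕ} {β : Fin 3 → ℝ}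
    (h : slopeForm α a β = 0) : xCoord α β / α 0 = relSlope α a * (yCoord α β / α 1) := by
  have h0 := (hα 0).ne'
  have h1 := (hα 1).ne'
  rw [slopeForm, sub_eq_zero] at h
  rw [h, relSlope]
  field_simp

/-- The cosine of the angle between the bottom and a ray of relative slope l is (2μ - 1) / (2 √(μ² -
μ + 1)), with μ = l for y < 0 and μ = 1 - l for y > 0. The last hypothesis compares it with r after
squaring. -/
theorem arccos_le_angle_bottom (hα : α ∈ posWeights) {β γ : Fin 3 → ℝ} (hx : xCoord α β < 0)
    (hy : yCoord α β = 0) {a : ℕ} (h : slopeForm α a γ = 0) (hy' : yCoord α γ ≠ 0) {μ r : ℝ}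
    (hμ : (yCoord α γ < 0 ∧ μ = relSlope α a) ∨ (0 < yCoord α γ ∧ μ = 1 - relSlope α a))
    (hr : 0 ≤ r) (hμr : 0 ≤ 2 * μ - 1 → (2 * μ - 1) ^ 2 ≤ 4 * r ^ 2 * (μ ^ 2 - μ + 1)) :
    Real.arccos r ≤ InnerProductGeometry.angle (direction α β) (direction α γ) := by
  refine arccos_le_angle (direction_ne_zero hα fun h => hx.ne h.1)
    (direction_ne_zero hα fun h => hy' h.2) (le_mul_sqrt hr ?_)
  rw [inner_direction hα, inner_direction hα, inner_direction hα, xCoord_div_of_slopeForm hα h, hy]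
  have hX : xCoord α β / α 0 < 0 := div_neg_of_neg_of_pos hx (hα 0)
  set X := xCoord α β / α 0
  set l := relSlope α a
  have hY : (yCoord α γ / α 1 < 0 ∧ μ = l) ∨ (0 < yCoord α γ / α 1 ∧ μ = 1 - l) :=
    hμ.imp (fun h => ⟨div_neg_of_neg_of_pos h.1 (hα 1), h.2⟩)
      fun h => ⟨div_pos h.1 (hα 1), h.2⟩
  set Y := yCoord α γ / α 1
  -- The substitution l ↦ 1 - l preserves l² - l + 1 and changes the sign of 2l - 1; u = |XY| treats
  -- both sides at once.
  obtain ⟨u, hu, hμu, hsq⟩ : ∃ u : ℝ, 0 < u ∧ X * Y * (2 * l - 1) = u * (2 * μ - 1) ∧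
      u ^ 2 * (μ ^ 2 - μ + 1) = X ^ 2 * Y ^ 2 * (l ^ 2 - l + 1) := by
    rcases hY with ⟨h1, rfl⟩ | ⟨h1, rfl⟩
    · exact ⟨X * Y, mul_pos_of_neg_of_neg hX h1, rfl, by ring⟩
    · exact ⟨-(X * Y), by rw [← neg_mul]; exact mul_pos (neg_pos.2 hX) h1, by ring, by ring⟩
  have e1 : (2 * X * (l * Y) + 2 * (0 / α 1) * Y - X * Y - l * Y * (0 / α 1)) / 3 =
      u * (2 * μ - 1) / 3 := by
    rw [← hμu]; ring
  have e2 : (2 * X * X + 2 * (0 / α 1) * (0 / α 1) - X * (0 / α 1) - X * (0 / α 1)) / 3 *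
      ((2 * (l * Y) * (l * Y) + 2 * Y * Y - l * Y * Y - l * Y * Y) / 3) =
      4 / 9 * (u ^ 2 * (μ ^ 2 - μ + 1)) := by
    rw [hsq]; ring
  rw [e1, e2]
  intro hp
  have h1 : 0 ≤ 2 * μ - 1 := by
    by_contra hneg
    have := mul_neg_of_pos_of_neg hu (not_le.1 hneg)
    linarith
  nlinarith [mul_le_mul_of_nonneg_left (hμr h1) (sq_nonneg u)]

/-- With r = 1/2 the comparison reduces to μ² ≤ μ, that is, to 0 ≤ μ ≤ 1. -/
theorem pi_div_three_le_angle_bottom (hα : α ∈ posWeights) {β γ : Fin 3 → ℝ}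
    (hx : xCoord α β < 0) (hy : yCoord α β = 0) {a : ℕ} (ha : a ∈ critSlopes α)
    (h : slopeForm α a γ = 0) (hy' : yCoord α γ ≠ 0) :
    Real.pi / 3 ≤ InnerProductGeometry.angle (direction α β) (direction α γ) := by
  obtain ⟨h0, h1⟩ := relSlope_mem hα ha
  rw [← Real.arccos_cos (x := Real.pi / 3) (by positivity) (by linarith [Real.pi_pos]),
    Real.cos_pi_div_three]
  rcases hy'.lt_or_gt with hn | hp
  · exact arccos_le_angle_bottom hα hx hy h hy' (Or.inl ⟨hn, rfl⟩) (by norm_num) fun _ => by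
      nlinarith
  · exact arccos_le_angle_bottom hα hx hy h hy' (Or.inr ⟨hp, rfl⟩) (by norm_num) fun _ => by
      nlinarith

/-- At μ = 5/6 the cosine is 2/√31, slightly below 9/25. This gap from the minimal angle π/3
supplies ε₀. -/
theorem arccos_le_angle_bottom_of_le (hα : α ∈ posWeights) {β γ : Fin 3 → ℝ}
    (hx : xCoord α β < 0) (hy : yCoord α β = 0) {a : ℕ}
    (h : slopeForm α a γ = 0) (hy' : yCoord α γ ≠ 0)
    (hμ : (yCoord α γ < 0 → relSlope α a ≤ 5 / 6) ∧ (0 < yCoord α γ → 1 / 6 ≤ relSlope α a)) :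
    Real.arccos (9 / 25) ≤ InnerProductGeometry.angle (direction α β) (direction α γ) := by
  rcases hy'.lt_or_gt with hn | hp
  · have := hμ.1 hn
    exact arccos_le_angle_bottom hα hx hy h hy' (Or.inl ⟨hn, rfl⟩) (by norm_num) fun _ => by
      nlinarith
  · have := hμ.2 hp
    exact arccos_le_angle_bottom hα hx hy h hy' (Or.inr ⟨hp, rfl⟩) (by norm_num) fun _ => by
      nlinarith

/-- Relative slopes lie in [0,1], so rays on opposite sides of y = 0 have cosine at most -1/2. In
the unflagged case this bounds the edges at the bottom and at the top. -/
theorem two_pi_div_three_le_angle (hα : α ∈ posWeights) {β γ : Fin 3 → ℝ} {a b : ℕ}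
    (ha : a ∈ critSlopes α) (hb : b ∈ critSlopes α) (hβ : slopeForm α a β = 0)
    (hγ : slopeForm α b γ = 0) (h : yCoord α β * yCoord α γ < 0) :
    2 * Real.pi / 3 ≤ InnerProductGeometry.angle (direction α β) (direction α γ) := by
  obtain ⟨h0, h1⟩ := relSlope_mem hα ha
  obtain ⟨h0', h1'⟩ := relSlope_mem hα hb
  have hhalf : Real.arccos (-(1 / 2)) = 2 * Real.pi / 3 := by
    rw [Real.arccos_neg, ← Real.cos_pi_div_three,
      Real.arccos_cos (x := Real.pi / 3) (by positivity) (by linarith [Real.pi_pos])]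
    ring
  rw [← hhalf]
  refine arccos_le_angle (direction_ne_zero hα fun h' => ?_) (direction_ne_zero hα fun h' => ?_) ?_
  · rw [h'.2] at h; simp at h
  · rw [h'.2] at h; simp at h
  rw [inner_direction hα, inner_direction hα, inner_direction hα, xCoord_div_of_slopeForm hα hβ,
    xCoord_div_of_slopeForm hα hγ]
  have hY : yCoord α β / α 1 * (yCoord α γ / α 1) < 0 := by
    rw [div_mul_div_comm]
    exact div_neg_of_neg_of_pos h (mul_pos (hα 1) (hα 1))
  set Y := yCoord α β / α 1
  set Y' := yCoord α γ / α 1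
  set l := relSlope α a
  set l' := relSlope α b
  have e1 : (2 * (l * Y) * (l' * Y') + 2 * Y * Y' - l * Y * Y' - l' * Y' * Y) / 3 =
      -(-(Y * Y') * (2 * l * l' + 2 - l - l') / 3) := by ring
  rw [e1, neg_mul (1 / 2 : ℝ), neg_le_neg_iff, ← Real.sqrt_sq (show (0 : ℝ) ≤ 1 / 2 by norm_num),
    ← Real.sqrt_mul (sq_nonneg _)]
  have hN : 0 ≤ 2 * l * l' + 2 - l - l' := by nlinarith [mul_nonneg h0 h0']
  refine Real.sqrt_le_iff.2 ⟨by
    have := mul_nonneg (neg_nonneg.2 hY.le) hN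
    linarith, ?_⟩
  -- The difference is three times a sum of products of l, l', 1 - l and 1 - l'.
  have key : (l ^ 2 - l + 1) * (l' ^ 2 - l' + 1) ≤ (2 * l * l' + 2 - l - l') ^ 2 := by
    have p1 : 0 ≤ (1 - l) * (1 - l') := mul_nonneg (sub_nonneg.2 h1) (sub_nonneg.2 h1')
    have p2 : 0 ≤ l * l' := mul_nonneg h0 h0'
    have p3 := mul_nonneg p1 p2
    have : (2 * l * l' + 2 - l - l') ^ 2 - (l ^ 2 - l + 1) * (l' ^ 2 - l' + 1) =
      3 * ((1 - l) * (1 - l') + l * l' + (1 - l) * (1 - l') * (l * l')) := by ring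
    linarith
  have := mul_le_mul_of_nonneg_left key (sq_nonneg (Y * Y'))
  nlinarith

/-- In the flagged case signs determine a ray including its side, so angles do not depend on the
chosen points. -/
theorem exists_pos_smul_of_sameSign (hD : (critSlopes α).Nonempty) (hf : IsFlagged α)
    {r p : Fin 3 → ℝ} (hr : IsRayPt α r) (hs : SameSign α p r) :
    ∃ c : ℝ, 0 < c ∧ xCoord α p = c * xCoord α r ∧ yCoord α p = c * yCoord α r := by
  have hpos : ∀ {u v : ℝ}, v ≠ 0 → SignType.sign u = SignType.sign v → 0 < u / v := by
    intro u v hv huv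
    rcases hv.lt_or_gt with h | h
    · rw [sign_neg h] at huv
      exact div_pos_of_neg_of_neg (sign_eq_neg_one_iff.1 huv) h
    · rw [sign_pos h] at huv
      exact div_pos (sign_eq_one_iff.1 huv) h
  have hsy := hs.2 hf
  by_cases hy : yCoord α r = 0
  · have hx : xCoord α r ≠ 0 := fun h => hr.2 ⟨h, hy⟩
    rw [hy, sign_zero] at hsy
    have hy' := sign_eq_zero_iff.1 hsy
    obtain ⟨a, ha⟩ := hD
    have := hs.1 a ha
    rw [slopeForm, slopeForm, hy, hy', mul_zero, sub_zero, sub_zero] at this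
    exact ⟨_, hpos hx this, by field_simp, by rw [hy, hy', mul_zero]⟩
  · obtain ⟨a, ha, h0⟩ := hr.1.resolve_right fun h => hy h.2
    have := hs.1 a ha
    rw [h0, sign_zero] at this
    have h0' := sign_eq_zero_iff.1 this
    refine ⟨_, hpos hy hsy, ?_, by field_simp⟩
    rw [slopeForm, sub_eq_zero] at h0 h0'
    rw [h0, h0']
    field_simp

end Angles

/-! ### Lengths of excursions -/

section Lengths

variable {k : Type*} [Field k] {α : Fin 3 → ℝ} {N : ℕ} {f : ℕ → PolyAut k}
  {σ : ℕ → Set (Fin 3 → ℝ)} {q : ℕ → Fin 3 → ℝ} {w : ℕ → ℝ}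

/-- The lengths `w i`, attributed to the odd indices `2 i + 1`. -/
def stepLength (w : ℕ → ℝ) (m : ℕ) : ℝ := if m % 2 = 1 then w (m / 2) else 0

theorem abs_sub_le_sum {B W : ℕ → ℝ} (h : ∀ m, |B (m + 1) - B m| ≤ W m) (j n : ℕ) :
    |B (j + n) - B j| ≤ ∑ i ∈ Finset.range n, W (j + i) := by
  induction n with
  | zero => simp
  | succ n ih =>
    rw [Finset.sum_range_succ]
    calc |B (j + (n + 1)) - B j| = |(B (j + n + 1) - B (j + n)) + (B (j + n) - B j)| := by
          rw [← add_assoc]; congr 1; ring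
      _ ≤ |B (j + n + 1) - B (j + n)| + |B (j + n) - B j| := abs_add_le _ _
      _ ≤ _ := by linarith [h (j + n)]

theorem LinkWalk.w_nonneg (W : LinkWalk α N f σ q w) (i : ℕ) : 0 ≤ w i := by
  obtain ⟨p, -, -, h⟩ := W.angle i
  rw [h]
  exact InnerProductGeometry.angle_nonneg _ _

theorem LinkWalk.stepLength_nonneg (W : LinkWalk α N f σ q w) (m : ℕ) : 0 ≤ stepLength w m := by
  unfold stepLength
  split_ifs
  · exact W.w_nonneg _
  · exact le_rfl

/-- The angle to the bottom direction is 1-Lipschitz along the walk, by the triangle inequality. It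
goes from 0 to its value at the turn and back to 0. -/
theorem LinkWalk.two_mul_angle_le (W : LinkWalk α N f σ q w) (hα : StrictWeight α)
    (hD : (critSlopes α).Nonempty) (hf : IsFlagged α) {j d : ℕ} (E : Excursion α f σ q j d)
    (hj : Even j) (hd : Even d) :
    2 * InnerProductGeometry.angle (direction α (q j)) (direction α (q (j + d))) ≤
      ∑ i ∈ Finset.range (2 * d), stepLength w (j + i) := by
  set v := direction α (q j) with hv
  -- Only rays are sampled, so B changes when a whole edge has been crossed; its length is
  -- attributed to the odd position.
  let B : ℕ → ℝ := fun m => InnerProductGeometry.angle v (direction α (q (2 * (m / 2))))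
  have hB : ∀ m, Even m → B m = InnerProductGeometry.angle v (direction α (q m)) := by
    rintro m ⟨r, rfl⟩
    simp only [B]
    rw [show 2 * ((r + r) / 2) = r + r by omega]
  have hstep : ∀ m, |B (m + 1) - B m| ≤ stepLength w m := by
    intro m
    obtain ⟨i, rfl | rfl⟩ := Nat.even_or_odd' m
    · have e : (2 * i + 1) / 2 = 2 * i / 2 := by omega
      simp only [B, e, sub_self, abs_zero]
      exact W.stepLength_nonneg _
    · have e1 : (2 * i + 1) / 2 = i := by omega
      have e2 : 2 * ((2 * i + 1 + 1) / 2) = 2 * i + 2 := by omega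
      have e3 : (2 * i + 1) % 2 = 1 := by omega
      simp only [B, e1, e2, stepLength, e3, if_true]
      obtain ⟨p, hps, -, hw⟩ := W.angle i
      obtain ⟨c, hc, hx, hy⟩ := exists_pos_smul_of_sameSign hD hf (W.ray (i + 1)) hps
      rw [hw, direction_eq_smul hα.pos hx hy, InnerProductGeometry.angle_smul_right_of_pos _ _ hc,
        show 2 * (i + 1) = 2 * i + 2 by ring, abs_le]
      have t1 := InnerProductGeometry.angle_le_angle_add_angle v (direction α (q (2 * i + 2)))
        (direction α (q (2 * i)))
      have t2 := InnerProductGeometry.angle_le_angle_add_angle v (direction α (q (2 * i)))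
        (direction α (q (2 * i + 2)))
      rw [InnerProductGeometry.angle_comm (direction α (q (2 * i + 2)))] at t1
      constructor <;> linarith
  have hv0 : v ≠ 0 := direction_ne_zero hα.pos (W.isOffPt hα.pos hD j)
  have b0 : B j = 0 := by
    rw [hB j hj, ← hv, InnerProductGeometry.angle_self hv0]
  have b2 : B (j + d + d) = 0 := by
    rw [hB _ (by rw [add_assoc]; exact hj.add (Even.add_self d))]
    have h0 : heightAt α (q j) = 0 := E.up 0 (Nat.zero_le _)
    have h2 : heightAt α (q (j + d + d)) = 0 := by
      have := E.down d le_rfl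
      omega
    have hs : SameSign α (q (j + d + d)) (q j) := sameSign_of_heightAt (W.isOffPt hα.pos hD _)
      (W.isOffPt hα.pos hD _) (h2.trans h0.symm) fun h => absurd h2 h.ne'
    obtain ⟨r, rfl⟩ := hj
    rw [← two_mul] at hs hv
    obtain ⟨c, hc, hx, hy⟩ := exists_pos_smul_of_sameSign hD hf (W.ray r) hs
    rw [← two_mul r]
    rw [direction_eq_smul hα.pos hx hy, InnerProductGeometry.angle_smul_right_of_pos _ _ hc, hv,
      InnerProductGeometry.angle_self (hv ▸ hv0)]
  have s1 := abs_sub_le_sum hstep j d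
  have s2 := abs_sub_le_sum hstep (j + d) d
  rw [b0, sub_zero] at s1
  rw [b2, zero_sub, abs_neg] at s2
  rw [two_mul d, Finset.sum_range_add]
  have s3 := le_abs_self (B (j + d))
  rw [hB _ (hj.add hd)] at s1 s2 s3
  simp only [← add_assoc]
  linarith

/-- Two boundary rays of a sector with equal rank are distinct, so they lie on opposite sides, and
`two_pi_div_three_le_angle` applies. -/
theorem LinkWalk.two_pi_div_three_le (W : LinkWalk α N f σ q w) (hα : StrictWeight α)
    (hD : IsFlagged α ∨ 2 ≤ (critSlopes α).card) (hD' : (critSlopes α).Nonempty)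
    (hf : ¬IsFlagged α) {i : ℕ} (h0 : 0 < heightAt α (q (2 * i)))
    (h1 : heightAt α (q (2 * i)) < topAt α)
    (he : heightAt α (q (2 * i)) = heightAt α (q (2 * i + 2))) : 2 * Real.pi / 3 ≤ w i := by
  obtain ⟨p, hps, hpo, hw⟩ := W.angle i
  have hoff := W.isOffPt hα.pos hD'
  have hpe : heightAt α p = heightAt α (q (2 * i + 2)) := hgt_eq_of_sameSignXY hD' hps
  have hpy := pos_iff_of_sameSignXY hD hpo (hoff _) hps
    (by change 0 < heightAt α p; omega) (by change heightAt α p < topAt α; omega) hpe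
  have hns : ¬ (0 < yCoord α (q (2 * i)) ↔ 0 < yCoord α p) := fun hiff =>
    W.pass i (sameSign_of_heightAt (hoff _) (hoff _) he fun _ _ => hiff.trans hpy)
  have hy : yCoord α (q (2 * i)) ≠ 0 := y_ne_zero_of_hgt (hoff _) h0 h1
  have hy' : yCoord α p ≠ 0 := y_ne_zero_of_hgt (fl := IsFlagged α) (D := critSlopes α) hpo
    (by change 0 < heightAt α p; omega) (by change heightAt α p < topAt α; omega)
  obtain ⟨a, ha, hz⟩ := (W.ray i).1.resolve_right fun h => hf h.1
  obtain ⟨b, hb, hz'⟩ := (W.ray (i + 1)).1.resolve_right fun h => hf h.1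
  have hz'' : slopeForm α b p = 0 := by
    have := hps.1 b hb
    rw [show 2 * i + 2 = 2 * (i + 1) by ring, hz', sign_zero] at this
    exact sign_eq_zero_iff.1 this
  rw [hw]
  refine two_pi_div_three_le_angle hα.pos ha hb hz hz'' ?_
  by_contra hneg
  have hmul : 0 < yCoord α (q (2 * i)) * yCoord α p :=
    lt_of_le_of_ne (not_lt.1 hneg) (mul_ne_zero hy hy').symm
  rcases pos_and_pos_or_neg_and_neg_of_mul_pos hmul with h | h
  · exact hns ⟨fun _ => h.2, fun _ => h.1⟩
  · exact hns ⟨fun h' => absurd h' h.1.not_gt, fun h' => absurd h' h.2.not_gt⟩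

theorem LinkWalk.sum_stepLength (W : LinkWalk α N f σ q w) (j : ℕ) :
    ∑ i ∈ Finset.range (2 * N), stepLength w (j + i) = ∑ i ∈ Finset.range N, w i := by
  have hper : ∀ m, stepLength w (m + 2 * N) = stepLength w m := fun m => by
    have e1 : (m + 2 * N) % 2 = m % 2 := by omega
    have e2 : (m + 2 * N) / 2 = m / 2 + N := by omega
    simp only [stepLength, e1, e2, W.per_w]
  induction j with
  | zero =>
    clear hper
    generalize N = n
    induction n with
    | zero => simp
    | succ n ih =>
      rw [show 2 * (n + 1) = 2 * n + 1 + 1 by ring, Finset.sum_range_succ, Finset.sum_range_succ,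
        ih, Finset.sum_range_succ]
      have e1 : (2 * n + 1) % 2 = 1 := by omega
      have e2 : (2 * n + 1) / 2 = n := by omega
      have e3 : (2 * n) % 2 ≠ 1 := by omega
      simp [stepLength, e1, e2]
  | succ j ih =>
    rw [← ih]
    have h1 := Finset.sum_range_succ (fun i => stepLength w (j + i)) (2 * N)
    have h2 := Finset.sum_range_succ' (fun i => stepLength w (j + i)) (2 * N)
    rw [hper j] at h1
    simp only [add_zero] at h2
    have h3 : ∀ i, j + 1 + i = j + (i + 1) := fun i => by ring
    simp only [h3]
    linarith

end Lengths

/-! ### Branching of two apartments and symmetric differences -/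

section Forks

variable {k : Type*} [Field k] {α : Fin 3 → ℝ} {N : ℕ} {f : ℕ → PolyAut k}
  {σ : ℕ → Set (Fin 3 → ℝ)} {q : ℕ → Fin 3 → ℝ} {w : ℕ → ℝ}

theorem cell_eq_cell_iff (hα : StrictWeight α) {g h : PolyAut k}
    (hg : g ∈ tameStab (valPt (1 : PolyAut k) α)) (hh : h ∈ tameStab (valPt (1 : PolyAut k) α))
    {ρ ρ' : Set (Fin 3 → ℝ)} (hρ : IsOpenFace ρ) (hρ' : IsOpenFace ρ') (hc : α ∈ closure ρ)
    (hc' : α ∈ closure ρ') {x : Fin 3 → ℝ} (hx : x ∈ ρ) :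
    cell g ρ = cell h ρ' ↔ ρ = ρ' ∧ g⁻¹ * h ∈ stabAt k α x := by
  constructor
  · intro he
    have h1 : valPt g x ∈ cell h ρ' := he ▸ ⟨x, hx, rfl⟩
    obtain ⟨y, hy, hyx⟩ := h1
    obtain ⟨⟨c, hc0, hcy⟩, h2⟩ := valPt_eq_of_mem_tameStab hα ((hρ.isCellAt hc).sub hx).1 hh hg hyx
    refine ⟨hρ.eq_of_sameSign hα hρ' hc hc' hx hy (hcy ▸ sameSign_smul hc0), ?_⟩
    have := inv_mem h2
    rwa [mul_inv_rev, inv_inv] at this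
  · rintro ⟨rfl, h2⟩
    exact cell_eq_cell hα (hρ.isCellAt hc) hx h2

theorem apartmentLink_eq (hα : StrictWeight α) {g : PolyAut k}
    (hg : g ∈ tameStab (valPt (1 : PolyAut k) α)) :
    apartmentLink α g = {c | ∃ ρ, IsOpenFace ρ ∧ α ∈ closure ρ ∧ c = cell g ρ} := by
  ext c
  constructor
  · rintro ⟨⟨h, hh, ρ, hρ, hc, rfl⟩, hsub⟩
    obtain ⟨x, hx⟩ := (hρ.isCellAt hc).nonempty
    obtain ⟨y, hy, hyx⟩ := hsub ⟨x, hx, rfl⟩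
    have h2 := (valPt_eq_of_mem_tameStab hα ((hρ.isCellAt hc).sub hx).1 hg hh hyx).2
    exact ⟨ρ, hρ, hc, (cell_eq_cell hα (hρ.isCellAt hc) hx h2).symm⟩
  · rintro ⟨ρ, hρ, hc, rfl⟩
    exact ⟨⟨g, hg, ρ, hρ, hc, rfl⟩, Set.image_mono fun y hy => ((hρ.isCellAt hc).sub hy).1⟩

/-- Apartments through ν can only be glued by the identity on weights, so the symmetric difference
lies over the sectors not fixed by g⁻¹h. -/
theorem symmDiff_apartmentLink (hα : StrictWeight α) {g h : PolyAut k}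
    (hg : g ∈ tameStab (valPt (1 : PolyAut k) α)) (hh : h ∈ tameStab (valPt (1 : PolyAut k) α)) :
    (apartmentLink α g ∪ apartmentLink α h) \ (apartmentLink α g ∩ apartmentLink α h) =
      {c | ∃ ρ, IsOpenFace ρ ∧ α ∈ closure ρ ∧ ∃ x ∈ ρ, g⁻¹ * h ∉ stabAt k α x ∧
        (c = cell g ρ ∨ c = cell h ρ)} := by
  rw [apartmentLink_eq hα hg, apartmentLink_eq hα hh]
  have hinv : ∀ {x}, h⁻¹ * g ∈ stabAt k α x → g⁻¹ * h ∈ stabAt k α x := fun hm => by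
    have := inv_mem hm
    rwa [mul_inv_rev, inv_inv] at this
  ext c
  constructor
  · rintro ⟨⟨ρ, hρ, hc, rfl⟩ | ⟨ρ, hρ, hc, rfl⟩, hn⟩
    · obtain ⟨x, hx⟩ := (hρ.isCellAt hc).nonempty
      refine ⟨ρ, hρ, hc, x, hx, fun hm => hn ⟨⟨ρ, hρ, hc, rfl⟩, ρ, hρ, hc, ?_⟩, Or.inl rfl⟩
      exact cell_eq_cell hα (hρ.isCellAt hc) hx hm
    · obtain ⟨x, hx⟩ := (hρ.isCellAt hc).nonempty
      refine ⟨ρ, hρ, hc, x, hx, fun hm => hn ⟨⟨ρ, hρ, hc, ?_⟩, ρ, hρ, hc, rfl⟩, Or.inr rfl⟩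
      exact (cell_eq_cell hα (hρ.isCellAt hc) hx hm).symm
  · rintro ⟨ρ, hρ, hc, x, hx, hm, rfl | rfl⟩
    · refine ⟨Or.inl ⟨ρ, hρ, hc, rfl⟩, ?_⟩
      rintro ⟨-, ρ', hρ', hc', he⟩
      exact hm ((cell_eq_cell_iff hα hg hh hρ hρ' hc hc' hx).1 he).2
    · refine ⟨Or.inr ⟨ρ, hρ, hc, rfl⟩, ?_⟩
      rintro ⟨⟨ρ', hρ', hc', he⟩, -⟩
      exact hm (hinv ((cell_eq_cell_iff hα hh hg hρ hρ' hc hc' hx).1 he).2)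

/-- The direction of `x` is on the side `b`, if it is on one of the two sides. -/
def OnSide (α x : Fin 3 → ℝ) (b : Prop) : Prop :=
  0 < heightAt α x → heightAt α x < topAt α → (0 < yCoord α x ↔ b)

/-- On the side `b`, the apartments of `g` and `h` branch at a direction of rank `d`. -/
structure Fork (α : Fin 3 → ℝ) (g h : PolyAut k) (b : Prop) (d : ℕ) (t z : Fin 3 → ℝ) : Prop where
  near_t : IsNearby α t
  ray_t : IsRayPt α t
  height_t : heightAt α t = d
  side_t : OnSide α t b
  near_z : IsNearby α z
  off_z : IsOffPt α z
  height_z : heightAt α z + 1 = d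
  side_z : OnSide α z b
  mem : g⁻¹ * h ∈ stabAt k α t
  notMem : g⁻¹ * h ∉ stabAt k α z

theorem Fork.symm {g h : PolyAut k} {b : Prop} {d : ℕ} {t z : Fin 3 → ℝ}
    (F : Fork α g h b d t z) : Fork α h g b d t z :=
  { F with
    mem := by
      have := inv_mem F.mem
      rwa [mul_inv_rev, inv_inv] at this
    notMem := fun hm => by
      have := inv_mem hm
      rw [mul_inv_rev, inv_inv] at this
      exact F.notMem this }

/-- On one side the half-planes that bound fixed sets are nested and all contain the top. Climbing
at positive rank therefore loses no condition. -/
theorem stabAt_le_of_heightAt_le (hα : StrictWeight α) {x y : Fin 3 → ℝ} (hx : IsNearby α x)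
    (hy : IsNearby α y) (hx' : IsOffPt α x) (hy' : IsOffPt α y) (h0 : 0 < heightAt α x)
    (hle : heightAt α x ≤ heightAt α y) {b : Prop} (hbx : OnSide α x b) (hby : OnSide α y b) :
    stabAt k α x ≤ stabAt k α y := by
  refine stabAt_le_of_allowedLE hα hx hy (allowedLE_of_hgt_le hx' hy' h0 hle fun ht => ?_)
  have ht' : heightAt α y < topAt α := ht
  rw [hbx h0 (by omega), hby (by omega) ht']

theorem heightAt_pos_of_sector (hf : IsFlagged α) {x : Fin 3 → ℝ} (hx : IsSectorPt α x) :
    0 < heightAt α x ∧ heightAt α x < topAt α := by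
  refine ⟨Nat.pos_of_ne_zero fun h => hx.2 hf ((of_hgt_eq_zero h).2 hf).1,
    lt_of_le_of_ne hgt_le_topHgt fun h => hx.2 hf ((of_hgt_eq_topHgt h).2 hf).1⟩

/-- By monotonicity, being fixed at rank d propagates upwards, and failing at rank d - 1 propagates
downwards. A sector cannot have rank d on this side, because the ray t occupies it. -/
theorem Fork.notMem_iff (hα : StrictWeight α) (hD : (critSlopes α).Nonempty)
    {g h : PolyAut k} {b : Prop} {d : ℕ} {t z : Fin 3 → ℝ} (F : Fork α g h b d t z)
    {x : Fin 3 → ℝ} (hx : IsSectorPt α x) (hxn : IsNearby α x) (hb : OnSide α x b) :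
    g⁻¹ * h ∉ stabAt k α x ↔ heightAt α x ≤ d := by
  have hxo := hx.isOffPt hD
  have ht := F.height_t
  have hz := F.height_z
  constructor
  · intro hm
    by_contra hlt
    exact hm (stabAt_le_of_heightAt_le hα F.near_t hxn F.ray_t.2 hxo (by omega) (by omega)
      F.side_t hb F.mem)
  · intro hle hm
    have hne : heightAt α x ≠ d := fun he =>
      not_sameSign_of_ray_of_sector hx F.ray_t (sameSign_of_heightAt hxo F.ray_t.2
        (he.trans ht.symm) fun h1 h2 => by
          rw [hb h1 h2, F.side_t (by omega) (by omega)])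
    refine F.notMem ?_
    rcases Nat.eq_zero_or_pos (heightAt α x) with h0 | h0
    · refine stabAt_le_of_allowedLE hα hxn F.near_z (allowedLE_of_bot h0 fun hf => ?_) hm
      exact absurd h0 (heightAt_pos_of_sector hf hx).1.ne'
    · exact stabAt_le_of_heightAt_le hα hxn F.near_z hxo F.off_z h0 (by omega) hb F.side_z hm

theorem Fork.arm_union (hα : StrictWeight α) (hD : (critSlopes α).Nonempty)
    {g h : PolyAut k} {b : Prop} {d : ℕ} {t z : Fin 3 → ℝ} (F : Fork α g h b d t z) :
    arm α g b d ∪ arm α h b d = {c | ∃ ρ, IsOpenFace ρ ∧ α ∈ closure ρ ∧ ∃ x ∈ ρ,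
      (g⁻¹ * h ∉ stabAt k α x ∧ OnSide α x b) ∧ (c = cell g ρ ∨ c = cell h ρ)} := by
  have key : ∀ ρ, IsOpenFace ρ → α ∈ closure ρ → ∀ x ∈ ρ, OnSide α x b →
      (g⁻¹ * h ∉ stabAt k α x ↔ heightAt α x ≤ d) := fun ρ hρ hc x hx hb =>
    F.notMem_iff hα hD (hρ.isSectorPt hα.pos hx) ((hρ.isCellAt hc).isNearby hx) hb
  ext c
  constructor
  · rintro (⟨ρ, hρ, hc, rfl, x, hx, hle, hb⟩ | ⟨ρ, hρ, hc, rfl, x, hx, hle, hb⟩)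
    · exact ⟨ρ, hρ, hc, x, hx, ⟨(key ρ hρ hc x hx hb).2 hle, hb⟩, Or.inl rfl⟩
    · exact ⟨ρ, hρ, hc, x, hx, ⟨(key ρ hρ hc x hx hb).2 hle, hb⟩, Or.inr rfl⟩
  · rintro ⟨ρ, hρ, hc, x, hx, ⟨hm, hb⟩, rfl | rfl⟩
    · exact Or.inl ⟨ρ, hρ, hc, rfl, x, hx, (key ρ hρ hc x hx hb).1 hm, hb⟩
    · exact Or.inr ⟨ρ, hρ, hc, rfl, x, hx, (key ρ hρ hc x hx hb).1 hm, hb⟩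

theorem Fork.union_eq_symmDiff (hα : StrictWeight α) (hD : (critSlopes α).Nonempty)
    {g h : PolyAut k} (hg : g ∈ tameStab (valPt (1 : PolyAut k) α))
    (hh : h ∈ tameStab (valPt (1 : PolyAut k) α)) {d d' : ℕ} {t z t' z' : Fin 3 → ℝ}
    (F : Fork α g h True d t z) (F' : Fork α g h False d' t' z') :
    (arm α g True d ∪ arm α h True d) ∪ (arm α g False d' ∪ arm α h False d') =
      (apartmentLink α g ∪ apartmentLink α h) \ (apartmentLink α g ∩ apartmentLink α h) := by
  rw [F.arm_union hα hD, F'.arm_union hα hD, symmDiff_apartmentLink hα hg hh]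
  ext c
  constructor
  · rintro (⟨ρ, hρ, hc, x, hx, ⟨hm, -⟩, hcc⟩ | ⟨ρ, hρ, hc, x, hx, ⟨hm, -⟩, hcc⟩) <;>
      exact ⟨ρ, hρ, hc, x, hx, hm, hcc⟩
  · rintro ⟨ρ, hρ, hc, x, hx, hm, hcc⟩
    by_cases hy : 0 < yCoord α x
    · exact Or.inl ⟨ρ, hρ, hc, x, hx, ⟨hm, fun _ _ => by simp [hy]⟩, hcc⟩
    · exact Or.inr ⟨ρ, hρ, hc, x, hx, ⟨hm, fun _ _ => by simp [hy]⟩, hcc⟩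

/-- `g⁻¹ * h` fixes a direction of rank `0`. -/
def BotRel (α : Fin 3 → ℝ) (g h : PolyAut k) : Prop :=
  ∃ r, IsNearby α r ∧ IsOffPt α r ∧ heightAt α r = 0 ∧ g⁻¹ * h ∈ stabAt k α r

theorem BotRel.symm {g h : PolyAut k} (H : BotRel α g h) : BotRel α h g := by
  obtain ⟨r, h1, h2, h3, h4⟩ := H
  refine ⟨r, h1, h2, h3, ?_⟩
  have := inv_mem h4
  rwa [mul_inv_rev, inv_inv] at this

/-- All slope forms are negative at the bottom, so an element fixing it has no monomial of weight α₁
in x₂, x₃. The only possible obstruction left is x₃^p in the second component, which asks for y ≥ 0.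
-/
theorem BotRel.mem_stabAt (hα : StrictWeight α) {g h : PolyAut k} (H : BotRel α g h)
    {x : Fin 3 → ℝ} (hx : IsNearby α x) (hf : IsFlagged α → 0 ≤ yCoord α x) :
    g⁻¹ * h ∈ stabAt k α x := by
  obtain ⟨r, h1, h2, h3, h4⟩ := H
  exact stabAt_le_of_allowedLE hα h1 hx (allowedLE_of_bot h3 hf) h4

theorem nonneg_yCoord_of_onSide (hf : IsFlagged α) {x : Fin 3 → ℝ}
    (hs : OnSide α x True) : 0 ≤ yCoord α x := by
  by_contra hneg
  rcases Nat.eq_zero_or_pos (heightAt α x) with h0 | h0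
  · exact hneg ((of_hgt_eq_zero h0).2 hf).1.ge
  rcases (hgt_le_topHgt : heightAt α x ≤ topAt α).eq_or_lt with h1 | h1
  · exact hneg ((of_hgt_eq_topHgt h1).2 hf).1.ge
  · exact hneg ((hs h0 h1).2 trivial).le

theorem BotRel.arm_eq (hα : StrictWeight α) {g h : PolyAut k}
    (H : BotRel α g h) {b : Prop} (hb : IsFlagged α → b) (d : ℕ) : arm α g b d = arm α h b d := by
  have key : ∀ {g h : PolyAut k}, BotRel α g h → arm α g b d ⊆ arm α h b d := by
    rintro g h H _ ⟨ρ, hρ, hc, rfl, x, hx, hle, hs⟩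
    refine ⟨ρ, hρ, hc, ?_, x, hx, hle, hs⟩
    refine cell_eq_cell hα (hρ.isCellAt hc) hx
      (H.mem_stabAt hα ((hρ.isCellAt hc).isNearby hx) fun hf => ?_)
    have : OnSide α x True := fun h1 h2 => by rw [hs h1 h2]; simp [hb hf]
    exact nonneg_yCoord_of_onSide hf this
  exact Set.Subset.antisymm (key H) (key H.symm)

/-- Charts related through the bottom agree on the side in question: on any side if unflagged, on y
> 0 if flagged. They may then be exchanged, and two excursions on opposite sides can be written with
the same pair of apartments. -/
theorem Fork.of_botRel (hα : StrictWeight α) {g h g' h' : PolyAut k}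
    {b : Prop} {d : ℕ} {t z : Fin 3 → ℝ} (F : Fork α g h b d t z) (hb : IsFlagged α → b)
    (Hg : BotRel α g' g) (Hh : BotRel α h h') : Fork α g' h' b d t z := by
  have tt : ∀ x, OnSide α x b → IsFlagged α → OnSide α x True := fun x hs hf h1 h2 => by
    rw [hs h1 h2]; simp [hb hf]
  have t1 : IsFlagged α → 0 ≤ yCoord α t := fun hf =>
    nonneg_yCoord_of_onSide hf (tt t F.side_t hf)
  have z1 : IsFlagged α → 0 ≤ yCoord α z := fun hf =>
    nonneg_yCoord_of_onSide hf (tt z F.side_z hf)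
  refine { F with mem := ?_, notMem := fun hm => F.notMem ?_ }
  · have := mul_mem (mul_mem (Hg.mem_stabAt hα F.near_t t1) F.mem) (Hh.mem_stabAt hα F.near_t t1)
    convert this using 1
    group
  · have := mul_mem (mul_mem (Hg.symm.mem_stabAt hα F.near_z z1) hm)
      (Hh.symm.mem_stabAt hα F.near_z z1)
    convert this using 1
    group

/-- Two excursions on different sides form the symmetric difference of two apartments. -/
theorem exists_symmDiff (hα : StrictWeight α) (hD : (critSlopes α).Nonempty)
    {g₁ h₁ g₂ h₂ : PolyAut k} (hg₂ : g₂ ∈ tameStab (valPt (1 : PolyAut k) α))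
    (hh₂ : h₂ ∈ tameStab (valPt (1 : PolyAut k) α)) {d₁ d₂ : ℕ} {t₁ z₁ t₂ z₂ : Fin 3 → ℝ}
    (F₁ : Fork α g₁ h₁ True d₁ t₁ z₁) (F₂ : Fork α g₂ h₂ False d₂ t₂ z₂)
    (H₁ : BotRel α h₁ g₂) (H₂ : BotRel α h₂ g₁) :
    (arm α g₁ True d₁ ∪ arm α h₁ True d₁) ∪ (arm α g₂ False d₂ ∪ arm α h₂ False d₂) =
      (apartmentLink α h₂ ∪ apartmentLink α g₂) \ (apartmentLink α h₂ ∩ apartmentLink α g₂) := by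
  rw [H₁.arm_eq hα (fun _ => trivial), ← H₂.arm_eq hα (fun _ => trivial),
    Set.union_comm (arm α g₂ False d₂)]
  exact (F₁.of_botRel hα (fun _ => trivial) H₂ H₁).union_eq_symmDiff hα hD hh₂ hg₂ F₂.symm

theorem Excursion.fork (W : LinkWalk α N f σ q w) (hα : StrictWeight α)
    (hD : (critSlopes α).Nonempty) {j d : ℕ} (E : Excursion α f σ q j d)
    (h : d < topAt α ∨ (0 < yCoord α (q (j + 1)) ↔ 0 < yCoord α (q (j + 2 * d - 1)))) :
    Fork α (f (j / 2)) (f ((j + 2 * d - 1) / 2)) (0 < yCoord α (q (j + 1))) d (q (j + d))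
      (q (j + d - 1)) := by
  obtain ⟨-, heven, hn⟩ := E.same h
  have hd := E.pos
  have e1 := E.up d le_rfl
  have e2 := E.up (d - 1) (by omega)
  rw [show j + (d - 1) = j + d - 1 by omega] at e2
  refine
    { near_t := W.isNearby _
      ray_t := ?_
      height_t := e1
      side_t := fun h1 h2 => E.side_up d le_rfl hd (by omega)
      near_z := W.isNearby _
      off_z := W.isOffPt hα.pos hD _
      height_z := by omega
      side_z := fun h1 h2 => by
        have := E.side_up (d - 1) (by omega) (by omega) (by omega)
        rwa [show j + (d - 1) = j + d - 1 by omega] at this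
      mem := E.mem_turn
      notMem := hn }
  obtain ⟨r, hr⟩ := heven
  rw [hr, ← two_mul]
  exact W.ray r

theorem LinkWalk.botRel (W : LinkWalk α N f σ q w) (hα : StrictWeight α)
    (hD : (critSlopes α).Nonempty) {j : ℕ} (h : heightAt α (q (j + 1)) = 0) :
    BotRel α (f (j / 2)) (f ((j + 1) / 2)) :=
  ⟨_, W.isNearby _, W.isOffPt hα.pos hD _, h, (W.rankedWalk hα hD).link j⟩

/-- The faces on the two sides make up the whole apartment. -/
theorem arm_union_arm_top (hα : StrictWeight α) {g : PolyAut k}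
    (hg : g ∈ tameStab (valPt (1 : PolyAut k) α)) :
    arm α g True (topAt α) ∪ arm α g False (topAt α) = apartmentLink α g := by
  rw [apartmentLink_eq hα hg]
  ext c
  constructor
  · rintro (⟨ρ, hρ, hc, rfl, -⟩ | ⟨ρ, hρ, hc, rfl, -⟩) <;> exact ⟨ρ, hρ, hc, rfl⟩
  · rintro ⟨ρ, hρ, hc, rfl⟩
    obtain ⟨x, hx⟩ := (hρ.isCellAt hc).nonempty
    by_cases hy : 0 < yCoord α x
    · exact Or.inl ⟨ρ, hρ, hc, rfl, x, hx, hgt_le_topHgt, fun _ _ => by simp [hy]⟩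
    · exact Or.inr ⟨ρ, hρ, hc, rfl, x, hx, hgt_le_topHgt, fun _ _ => by simp [hy]⟩

/-- Two apartments that agree on the side `y > 0`. -/
theorem arm_union_arm_eq_symmDiff (hα : StrictWeight α) (hD : (critSlopes α).Nonempty)
    {g h : PolyAut k} (hg : g ∈ tameStab (valPt (1 : PolyAut k) α))
    (hh : h ∈ tameStab (valPt (1 : PolyAut k) α)) {d : ℕ} {t z : Fin 3 → ℝ}
    (F : Fork α g h False d t z) (H : BotRel α g h) :
    arm α g False d ∪ arm α h False d =
      (apartmentLink α g ∪ apartmentLink α h) \ (apartmentLink α g ∩ apartmentLink α h) := by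
  rw [F.arm_union hα hD, symmDiff_apartmentLink hα hg hh]
  ext c
  constructor
  · rintro ⟨ρ, hρ, hc, x, hx, ⟨hm, -⟩, hcc⟩
    exact ⟨ρ, hρ, hc, x, hx, hm, hcc⟩
  · rintro ⟨ρ, hρ, hc, x, hx, hm, hcc⟩
    refine ⟨ρ, hρ, hc, x, hx, ⟨hm, fun h1 h2 => ?_⟩, hcc⟩
    simp only [iff_false]
    intro hy
    exact hm (H.mem_stabAt hα ((hρ.isCellAt hc).isNearby hx) fun _ => hy.le)

end Forks

/-! ### Cutting a cycle into excursions; the unflagged case -/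

section Decomposition

variable {k : Type*} [Field k] {α : Fin 3 → ℝ} {N : ℕ} {f : ℕ → PolyAut k}
  {σ : ℕ → Set (Fin 3 → ℝ)} {q : ℕ → Fin 3 → ℝ} {w : ℕ → ℝ}

/-- The edges visited between the positions `j` and `e`. -/
def visited (f : ℕ → PolyAut k) (σ : ℕ → Set (Fin 3 → ℝ)) (j e : ℕ) : Set (Set (ValClass k)) :=
  {c | ∃ i, j ≤ 2 * i + 1 ∧ 2 * i + 1 ≤ e ∧ c = cell (f i) (σ i)}

theorem visited_union {j l e : ℕ} (h : j ≤ l) (h' : l ≤ e) :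
    visited f σ j l ∪ visited f σ l e = visited f σ j e := by
  ext c
  constructor
  · rintro (⟨i, h1, h2, rfl⟩ | ⟨i, h1, h2, rfl⟩)
    · exact ⟨i, h1, h2.trans h', rfl⟩
    · exact ⟨i, h.trans h1, h2, rfl⟩
  · rintro ⟨i, h1, h2, rfl⟩
    rcases le_total (2 * i + 1) l with h3 | h3
    · exact Or.inl ⟨i, h1, h3, rfl⟩
    · exact Or.inr ⟨i, h3, h2, rfl⟩

theorem LinkWalk.per_cell (W : LinkWalk α N f σ q w) (i n : ℕ) :
    cell (f (i + n * N)) (σ (i + n * N)) = cell (f i) (σ i) := by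
  induction n with
  | zero => simp
  | succ n ih => rw [← ih, Nat.succ_mul, ← add_assoc, W.per_f, W.per_σ]

theorem LinkWalk.visited_eq_range (W : LinkWalk α N f σ q w) (j : ℕ) :
    visited f σ j (j + 2 * N) = Set.range fun i => cell (f i) (σ i) := by
  have hN := W.two_le
  ext c
  constructor
  · rintro ⟨i, -, -, rfl⟩
    exact ⟨i, rfl⟩
  · rintro ⟨i, rfl⟩
    obtain ⟨M, rfl⟩ : ∃ M, N = M + 1 := ⟨N - 1, by omega⟩
    -- As M ≡ -1 modulo N, the residue r represents i - j/2 without natural subtraction.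
    have hr := Nat.mod_lt (i + j / 2 * M) (Nat.succ_pos M)
    have hn := Nat.mod_add_div (i + j / 2 * M) (M + 1)
    set r := (i + j / 2 * M) % (M + 1)
    have e : i + j / 2 * (M + 1) = j / 2 + r + (i + j / 2 * M) / (M + 1) * (M + 1) := by
      rw [mul_comm _ (M + 1), Nat.mul_succ]
      nlinarith
    refine ⟨j / 2 + r, by omega, by omega, ?_⟩
    change cell (f i) (σ i) = _
    rw [← W.per_cell i (j / 2), e, W.per_cell]

theorem LinkWalk.f_add (W : LinkWalk α N f σ q w) (j : ℕ) : f ((j + 2 * N) / 2) = f (j / 2) := by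
  rw [show (j + 2 * N) / 2 = j / 2 + N by omega, W.per_f]

theorem LinkWalk.q_add_one (W : LinkWalk α N f σ q w) (j : ℕ) :
    q (j + 2 * N + 1) = q (j + 1) := by
  rw [show j + 2 * N + 1 = j + 1 + 2 * N by ring, W.per_q]

/-- The length of the part of a cycle between the positions `j` and `j + n`. -/
def partLength (w : ℕ → ℝ) (j n : ℕ) : ℝ := ∑ i ∈ Finset.range n, stepLength w (j + i)

theorem partLength_add (w : ℕ → ℝ) (j m n : ℕ) :
    partLength w j (m + n) = partLength w j m + partLength w (j + m) n := by
  simp only [partLength, Finset.sum_range_add, add_assoc]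

theorem LinkWalk.partLength_nonneg (W : LinkWalk α N f σ q w) (j n : ℕ) : 0 ≤ partLength w j n :=
  Finset.sum_nonneg fun _ _ => W.stepLength_nonneg _

theorem Excursion.le_of_height_eq_zero {j d l : ℕ} (E : Excursion α f σ q j d) (hl : j < l)
    (h : heightAt α (q l) = 0) : j + 2 * d ≤ l := by
  by_contra hlt
  rcases le_total l (j + d) with h1 | h1
  · have := E.up (l - j) (by omega)
    rw [show j + (l - j) = l by omega] at this
    omega
  · have := E.down (l - (j + d)) (by omega)
    rw [show j + d + (l - (j + d)) = l by omega] at this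
    omega

theorem Excursion.height_end {j d : ℕ} (E : Excursion α f σ q j d) :
    heightAt α (q (j + 2 * d)) = 0 := by
  have := E.down d le_rfl
  rw [show j + d + d = j + 2 * d by ring] at this
  omega

/-- A cycle with at most three excursions. -/
theorem LinkWalk.exists_excursions (W : LinkWalk α N f σ q w) (hα : StrictWeight α)
    (hD : (critSlopes α).Nonempty) {ℓ : ℝ}
      (hlen : ∀ j d, Excursion α f σ q j d → ℓ ≤ partLength w j (2 * d))
    (hL : partLength w 0 (2 * N) < 4 * ℓ) :
    ∃ j d, Excursion α f σ q j d ∧ (d = N ∨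
      ∃ e, Excursion α f σ q (j + 2 * d) e ∧ (d + e = N ∨
        ∃ m, Excursion α f σ q (j + 2 * d + 2 * e) m ∧ d + e + m = N)) := by
  obtain ⟨j, hj⟩ := (W.rankedWalk hα hD).exists_eq_zero
  have hj : heightAt α (q j) = 0 := hj
  have hT : heightAt α (q (j + 2 * N)) = 0 := by rw [W.per_q, hj]
  have hL' : partLength w j (2 * N) < 4 * ℓ := by
    rw [partLength, W.sum_stepLength, ← W.sum_stepLength 0]
    exact hL
  have hN := W.two_le
  obtain ⟨d, hd⟩ := W.exists_excursion hα hD hj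
  have h1 := hd.le_of_height_eq_zero (by omega) hT
  refine ⟨j, d, hd, ?_⟩
  by_cases hdN : d = N
  · exact Or.inl hdN
  obtain ⟨e, he⟩ := W.exists_excursion hα hD hd.height_end
  have h2 := he.le_of_height_eq_zero (by omega) hT
  refine Or.inr ⟨e, he, ?_⟩
  by_cases heN : d + e = N
  · exact Or.inl heN
  obtain ⟨m, hm⟩ := W.exists_excursion hα hD he.height_end
  have h3 := hm.le_of_height_eq_zero (by omega) hT
  refine Or.inr ⟨m, hm, ?_⟩
  by_contra hmN
  obtain ⟨n, hn⟩ := W.exists_excursion hα hD hm.height_end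
  have h4 := hn.le_of_height_eq_zero (by omega) hT
  obtain ⟨r, hr⟩ : ∃ r, 2 * N = 2 * d + 2 * e + 2 * m + 2 * n + r :=
    ⟨2 * N - (2 * d + 2 * e + 2 * m + 2 * n), by omega⟩
  have e1 := hlen _ _ hd
  have e2 := hlen _ _ he
  have e3 := hlen _ _ hm
  have e4 := hlen _ _ hn
  rw [hr, partLength_add, partLength_add, partLength_add, partLength_add] at hL'
  have e5 := W.partLength_nonneg (j + (2 * d + 2 * e + 2 * m + 2 * n)) r
  simp only [← add_assoc] at hL' e5
  linarith

theorem LinkWalk.w_le_partLength (W : LinkWalk α N f σ q w) {j n i : ℕ} (h : j ≤ 2 * i + 1)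
    (h' : 2 * i + 1 < j + n) : w i ≤ partLength w j n := by
  have e : stepLength w (j + (2 * i + 1 - j)) = w i := by
    rw [show j + (2 * i + 1 - j) = 2 * i + 1 by omega, stepLength, if_pos (by omega)]
    congr 1
    omega
  rw [← e]
  exact Finset.single_le_sum (f := fun m => stepLength w (j + m))
    (fun _ _ => W.stepLength_nonneg _) (Finset.mem_range.2 (by omega))

/-! ### Vertices that are not on a line `α₂ = p α₃` -/

theorem topAt_of_not_flagged (hf : ¬IsFlagged α) : topAt α = 2 * (critSlopes α).card := by
  simp [topAt, topHgt, hf]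

theorem topAt_of_flagged (hf : IsFlagged α) : topAt α = 2 * (critSlopes α).card + 2 := by
  simp [topAt, topHgt, hf]

theorem LinkWalk.odd_of_height_eq_zero (W : LinkWalk α N f σ q w)
    (hf : ¬IsFlagged α) {j : ℕ} (h : heightAt α (q j) = 0) : ∃ i, j = 2 * i + 1 := by
  obtain ⟨i, rfl | rfl⟩ := Nat.even_or_odd' j
  · exfalso
    rcases (W.ray i).1 with ⟨a, ha, h0⟩ | ⟨h1, -⟩
    · exact ((of_hgt_eq_zero h).1 a ha).ne h0
    · exact hf h1
  · exact ⟨i, rfl⟩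

theorem LinkWalk.side_flip (W : LinkWalk α N f σ q w) (hα : StrictWeight α)
    (hD : 2 ≤ (critSlopes α).card) (hf : ¬IsFlagged α) {i : ℕ} (h0 : 0 < heightAt α (q (2 * i)))
    (h1 : heightAt α (q (2 * i)) < topAt α)
    (he : heightAt α (q (2 * i)) = heightAt α (q (2 * i + 2))) :
    2 * Real.pi / 3 ≤ w i ∧ ¬(0 < yCoord α (q (2 * i)) ↔ 0 < yCoord α (q (2 * i + 2))) := by
  have hD' : (critSlopes α).Nonempty := Finset.card_pos.1 (by omega)
  refine ⟨W.two_pi_div_three_le hα (Or.inr hD) hD' hf h0 h1 he, fun hs => W.pass i ?_⟩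
  exact sameSign_of_heightAt (W.ray _).2 (W.ray (i + 1)).2 he fun _ _ => hs

/-- Unflagged, the cell of rank 0 is a sector around (-1,0), and its two boundary rays have rank 1
below the top. Crossing it changes sides and costs at least 2π/3. -/
theorem LinkWalk.flip_bottom (W : LinkWalk α N f σ q w) (hα : StrictWeight α)
    (hD : 2 ≤ (critSlopes α).card) (hf : ¬IsFlagged α) {j : ℕ} (hj : heightAt α (q j) = 0)
    (h0 : 0 < j) :
    2 * Real.pi / 3 ≤ stepLength w j ∧
      ¬(0 < yCoord α (q (j - 1)) ↔ 0 < yCoord α (q (j + 1))) := by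
  have hD' : (critSlopes α).Nonempty := Finset.card_pos.1 (by omega)
  obtain ⟨i, rfl⟩ := W.odd_of_height_eq_zero hf hj
  have a1 := (W.adjacent hα.pos hD' (2 * i)).1
  have a2 := (W.adjacent hα.pos hD' (2 * i + 1)).1
  rw [show 2 * i + 1 + 1 = 2 * i + 2 by ring] at a2
  have ht := topAt_of_not_flagged hf
  have h := W.side_flip hα hD hf (i := i) (by omega) (by omega) (by omega)
  have e : stepLength w (2 * i + 1) = w i := by
    rw [stepLength, if_pos (by omega)]; congr 1; omega
  rw [e]
  exact h

/-- Each excursion is charged with its initial bottom edge. One that reaches the top also crosses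
the top sector, which again changes sides and costs 2π/3: a turn on the same side would have to be
at a ray, but the top is a sector. -/
theorem LinkWalk.unflagged_excursion (W : LinkWalk α N f σ q w) (hα : StrictWeight α)
    (hD : 2 ≤ (critSlopes α).card) (hf : ¬IsFlagged α) {j d : ℕ} (E : Excursion α f σ q j d) :
    (d < topAt α ∧ 2 * Real.pi / 3 ≤ partLength w j (2 * d) ∧
      (0 < yCoord α (q (j + 1)) ↔ 0 < yCoord α (q (j + 2 * d - 1)))) ∨
    (d = topAt α ∧ 4 * Real.pi / 3 ≤ partLength w j (2 * d) ∧
      ¬(0 < yCoord α (q (j + 1)) ↔ 0 < yCoord α (q (j + 2 * d - 1)))) := by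
  have hD' : (critSlopes α).Nonempty := Finset.card_pos.1 (by omega)
  have ht := topAt_of_not_flagged hf
  have hd := E.pos
  have h0 : heightAt α (q j) = 0 := E.up 0 (Nat.zero_le _)
  obtain ⟨i, rfl⟩ := W.odd_of_height_eq_zero hf h0
  have hw : 2 * Real.pi / 3 ≤ stepLength w (2 * i + 1) :=
    (W.flip_bottom hα hD hf h0 (by omega)).1
  have e : stepLength w (2 * i + 1) = w i := by
    rw [stepLength, if_pos (by omega)]; congr 1; omega
  rw [e] at hw
  rcases E.le_top.lt_or_eq with h | h
  · exact Or.inl ⟨h, hw.trans (W.w_le_partLength le_rfl (by omega)), E.side_eq h⟩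
  · right
    have h1 := E.up (d - 1) (by omega)
    have h2 := E.down 1 (by omega)
    have e1 : 2 * i + 1 + (d - 1) = 2 * (i + (critSlopes α).card) := by omega
    have e2 : 2 * i + 1 + d + 1 = 2 * (i + (critSlopes α).card) + 2 := by omega
    rw [e1] at h1
    rw [e2] at h2
    have h3 := W.side_flip hα hD hf (i := i + (critSlopes α).card) (by omega) (by omega) (by omega)
    refine ⟨h, ?_, fun hs => ?_⟩
    · have hsum : w i + w (i + (critSlopes α).card) ≤ partLength w (2 * i + 1) (2 * d) := by
        rw [show 2 * d = 1 + (2 * d - 1) by omega, partLength_add]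
        refine add_le_add (W.w_le_partLength le_rfl (by omega))
          (W.w_le_partLength (by omega) (by omega))
      linarith [h3.1]
    · obtain ⟨r, hr⟩ := (E.same (Or.inr hs)).2.1
      omega

/-- Every bottom and every excursion through the top changes sides, so the number of excursions plus
the number of those through the top is even. Length below 8π/3 leaves one excursion through the top,
or two that stay below it. -/
theorem LinkWalk.unflagged_cases (W : LinkWalk α N f σ q w) (hα : StrictWeight α)
    (hD : 2 ≤ (critSlopes α).card) (hf : ¬IsFlagged α)
    (hL : partLength w 0 (2 * N) < 8 * Real.pi / 3) :
    (∃ f' ∈ tameStab (valPt (1 : PolyAut k) α),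
      (Set.range fun i => cell (f i) (σ i)) = apartmentLink α f') ∨
    (∃ f' ∈ tameStab (valPt (1 : PolyAut k) α), ∃ g ∈ tameStab (valPt (1 : PolyAut k) α),
      (Set.range fun i => cell (f i) (σ i)) =
        (apartmentLink α f' ∪ apartmentLink α g) \ (apartmentLink α f' ∩ apartmentLink α g)) := by
  have hD' : (critSlopes α).Nonempty := Finset.card_pos.1 (by omega)
  have key := fun j d => W.unflagged_excursion hα hD hf (j := j) (d := d)
  have hlen : ∀ j d, Excursion α f σ q j d → 2 * Real.pi / 3 ≤ partLength w j (2 * d) := by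
    intro j d E
    rcases key j d E with ⟨-, h, -⟩ | ⟨-, h, -⟩
    · exact h
    · linarith [Real.pi_pos]
  have flip := fun j => W.flip_bottom hα hD hf (j := j)
  have bot : ∀ {j d}, Excursion α f σ q j d →
      BotRel α (f ((j + 2 * d - 1) / 2)) (f ((j + 2 * d) / 2)) := fun {j d} E => by
    have hd := E.pos
    have e : j + 2 * d - 1 + 1 = j + 2 * d := by omega
    have := W.botRel hα hD' (j := j + 2 * d - 1) (by rw [e]; exact E.height_end)
    rwa [e] at this
  obtain ⟨j, d, E, h⟩ := W.exists_excursions hα hD' hlen (by linarith)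
  have hL' : ∀ j, partLength w j (2 * N) < 8 * Real.pi / 3 := fun j => by
    rw [partLength, W.sum_stepLength, ← W.sum_stepLength 0]
    exact hL
  have hdp := E.pos
  have f1 := flip _ E.height_end (by omega)
  have b1 := bot E
  rw [← W.visited_eq_range j]
  rcases h with rfl | ⟨e, E', rfl | ⟨m, E'', rfl⟩⟩
  · left
    rw [W.q_add_one] at f1
    rw [W.f_add] at b1
    rcases key j d E with ⟨-, -, hs⟩ | ⟨hd, -, hs⟩
    · exact absurd hs.symm f1.2
    · refine ⟨f (j / 2), W.mem _, ?_⟩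
      have ha := arm_union_arm_top hα (W.mem (j / 2))
      rw [← hd] at ha
      rw [visited, E.cells, b1.arm_eq hα (fun h => absurd h hf), ← ha]
      by_cases hy : 0 < yCoord α (q (j + 1))
      · have hy' : ¬0 < yCoord α (q (j + 2 * d - 1)) := fun h => hs (by simp [hy, h])
        rw [eq_true hy, eq_false hy']
      · have hy' : 0 < yCoord α (q (j + 2 * d - 1)) := by
          by_contra h
          exact hs (by simp [hy, h])
        rw [eq_false hy, eq_true hy', Set.union_comm]
  · right
    have hep := E'.pos
    have f2 := flip _ E'.height_end (by omega)
    have b2 := bot E'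
    have e2 : j + 2 * d + 2 * e = j + 2 * (d + e) := by ring
    rw [e2, W.f_add] at b2
    rw [e2, W.q_add_one] at f2
    have hl := hL' j
    rw [mul_add, partLength_add] at hl
    rcases key _ _ E with ⟨hd, hl1, hs⟩ | ⟨hd, hl1, hs⟩ <;>
      rcases key _ _ E' with ⟨he, hl2, hs'⟩ | ⟨he, hl2, hs'⟩
    · have F := E.fork W hα hD' (Or.inl hd)
      have F' := E'.fork W hα hD' (Or.inl he)
      have hv : visited f σ j (j + 2 * (d + e)) =
          visited f σ j (j + 2 * d) ∪ visited f σ (j + 2 * d) (j + 2 * d + 2 * e) := by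
        rw [visited_union (by omega) (by omega), e2]
      have c1 := E.cells
      have c2 := E'.cells
      rw [e2] at c2 F' hs'
      by_cases hy : 0 < yCoord α (q (j + 1))
      · have hy1 : 0 < yCoord α (q (j + 2 * d - 1)) := hs.1 hy
        have hy2 : ¬0 < yCoord α (q (j + 2 * d + 1)) := fun h => f1.2 (by simp [hy1, h])
        have hy3 : ¬0 < yCoord α (q (j + 2 * (d + e) - 1)) := fun h => hy2 (hs'.2 h)
        rw [eq_true hy] at F
        rw [eq_false hy2] at F'
        refine ⟨_, W.mem ((j + 2 * (d + e) - 1) / 2), _, W.mem ((j + 2 * d) / 2), ?_⟩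
        rw [← exists_symmDiff hα hD' (W.mem _) (W.mem _) F F' b1 b2, hv]
        rw [eq_true hy, eq_true hy1] at c1
        rw [eq_false hy2, eq_false hy3] at c2
        exact congrArg₂ _ c1 (by rw [visited, e2]; exact c2)
      · have hy1 : ¬0 < yCoord α (q (j + 2 * d - 1)) := fun h => hy (hs.2 h)
        have hy2 : 0 < yCoord α (q (j + 2 * d + 1)) := by
          by_contra h; exact f1.2 (by simp [hy1, h])
        have hy3 : 0 < yCoord α (q (j + 2 * (d + e) - 1)) := hs'.1 hy2
        rw [eq_false hy] at F
        rw [eq_true hy2] at F'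
        refine ⟨_, W.mem ((j + 2 * d - 1) / 2), _, W.mem (j / 2), ?_⟩
        rw [← exists_symmDiff hα hD' (W.mem _) (W.mem _) F' F b2 b1, hv, Set.union_comm]
        rw [eq_false hy, eq_false hy1] at c1
        rw [eq_true hy2, eq_true hy3] at c2
        exact congrArg₂ _ (by rw [visited, e2]; exact c2) c1
    -- One of the two excursions reaches the top: three changes of side cannot close up.
    · exfalso
      rw [e2] at hs'
      tauto
    · exfalso
      rw [e2] at hs'
      tauto
    · linarith
  -- Three excursions: all below the top contradict parity, and one through the top already makes
  -- the length at least 8π/3.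
  · exfalso
    have hep := E'.pos
    have f2 := flip _ E'.height_end (by omega)
    have hmp := E''.pos
    have f3 := flip _ E''.height_end (by omega)
    have e3 : j + 2 * d + 2 * e + 2 * m = j + 2 * (d + e + m) := by ring
    rw [e3, W.q_add_one] at f3
    have hl := hL' j
    rw [mul_add, mul_add, partLength_add, partLength_add, ← add_assoc] at hl
    have h1 := key _ _ E
    have h2 := key _ _ E'
    have h3 := key _ _ E''
    rw [e3] at h3
    have l1 := hlen _ _ E
    have l2 := hlen _ _ E'
    have l3 := hlen _ _ E''
    rcases h1 with ⟨-, -, hs⟩ | ⟨-, hl1, -⟩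
    · rcases h2 with ⟨-, -, hs2⟩ | ⟨-, hl1, -⟩
      · rcases h3 with ⟨-, -, hs3⟩ | ⟨-, hl1, -⟩
        · tauto
        · linarith
      · linarith
    · linarith

end Decomposition

/-! ### Decomposition of short cycles in the flagged case -/

section FlaggedDecomposition

variable {k : Type*} [Field k] {α : Fin 3 → ℝ} {N : ℕ} {f : ℕ → PolyAut k}
  {σ : ℕ → Set (Fin 3 → ℝ)} {q : ℕ → Fin 3 → ℝ} {w : ℕ → ℝ}

/-- The angle between the directions `s` and `t` is small. -/
def IsSteep (α t : Fin 3 → ℝ) : Prop :=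
  ∃ a ∈ critSlopes α, slopeForm α a t = 0 ∧
    ((yCoord α t < 0 ∧ 5 / 6 < relSlope α a) ∨ (0 < yCoord α t ∧ relSlope α a < 1 / 6))

/-- The excursion from a direction of rank `0` along the apartment of `g`, and back along the
apartment of `h`. -/
structure Leg (α : Fin 3 → ℝ) (g h : PolyAut k) (b : Prop) (d : ℕ) (t z : Fin 3 → ℝ) : Prop where
  mem_left : g ∈ tameStab (valPt (1 : PolyAut k) α)
  mem_right : h ∈ tameStab (valPt (1 : PolyAut k) α)
  lt_top : d < topAt α
  fork : Fork α g h b d t z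

/-- The edges of a leg. -/
def legEdges (α : Fin 3 → ℝ) (g h : PolyAut k) (b : Prop) (d : ℕ) : Set (Set (ValClass k)) :=
  arm α g b d ∪ arm α h b d

/-- Two consecutive legs, on the sides `b` and `b'`, meet at a direction of rank `0`. -/
structure LegTurn (α : Fin 3 → ℝ) (h : PolyAut k) (b : Prop) (g : PolyAut k) (b' : Prop) :
    Prop where
  bot : BotRel α h g
  not_up : b → ¬b'
  low : ¬b → ¬b' → ∃ x, IsNearby α x ∧ yCoord α x < 0 ∧ h⁻¹ * g ∉ stabAt k α x

theorem LinkWalk.even_of_height_eq_zero (W : LinkWalk α N f σ q w) (hα : StrictWeight α)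
    (hf : IsFlagged α) {j : ℕ} (h : heightAt α (q j) = 0) : ∃ i, j = 2 * i := by
  obtain ⟨i, rfl | rfl⟩ := Nat.even_or_odd' j
  · exact ⟨i, rfl⟩
  · exact absurd ((of_hgt_eq_zero h).2 hf).1 ((W.sector hα.pos i).2 hf)

theorem LinkWalk.xCoord_neg (W : LinkWalk α N f σ q w) (hα : StrictWeight α)
    (hD : (critSlopes α).Nonempty) (hf : IsFlagged α) {j : ℕ} (h : heightAt α (q j) = 0) :
    xCoord α (q j) < 0 ∧ yCoord α (q j) = 0 := by
  obtain ⟨hy, hx⟩ := (of_hgt_eq_zero h).2 hf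
  exact ⟨lt_of_le_of_ne hx fun h0 => W.isOffPt hα.pos hD j ⟨h0, hy⟩, hy⟩

/-- Bottom and top are opposite rays here. The length is at least twice the angle from the bottom to
the turn, hence at least 2π if the turn is the top, and at least 2π/3 otherwise. It is below 2
arccos(9/25) only for steep turns. -/
theorem LinkWalk.flagged_length (W : LinkWalk α N f σ q w) (hα : StrictWeight α)
    (hD : (critSlopes α).Nonempty) (hf : IsFlagged α) {j d : ℕ} (E : Excursion α f σ q j d) :
    (d < topAt α → 2 * Real.pi / 3 ≤ partLength w j (2 * d) ∧
      (partLength w j (2 * d) < 2 * Real.arccos (9 / 25) → IsSteep α (q (j + d)))) ∧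
    (d = topAt α → 2 * Real.pi ≤ partLength w j (2 * d)) := by
  have h0 : heightAt α (q j) = 0 := E.up 0 (Nat.zero_le _)
  obtain ⟨i, hi⟩ := W.even_of_height_eq_zero hα hf h0
  obtain ⟨hx, hy⟩ := W.xCoord_neg hα hD hf h0
  have hd := E.pos
  have ht := E.up d le_rfl
  have hj : Even j := ⟨i, by omega⟩
  refine ⟨fun hlt => ?_, fun heq => ?_⟩
  · have hde : Even d := (Nat.even_add.1 (E.same (Or.inl hlt)).2.1).1 hj
    have hle := W.two_mul_angle_le hα hD hf E hj hde
    rw [← partLength] at hle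
    obtain ⟨r, hr⟩ := hde
    have hy' : yCoord α (q (j + d)) ≠ 0 :=
      y_ne_zero_of_hgt (W.isOffPt hα.pos hD _) (by change 0 < heightAt α _; omega)
        (by change heightAt α _ < topAt α; omega)
    obtain ⟨a, ha, hs⟩ : ∃ a ∈ critSlopes α, slopeForm α a (q (j + d)) = 0 := by
      have := (W.ray (i + r)).1
      rw [show 2 * (i + r) = j + d by omega] at this
      exact this.resolve_right fun h => hy' h.2
    refine ⟨?_, fun hlen => ⟨a, ha, hs, ?_⟩⟩
    · linarith [pi_div_three_le_angle_bottom hα.pos hx hy ha hs hy']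
    · by_contra hcon
      rw [not_or, not_and, not_and, not_lt, not_lt] at hcon
      linarith [arccos_le_angle_bottom_of_le hα.pos hx hy hs hy' hcon]
  · have hde : Even d := ⟨(critSlopes α).card + 1, by rw [heq, topAt_of_flagged hf]; ring⟩
    have hle := W.two_mul_angle_le hα hD hf E hj hde
    rw [← partLength] at hle
    obtain ⟨hy', hx'⟩ := (of_hgt_eq_topHgt (ht.trans heq)).2 hf
    have hdir : direction α (q (j + d)) =
        (xCoord α (q (j + d)) / xCoord α (q j)) • direction α (q j) :=
      direction_eq_smul hα.pos (by rw [div_mul_cancel₀ _ hx.ne]) (by rw [hy, hy', mul_zero])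
    have hang : InnerProductGeometry.angle (direction α (q j)) (direction α (q (j + d))) =
        Real.pi := by
      rw [hdir, InnerProductGeometry.angle_smul_right_of_neg _ _ (div_neg_of_pos_of_neg hx' hx),
        InnerProductGeometry.angle_neg_right,
        InnerProductGeometry.angle_self (direction_ne_zero hα.pos (W.isOffPt hα.pos hD j)), sub_zero]
    rw [hang] at hle
    exact hle

/-- Fixing the bottom excludes the monomials of weight α₁. On y < 0, fixing the turn excludes x₃^p
as well, so the fork could not branch. Consequently one excursion below the top never closes up. -/
theorem Fork.not_botRel (hα : StrictWeight α) {g h : PolyAut k} {b : Prop}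
    {d : ℕ} {t z : Fin 3 → ℝ} (F : Fork α g h b d t z) (hd : b ∨ d < topAt α)
    (hm : g⁻¹ * h ∈ tameStab (valPt (1 : PolyAut k) α)) : ¬BotRel α g h := by
  intro H
  by_cases hb : b
  · refine F.notMem (H.mem_stabAt hα F.near_z fun hf => nonneg_yCoord_of_onSide hf ?_)
    exact fun h1 h2 => by rw [F.side_z h1 h2]; simp [hb]
  · have hlt := hd.resolve_left hb
    have h0 : 0 < d := by have := F.height_z; omega
    have ht := F.height_t
    have hy : yCoord α t < 0 := by
      refine lt_of_le_of_ne (not_lt.1 fun hy => hb ((F.side_t (by omega) (by omega)).1 hy)) ?_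
      exact y_ne_zero_of_hgt F.ray_t.2 (by change 0 < heightAt α _; omega)
        (by change heightAt α _ < topAt α; omega)
    obtain ⟨r, hr, -, hr0, hmem⟩ := H
    have h1 := ((mem_stabAt_iff hα hr hm).1 hmem).1
    have h2 := ((mem_stabAt_iff hα F.near_t hm).1 F.mem).2
    refine F.notMem ((mem_stabAt_iff hα F.near_z hm).2 ⟨fun a b' hab hc => ?_, fun b' hb' hc => ?_⟩)
    · exact absurd (h1 a b' hab hc)
        (not_le.2 ((of_hgt_eq_zero hr0).1 a ((mem_critSlopes hα.pos).2 ⟨b', hab⟩)))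
    · exact absurd (h2 b' hb' hc) (not_le.2 hy)

/-- The change of chart fixes the bottom, hence all directions with y ≥ 0. Returning on the side y >
0 would repeat an edge; a turn from y < 0 to y < 0 requires a chart change that acts nontrivially
there. -/
theorem LinkWalk.legTurn (W : LinkWalk α N f σ q w) (hα : StrictWeight α)
    (hD : (critSlopes α).Nonempty) (hf : IsFlagged α) {j : ℕ} (h : heightAt α (q j) = 0)
    (hj : 0 < j) : LegTurn α (f ((j - 1) / 2)) (0 < yCoord α (q (j - 1))) (f (j / 2))
      (0 < yCoord α (q (j + 1))) := by
  obtain ⟨i, hi⟩ := W.even_of_height_eq_zero hα hf h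
  obtain ⟨i, rfl⟩ : ∃ l, i = l + 1 := ⟨i - 1, by omega⟩
  have e1 : j - 1 = 2 * i + 1 := by omega
  have e2 : j + 1 = 2 * i + 3 := by omega
  have e3 : j / 2 = i + 1 := by omega
  have e4 : (2 * i + 1) / 2 = i := by omega
  have a1 := (W.adjacent hα.pos hD (2 * i + 1)).1
  have a2 := (W.adjacent hα.pos hD (2 * i + 2)).1
  rw [show 2 * i + 1 + 1 = j by omega] at a1
  rw [show 2 * i + 2 + 1 = 2 * i + 3 by omega, show 2 * i + 2 = j by omega] at a2
  rw [e1, e2, e3, e4]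
  have hb : BotRel α (f i) (f (i + 1)) := by
    have := W.botRel hα hD (j := 2 * i + 1) (by rw [show 2 * i + 1 + 1 = j by omega]; exact h)
    rwa [show (2 * i + 1 + 1) / 2 = i + 1 by omega, e4] at this
  have hs : (0 < yCoord α (q (2 * i + 1)) ↔ 0 < yCoord α (q (2 * i + 3))) →
      (f i)⁻¹ * f (i + 1) ∉ stabAt k α (q (2 * i + 3)) := fun hs =>
    W.distinct i (sameSign_of_heightAt (W.isOffPt hα.pos hD _) (W.isOffPt hα.pos hD _)
      (by omega) fun _ _ => hs)
  refine ⟨hb, fun h1 h2 => ?_, fun h1 h2 => ?_⟩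
  · exact hs (by simp [h1, h2]) (hb.mem_stabAt hα (W.isNearby _) fun _ => h2.le)
  · refine ⟨_, W.isNearby _, lt_of_le_of_ne (not_lt.1 h2) ?_, hs (by simp [h1, h2])⟩
    exact (W.sector hα.pos (i + 1)).2 hf

theorem LinkWalk.leg (W : LinkWalk α N f σ q w) (hα : StrictWeight α)
    (hD : (critSlopes α).Nonempty) {j d : ℕ} (E : Excursion α f σ q j d)
    (h : d < topAt α) :
    Leg α (f (j / 2)) (f ((j + 2 * d - 1) / 2)) (0 < yCoord α (q (j + 1))) d (q (j + d))
      (q (j + d - 1)) ∧ visited f σ j (j + 2 * d) =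
        legEdges α (f (j / 2)) (f ((j + 2 * d - 1) / 2)) (0 < yCoord α (q (j + 1))) d := by
  refine ⟨⟨W.mem _, W.mem _, h, E.fork W hα hD (Or.inl h)⟩, ?_⟩
  rw [visited, E.cells, legEdges, propext (E.side_eq h)]

/-- The cycles that consist of two legs on the side `y < 0`. -/
def IsTwoLegs (α : Fin 3 → ℝ) (γ : Set (Set (ValClass k))) : Prop :=
  ∃ (g₁ h₁ g₂ h₂ : PolyAut k) (d₁ d₂ : ℕ) (t₁ z₁ t₂ z₂ : Fin 3 → ℝ),
    Leg α g₁ h₁ False d₁ t₁ z₁ ∧ Leg α g₂ h₂ False d₂ t₂ z₂ ∧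
    LegTurn α h₁ False g₂ False ∧ LegTurn α h₂ False g₁ False ∧
    γ = legEdges α g₁ h₁ False d₁ ∪ legEdges α g₂ h₂ False d₂

/-- The cycles that consist of three legs, the second and the third one on the side `y < 0`. -/
def IsThreeLegs (α : Fin 3 → ℝ) (b : Prop) (γ : Set (Set (ValClass k))) : Prop :=
  ∃ (g₁ h₁ g₂ h₂ g₃ h₃ : PolyAut k) (d₁ d₂ d₃ : ℕ) (t₁ z₁ t₂ z₂ t₃ z₃ : Fin 3 → ℝ),
    Leg α g₁ h₁ b d₁ t₁ z₁ ∧ Leg α g₂ h₂ False d₂ t₂ z₂ ∧ Leg α g₃ h₃ False d₃ t₃ z₃ ∧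
    IsSteep α t₁ ∧ IsSteep α t₂ ∧ IsSteep α t₃ ∧
    LegTurn α h₁ b g₂ False ∧ LegTurn α h₂ False g₃ False ∧ LegTurn α h₃ False g₁ b ∧
    γ = legEdges α g₁ h₁ b d₁ ∪ legEdges α g₂ h₂ False d₂ ∪ legEdges α g₃ h₃ False d₃

/-- At most three excursions fit. An excursion to the top uses all the available length, so it is
alone. Consecutive excursions are never both on y > 0, so at most one of two or three is, and cyclic
relabelling puts it first. -/
theorem LinkWalk.flagged_cases (W : LinkWalk α N f σ q w) (hα : StrictWeight α)
    (hD : (critSlopes α).Nonempty) (hf : IsFlagged α)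
    (hL : partLength w 0 (2 * N) < 2 * Real.pi + 2 * (Real.arccos (9 / 25) - Real.pi / 3)) :
    (∃ f' ∈ tameStab (valPt (1 : PolyAut k) α),
      (Set.range fun i => cell (f i) (σ i)) = apartmentLink α f') ∨
    (∃ f' ∈ tameStab (valPt (1 : PolyAut k) α), ∃ g ∈ tameStab (valPt (1 : PolyAut k) α),
      (Set.range fun i => cell (f i) (σ i)) =
        (apartmentLink α f' ∪ apartmentLink α g) \ (apartmentLink α f' ∩ apartmentLink α g)) ∨
    IsTwoLegs α (Set.range fun i => cell (f i) (σ i)) ∨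
    IsThreeLegs α False (Set.range fun i => cell (f i) (σ i)) ∨
    IsThreeLegs α True (Set.range fun i => cell (f i) (σ i)) := by
  have hpi : Real.arccos (9 / 25) ≤ Real.pi / 2 := Real.arccos_le_pi_div_two.2 (by norm_num)
  have hpos := Real.pi_pos
  have key := fun {j d} => W.flagged_length hα hD hf (j := j) (d := d)
  have hlen : ∀ j d, Excursion α f σ q j d → 2 * Real.pi / 3 ≤ partLength w j (2 * d) := by
    intro j d E
    rcases E.le_top.lt_or_eq with h | h
    · exact ((key E).1 h).1
    · linarith [(key E).2 h]
  have turn : ∀ {j d}, Excursion α f σ q j d → LegTurn α (f ((j + 2 * d - 1) / 2))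
      (0 < yCoord α (q (j + 2 * d - 1))) (f ((j + 2 * d) / 2))
      (0 < yCoord α (q (j + 2 * d + 1))) := fun {j d} E =>
    W.legTurn hα hD hf E.height_end (by have := E.pos; omega)
  obtain ⟨j, d, E, h⟩ := W.exists_excursions hα hD hlen (by linarith)
  have hL' : partLength w j (2 * N) < 2 * Real.pi + 2 * (Real.arccos (9 / 25) - Real.pi / 3) := by
    rw [partLength, W.sum_stepLength, ← W.sum_stepLength 0]
    exact hL
  have hdp := E.pos
  have t1 := turn E
  have l1 := hlen _ _ E
  rw [← W.visited_eq_range j]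
  rcases h with rfl | ⟨e, E', rfl | ⟨m, E'', rfl⟩⟩
  · rw [W.q_add_one, W.f_add] at t1
    have hm := mul_mem (inv_mem (W.mem (j / 2))) (W.mem ((j + 2 * d - 1) / 2))
    rcases E.le_top.lt_or_eq with hd | hd
    · exact absurd t1.bot.symm ((W.leg hα hD E hd).1.fork.not_botRel hα (Or.inr hd) hm)
    · have hv : visited f σ j (j + 2 * d) = _ := E.cells
      have ha := fun i => arm_union_arm_top hα (W.mem i)
      rw [← hd] at ha
      by_cases hy : 0 < yCoord α (q (j + 1)) <;>
        by_cases hy' : 0 < yCoord α (q (j + 2 * d - 1))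
      · exact absurd hy (t1.not_up hy')
      · left
        refine ⟨_, W.mem ((j + 2 * d - 1) / 2), ?_⟩
        rw [hv, eq_true hy, eq_false hy', t1.bot.symm.arm_eq hα (fun _ => trivial), ha]
      · left
        refine ⟨_, W.mem (j / 2), ?_⟩
        rw [hv, eq_false hy, eq_true hy', t1.bot.arm_eq hα (fun _ => trivial), Set.union_comm, ha]
      · right; left
        have F := E.fork W hα hD (Or.inr (by simp [hy, hy']))
        rw [eq_false hy] at F
        refine ⟨_, W.mem (j / 2), _, W.mem ((j + 2 * d - 1) / 2), ?_⟩
        rw [hv, eq_false hy, eq_false hy']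
        exact arm_union_arm_eq_symmDiff hα hD (W.mem _) (W.mem _) F t1.bot.symm
  · have hep := E'.pos
    have e2 : j + 2 * d + 2 * e = j + 2 * (d + e) := by ring
    have t2 := turn E'
    have l2 := hlen _ _ E'
    rw [mul_add, partLength_add] at hL'
    have hd : d < topAt α := lt_of_le_of_ne E.le_top fun h => by linarith [(key E).2 h]
    have he : e < topAt α := lt_of_le_of_ne E'.le_top fun h => by linarith [(key E').2 h]
    rw [← propext (E.side_eq hd)] at t1
    rw [← propext (E'.side_eq he), e2, W.q_add_one, W.f_add] at t2
    obtain ⟨L1, v1⟩ := W.leg hα hD E hd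
    obtain ⟨L2, v2⟩ := W.leg hα hD E' he
    rw [e2] at L2 v2
    have hv : visited f σ j (j + 2 * (d + e)) = _ ∪ _ :=
      (visited_union (l := j + 2 * d) (by omega) (by omega)).symm
    rw [v1, v2] at hv
    by_cases hy : 0 < yCoord α (q (j + 1)) <;>
      by_cases hy' : 0 < yCoord α (q (j + 2 * d + 1))
    · exact absurd hy' (t1.not_up hy)
    · right; left
      rw [eq_true hy] at L1 t1 t2 hv
      rw [eq_false hy'] at L2 t1 t2 hv
      refine ⟨_, L2.mem_right, _, L2.mem_left, ?_⟩
      rw [hv]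
      exact exists_symmDiff hα hD L2.mem_left L2.mem_right L1.fork L2.fork t1.bot t2.bot
    · right; left
      rw [eq_false hy] at L1 t1 t2 hv
      rw [eq_true hy'] at L2 t1 t2 hv
      refine ⟨_, L1.mem_right, _, L1.mem_left, ?_⟩
      rw [hv, Set.union_comm]
      exact exists_symmDiff hα hD L1.mem_left L1.mem_right L2.fork L1.fork t2.bot t1.bot
    · right; right; left
      rw [eq_false hy] at L1 t1 t2 hv
      rw [eq_false hy'] at L2 t1 t2 hv
      exact ⟨_, _, _, _, _, _, _, _, _, _, L1, L2, t1, t2, hv⟩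
  · have hep := E'.pos
    have hmp := E''.pos
    have e3 : j + 2 * d + 2 * e + 2 * m = j + 2 * (d + e + m) := by ring
    have t2 := turn E'
    have t3 := turn E''
    have l2 := hlen _ _ E'
    have l3 := hlen _ _ E''
    rw [mul_add, mul_add, partLength_add, partLength_add, ← add_assoc j] at hL'
    have hd : d < topAt α := lt_of_le_of_ne E.le_top fun h => by linarith [(key E).2 h]
    have he : e < topAt α := lt_of_le_of_ne E'.le_top fun h => by linarith [(key E').2 h]
    have hm : m < topAt α := lt_of_le_of_ne E''.le_top fun h => by linarith [(key E'').2 h]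
    -- The other two excursions have total length at least 4π/3, which leaves less than 2
    -- arccos(9/25) for each one.
    have s1 := ((key E).1 hd).2 (by linarith)
    have s2 := ((key E').1 he).2 (by linarith)
    have s3 := ((key E'').1 hm).2 (by linarith)
    rw [← propext (E.side_eq hd)] at t1
    rw [← propext (E'.side_eq he)] at t2
    rw [← propext (E''.side_eq hm), e3, W.q_add_one, W.f_add] at t3
    obtain ⟨L1, v1⟩ := W.leg hα hD E hd
    obtain ⟨L2, v2⟩ := W.leg hα hD E' he
    obtain ⟨L3, v3⟩ := W.leg hα hD E'' hm
    rw [e3] at L3 v3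
    have hv : visited f σ j (j + 2 * (d + e + m)) = _ ∪ _ :=
      (visited_union (l := j + 2 * d + 2 * e) (by omega) (by omega)).symm
    rw [← visited_union (l := j + 2 * d) (e := j + 2 * d + 2 * e) (by omega) (by omega), v1, v2,
      v3] at hv
    right; right; right
    by_cases hy : 0 < yCoord α (q (j + 1))
    · rw [eq_true hy] at L1 t1 t3 hv
      have hy2 := t1.not_up trivial
      have hy3 := fun h => t3.not_up h trivial
      rw [eq_false hy2] at L2 t1 t2 hv
      rw [eq_false hy3] at L3 t2 t3 hv
      exact Or.inr ⟨_, _, _, _, _, _, _, _, _, _, _, _, _, _, _, L1, L2, L3, s1, s2, s3, t1, t2, t3,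
        hv⟩
    rw [eq_false hy] at L1 t1 t3 hv
    by_cases hy2 : 0 < yCoord α (q (j + 2 * d + 1))
    · rw [eq_true hy2] at L2 t1 t2 hv
      have hy3 := t2.not_up trivial
      rw [eq_false hy3] at L3 t2 t3 hv
      refine Or.inr ⟨_, _, _, _, _, _, _, _, _, _, _, _, _, _, _, L2, L3, L1, s2, s3, s1, t2, t3, t1,
        ?_⟩
      rw [hv, Set.union_assoc, Set.union_comm]
    rw [eq_false hy2] at L2 t1 t2 hv
    by_cases hy3 : 0 < yCoord α (q (j + 2 * d + 2 * e + 1))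
    · rw [eq_true hy3] at L3 t2 t3 hv
      refine Or.inr ⟨_, _, _, _, _, _, _, _, _, _, _, _, _, _, _, L3, L1, L2, s3, s1, s2, t3, t1, t2,
        ?_⟩
      rw [hv, Set.union_comm, Set.union_assoc]
    · rw [eq_false hy3] at L3 t2 t3 hv
      exact Or.inl ⟨_, _, _, _, _, _, _, _, _, _, _, _, _, _, _, L1, L2, L3, s1, s2, s3, t1, t2, t3,
        hv⟩

end FlaggedDecomposition

/-! ### Model automorphisms for the weight [m, p, 1] -/

section FlagModel

variable {k : Type*} [Field k]

/-- The polynomial automorphism with given components and components of the inverse. -/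
def PolyAut.ofCoords (v w : Fin 3 → MvPolynomial (Fin 3) k) (h : ∀ i, aeval v (w i) = X i)
    (h' : ∀ i, aeval w (v i) = X i) : PolyAut k :=
  MulOpposite.op (AlgEquiv.ofAlgHom (aeval v) (aeval w)
    (MvPolynomial.algHom_ext fun i => by simpa using h i)
    (MvPolynomial.algHom_ext fun i => by simpa using h' i))

theorem PolyAut.coords_ofCoords (v w : Fin 3 → MvPolynomial (Fin 3) k)
    (h : ∀ i, aeval v (w i) = X i) (h' : ∀ i, aeval w (v i) = X i) :
    (PolyAut.ofCoords v w h h').coords = v := by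
  funext i
  exact aeval_X v i

theorem monomial_mon (a b : ℕ) (r : k) :
    (monomial (mon a b) r : MvPolynomial (Fin 3) k) = C r * (X 1 ^ a * X 2 ^ b) := by
  rw [X_pow_eq_monomial, X_pow_eq_monomial, monomial_mul, C_mul_monomial, mon]
  simp

/-- The homogenisation `x₃ ^ m * R(x₂ / x₃ ^ p)`, for `R` of degree at most `m / p`. -/
def homog (m p : ℕ) : Polynomial k →ₗ[k] MvPolynomial (Fin 3) k :=
  ∑ a ∈ Finset.range (m / p + 1), (monomial (mon a (m - p * a))) ∘ₗ Polynomial.lcoeff k a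

variable {m p : ℕ}

theorem homog_apply (R : Polynomial k) :
    homog m p R = ∑ a ∈ Finset.range (m / p + 1), monomial (mon a (m - p * a)) (R.coeff a) := by
  simp [homog]

theorem homog_eq_sum (R : Polynomial k) : homog m p R =
    ∑ a ∈ Finset.range (m / p + 1), C (R.coeff a) * (X 1 ^ a * X 2 ^ (m - p * a)) := by
  simp only [homog_apply, monomial_mon]

theorem coeff_homog (R : Polynomial k) {a b : ℕ} (h : a * p + b = m) (hp : 0 < p) :
    coeff (mon a b) (homog m p R) = R.coeff a := by
  classical
  have ha : a ≤ m / p := (Nat.le_div_iff_mul_le hp).2 (by omega)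
  rw [homog_apply, coeff_sum, Finset.sum_eq_single a]
  · rw [coeff_monomial, if_pos]
    rw [show m - p * a = b by rw [mul_comm]; omega]
  · intro a' _ hne
    rw [coeff_monomial, if_neg]
    intro he
    have := DFunLike.congr_fun he 1
    simp [mon] at this
    exact hne this
  · intro hn
    exact absurd (Finset.mem_range.2 (by omega)) hn

theorem pull_homog (f : PolyAut k) (R : Polynomial k) : f.pull (homog m p R) =
    ∑ a ∈ Finset.range (m / p + 1),
      C (R.coeff a) * (f.coords 1 ^ a * f.coords 2 ^ (m - p * a)) := by
  rw [f.pull_eq_aeval, homog_eq_sum, map_sum]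
  simp [algebraMap_eq]

theorem bind₁_homog (P : MvPolynomial (Fin 3) k) (R : Polynomial k) :
    bind₁ ![P, X 1, X 2] (homog m p R) = homog m p R := by
  rw [homog_eq_sum, map_sum]
  simp

/-- The automorphism `(x₁ + x₃ ^ m * R(x₂ / x₃ ^ p), x₂, x₃)`. -/
def shear (m p : ℕ) (R : Polynomial k) : PolyAut k :=
  PolyAut.ofCoords ![X 0 + homog m p R, X 1, X 2] ![X 0 - homog m p R, X 1, X 2]
    (fun i => by fin_cases i <;> simp [bind₁_homog])
    (fun i => by fin_cases i <;> simp [bind₁_homog])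

/-- The automorphism `(x₁, x₂ + c x₃ ^ p, x₃)`. -/
def slide (p : ℕ) (c : k) : PolyAut k :=
  PolyAut.ofCoords ![X 0, X 1 + C c * X 2 ^ p, X 2] ![X 0, X 1 - C c * X 2 ^ p, X 2]
    (fun i => by fin_cases i <;> simp [algebraMap_eq])
    (fun i => by fin_cases i <;> simp [algebraMap_eq])

theorem shear_coords (R : Polynomial k) :
    (shear m p R).coords = ![X 0 + homog m p R, X 1, X 2] := PolyAut.coords_ofCoords _ _ _ _

theorem slide_coords (c : k) : (slide p c).coords = ![X 0, X 1 + C c * X 2 ^ p, X 2] :=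
  PolyAut.coords_ofCoords _ _ _ _

theorem shear_mul (R S : Polynomial k) : shear m p R * shear m p S = shear m p (R + S) := by
  refine PolyAut.ext_coords (funext fun i => ?_)
  rw [PolyAut.coords_mul, shear_coords, shear_coords, PolyAut.pull_eq_aeval, shear_coords]
  fin_cases i
  · simp [bind₁_homog]
    ring
  · simp
  · simp

theorem slide_mul (c d : k) : slide p c * slide p d = slide p (c + d) := by
  refine PolyAut.ext_coords (funext fun i => ?_)
  rw [PolyAut.coords_mul, slide_coords, slide_coords, PolyAut.pull_eq_aeval, slide_coords]
  fin_cases i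
  · simp
  · simp [algebraMap_eq]
    ring
  · simp

theorem shear_zero : shear m p (0 : Polynomial k) = 1 := by
  refine PolyAut.ext_coords (funext fun i => ?_)
  rw [shear_coords]
  fin_cases i <;> simp [PolyAut.coords, PolyAut.pull]

theorem slide_zero : slide p (0 : k) = 1 := by
  refine PolyAut.ext_coords (funext fun i => ?_)
  rw [slide_coords]
  fin_cases i <;> simp [PolyAut.coords, PolyAut.pull]

theorem shear_inv (R : Polynomial k) : (shear m p R)⁻¹ = shear m p (-R) :=
  inv_eq_of_mul_eq_one_right (by rw [shear_mul, add_neg_cancel, shear_zero])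

theorem slide_inv (c : k) : (slide p c)⁻¹ = slide p (-c) :=
  inv_eq_of_mul_eq_one_right (by rw [slide_mul, add_neg_cancel, slide_zero])

/-- This is the binomial theorem, homogenised; the coefficients beyond degree n vanish. -/
theorem homog_taylor_X_pow (c : k) {n : ℕ} (hn : p * n ≤ m) (hn' : n ≤ m / p) :
    homog m p (Polynomial.taylor c (Polynomial.X ^ n)) =
      (X 1 + C c * X 2 ^ p) ^ n * X 2 ^ (m - p * n) := by
  rw [Polynomial.taylor_X_pow, homog_eq_sum, add_pow (X 1 : MvPolynomial (Fin 3) k),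
    Finset.sum_mul]
  symm
  refine (Finset.sum_subset (Finset.range_subset_range.2 (by omega)) fun a _ ha => ?_).trans
    (Finset.sum_congr rfl fun a ha => ?_)
  · rw [Nat.choose_eq_zero_of_lt (by simpa using ha)]
    simp
  · rw [Polynomial.coeff_X_add_C_pow]
    rcases le_or_gt a n with h | h
    · obtain ⟨b, rfl⟩ := Nat.exists_eq_add_of_le h
      rw [show m - p * a = p * b + (m - p * (a + b)) by
        rw [mul_add] at hn ⊢; omega, pow_add, pow_mul]
      simp only [Nat.add_sub_cancel_left, map_mul, map_pow, map_natCast, mul_pow]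
      ring
    · rw [Nat.choose_eq_zero_of_lt h]
      simp

theorem slide_pull_homog (c : k) (hp : 0 < p) {R : Polynomial k} (hR : R.natDegree ≤ m / p) :
    (slide p c).pull (homog m p R) = homog m p (Polynomial.taylor c R) := by
  have hb : ∀ a ∈ Finset.range (m / p + 1), p * a ≤ m ∧ a ≤ m / p := fun a ha => by
    have h := Nat.lt_succ_iff.1 (Finset.mem_range.1 ha)
    exact ⟨by rw [mul_comm]; exact (Nat.le_div_iff_mul_le hp).1 h, h⟩
  conv_rhs => rw [R.as_sum_range_C_mul_X_pow' (Nat.lt_succ_of_le hR)]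
  rw [pull_homog, map_sum, map_sum]
  refine Finset.sum_congr rfl fun a ha => ?_
  rw [slide_coords, ← Polynomial.smul_eq_C_mul, map_smul, map_smul,
    homog_taylor_X_pow c (hb a ha).1 (hb a ha).2, smul_eq_C_mul]
  simp

/-- Dehomogenised, a slide translates the variable x₂ / x₃^p by c, so moving it past a shear applies
a Taylor shift. Vanishing orders at the points c enter the argument here. -/
theorem shear_mul_slide (c : k) (hp : 0 < p) {R : Polynomial k} (hR : R.natDegree ≤ m / p) :
    shear m p R * slide p c = slide p c * shear m p (Polynomial.taylor c R) := by
  refine PolyAut.ext_coords (funext fun i => ?_)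
  rw [PolyAut.coords_mul, PolyAut.coords_mul, shear_coords, slide_coords]
  fin_cases i
  · simp only [Fin.zero_eta, Matrix.cons_val_zero]
    rw [PolyAut.pull_eq_aeval, map_add, ← PolyAut.pull_eq_aeval, ← PolyAut.pull_eq_aeval,
      slide_pull_homog c hp hR]
    change (slide p c).coords 0 + _ = (shear m p _).coords 0
    rw [slide_coords, shear_coords]
    simp
  · simp [PolyAut.pull_eq_aeval, slide_coords, shear_coords, algebraMap_eq]
  · simp [PolyAut.pull_eq_aeval, slide_coords, shear_coords]

theorem slide_mul_shear (c : k) (hp : 0 < p) {R : Polynomial k} (hR : R.natDegree ≤ m / p) :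
    slide p c * shear m p R = shear m p (Polynomial.taylor (-c) R) * slide p c := by
  rw [shear_mul_slide c hp (by rwa [Polynomial.natDegree_taylor]), Polynomial.taylor_taylor,
    add_neg_cancel, Polynomial.taylor_zero]

end FlagModel

/-! ### Labelling the stabiliser by a polynomial and a scalar -/

section FlagWeight

variable {k : Type*} [Field k] {α : Fin 3 → ℝ} {m p : ℕ}

/-- `[α] = [m, p, 1]`. -/
structure IsFlagWeight (α : Fin 3 → ℝ) (m p : ℕ) : Prop where
  strict : StrictWeight α
  h0 : α 0 = m * α 2
  h1 : α 1 = p * α 2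

theorem exists_isFlagWeight (hα : StrictWeight α) (hf : IsFlagged α)
    (hD : (critSlopes α).Nonempty) : ∃ m p, IsFlagWeight α m p := by
  obtain ⟨p, hp⟩ := hf
  obtain ⟨a, ha⟩ := hD
  obtain ⟨b, hb⟩ := (mem_critSlopes hα.pos).1 ha
  refine ⟨a * p + b, p, hα, ?_, hp.symm⟩
  rw [← hb, ← hp]
  push_cast
  ring

theorem IsFlagWeight.pos2 (hα : IsFlagWeight α m p) : 0 < α 2 := hα.strict.pos 2

theorem IsFlagWeight.one_lt (hα : IsFlagWeight α m p) : 1 < p := by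
  have h := hα.strict.lt12
  rw [hα.h1] at h
  have h2 := hα.pos2
  have : (1 : ℝ) < p := by nlinarith
  exact_mod_cast this

theorem IsFlagWeight.pos_p (hα : IsFlagWeight α m p) : 0 < p := zero_lt_one.trans hα.one_lt

theorem IsFlagWeight.lt (hα : IsFlagWeight α m p) : p < m := by
  have h := hα.strict.lt01
  rw [hα.h1, hα.h0] at h
  have : (p : ℝ) < m := lt_of_mul_lt_mul_right h hα.pos2.le
  exact_mod_cast this

theorem IsFlagWeight.crit_iff (hα : IsFlagWeight α m p) {a b : ℕ} :
    (a : ℝ) * α 1 + b * α 2 = α 0 ↔ a * p + b = m := by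
  rw [hα.h1, hα.h0, ← mul_assoc, ← add_mul, mul_left_inj' hα.pos2.ne']
  exact_mod_cast Iff.rfl

theorem IsFlagWeight.crit1_iff (hα : IsFlagWeight α m p) {b : ℕ} :
    (b : ℝ) * α 2 = α 1 ↔ b = p := by
  rw [hα.h1, mul_left_inj' hα.pos2.ne']
  exact_mod_cast Iff.rfl

theorem IsFlagWeight.flagged (hα : IsFlagWeight α m p) : IsFlagged α := ⟨p, hα.h1.symm⟩

theorem IsFlagWeight.mem_critSlopes_iff (hα : IsFlagWeight α m p) {a : ℕ} :
    a ∈ critSlopes α ↔ a ≤ m / p := by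
  rw [mem_critSlopes hα.strict.pos, Nat.le_div_iff_mul_le hα.pos_p]
  simp only [hα.crit_iff]
  exact ⟨fun ⟨b, hb⟩ => by omega, fun h => ⟨m - a * p, by omega⟩⟩

theorem mem_tameStab_iff (hα : α ∈ posWeights) {f : PolyAut k} :
    f ∈ tameStab (valPt (1 : PolyAut k) α) ↔ f ∈ tame k ∧ ∀ i, DegLE α (α i) (f.coords i) := by
  rw [← valPt_eq_one_iff hα]
  simp [tameStab, Subgroup.mem_inf, MulAction.mem_stabilizer_iff, smul_valPt]

theorem homog_mem_supported (R : Polynomial k) : homog m p R ∈ supported k (Set.Ioi 0) := by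
  rw [homog_eq_sum]
  refine sum_mem fun a _ => mul_mem (Subalgebra.algebraMap_mem _ _) (mul_mem ?_ ?_)
  · exact pow_mem (X_mem_supported.2 (by simp)) _
  · exact pow_mem (X_mem_supported.2 (by simp)) _

theorem shear_mem_tame (R : Polynomial k) : shear m p R ∈ tame k := by
  refine Subgroup.subset_closure (Or.inr ⟨homog m p R, fun h => ?_, shear_coords R⟩)
  exact lt_irrefl _ (Set.mem_Ioi.1 (mem_supported.1 (homog_mem_supported R) h))

/-- A slide is conjugate to an elementary automorphism in the first variable by the exchange of x₁
and x₂. -/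
theorem slide_mem_tame (c : k) : slide p c ∈ tame k := by
  let e : PolyAut k := PolyAut.ofCoords ![X 0 + C c * X 2 ^ p, X 1, X 2]
    ![X 0 - C c * X 2 ^ p, X 1, X 2]
    (fun i => by fin_cases i <;> simp [algebraMap_eq])
    (fun i => by fin_cases i <;> simp [algebraMap_eq])
  let s : PolyAut k := PolyAut.ofCoords ![X 1, X 0, X 2] ![X 1, X 0, X 2]
    (fun i => by fin_cases i <;> simp) (fun i => by fin_cases i <;> simp)
  have he : e.coords = ![X 0 + C c * X 2 ^ p, X 1, X 2] := PolyAut.coords_ofCoords _ _ _ _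
  have hs : s.coords = ![X 1, X 0, X 2] := PolyAut.coords_ofCoords _ _ _ _
  have hst : s ∈ tame k := by
    refine Subgroup.subset_closure (Or.inl fun i => ?_)
    rw [hs]
    fin_cases i <;> simp [totalDegree_X]
  have het : e ∈ tame k := by
    refine Subgroup.subset_closure (Or.inr ⟨C c * X 2 ^ p, fun h => ?_, he⟩)
    have h1 : C c * X 2 ^ p ∈ supported k (Set.Ioi (0 : Fin 3)) :=
      mul_mem (Subalgebra.algebraMap_mem _ _) (pow_mem (X_mem_supported.2 (by simp)) _)
    exact lt_irrefl _ (Set.mem_Ioi.1 (mem_supported.1 h1 h))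
  have : slide p c = s * e * s := by
    refine PolyAut.ext_coords (funext fun i => ?_)
    rw [PolyAut.coords_mul, PolyAut.coords_mul, hs, slide_coords]
    fin_cases i <;> simp [PolyAut.pull_eq_aeval, hs, he, algebraMap_eq]
  rw [this]
  exact mul_mem (mul_mem hst het) hst

theorem degLE_monomial {β : Fin 3 → ℝ} {d : ℝ} {n : Fin 3 →₀ ℕ} (h : ∑ i, β i * (n i : ℝ) ≤ d)
    (r : k) : DegLE β d (monomial n r) := by
  classical
  intro n' hn'
  rw [Finset.mem_singleton.1 (support_monomial_subset hn')]
  exact h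

theorem IsFlagWeight.shear_mem (hα : IsFlagWeight α m p) (R : Polynomial k) :
    shear m p R ∈ tameStab (valPt (1 : PolyAut k) α) := by
  refine (mem_tameStab_iff hα.strict.pos).2 ⟨shear_mem_tame R, fun i => ?_⟩
  rw [shear_coords]
  fin_cases i
  · refine (degLE_X α 0).add ?_
    rw [homog_apply]
    refine DegLE.sum fun a ha => degLE_monomial ?_ _
    rw [sum_mon]
    refine (hα.crit_iff.2 ?_).le
    have := (Nat.le_div_iff_mul_le hα.pos_p).1 (Nat.lt_succ_iff.1 (Finset.mem_range.1 ha))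
    rw [mul_comm p a]
    omega
  · exact degLE_X α 1
  · exact degLE_X α 2

theorem IsFlagWeight.slide_mem (hα : IsFlagWeight α m p) (c : k) :
    slide p c ∈ tameStab (valPt (1 : PolyAut k) α) := by
  refine (mem_tameStab_iff hα.strict.pos).2 ⟨slide_mem_tame c, fun i => ?_⟩
  rw [slide_coords]
  fin_cases i
  · exact degLE_X α 0
  · refine (degLE_X α 1).add ?_
    have := (degLE_C α c).mul ((degLE_X α 2).pow (k := k) p)
    rwa [zero_add, ← hα.h1] at this
  · exact degLE_X α 2

/-- `P` has weighted degree less than `d` for the weights `β`. -/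
def DegLT (β : Fin 3 → ℝ) (d : ℝ) (P : MvPolynomial (Fin 3) k) : Prop :=
  ∀ n ∈ P.support, ∑ i, β i * (n i : ℝ) < d

theorem DegLT.add {d : ℝ} {P Q : MvPolynomial (Fin 3) k} (hP : DegLT α d P)
    (hQ : DegLT α d Q) : DegLT α d (P + Q) := by
  classical
  intro n hn
  rcases Finset.mem_union.1 (support_add hn) with h | h
  exacts [hP n h, hQ n h]

theorem DegLT.mul {d e : ℝ} {P Q : MvPolynomial (Fin 3) k} (hP : DegLT α d P)
    (hQ : DegLE α e Q) : DegLT α (d + e) (P * Q) := by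
  classical
  intro n hn
  obtain ⟨a, ha, b, hb, rfl⟩ := Finset.mem_add.1 (support_mul P Q hn)
  have := add_lt_add_of_lt_of_le (hP a ha) (hQ b hb)
  rw [← Finset.sum_add_distrib] at this
  simpa [mul_add] using this

theorem DegLT.coeff_eq_zero {d : ℝ} {P : MvPolynomial (Fin 3) k} (hP : DegLT α d P)
    {n : Fin 3 →₀ ℕ} (hn : ∑ i, α i * (n i : ℝ) = d) : coeff n P = 0 := by
  by_contra h
  exact (hP n (mem_support_iff.2 h)).ne hn

/-- Leading parts multiply: changing each factor by terms of lower weight changes the product only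
in lower weight. -/
theorem degLT_mul_sub {d e : ℝ} {P P' Q Q' : MvPolynomial (Fin 3) k} (hP : DegLT α d (P - P'))
    (hP' : DegLE α d P') (hQ : DegLE α e Q) (hQ' : DegLT α e (Q - Q')) :
    DegLT α (d + e) (P * Q - P' * Q') := by
  rw [show P * Q - P' * Q' = (P - P') * Q + (Q - Q') * P' by ring]
  refine (hP.mul hQ).add ?_
  rw [add_comm]
  exact hQ'.mul hP'

theorem degLT_pow_sub {d : ℝ} {P P' : MvPolynomial (Fin 3) k} (hP : DegLT α d (P - P'))
    (h : DegLE α d P) (h' : DegLE α d P') (n : ℕ) : DegLT α (n * d) (P ^ n - P' ^ n) := by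
  induction n with
  | zero => intro n hn; simp at hn
  | succ n ih =>
    rw [pow_succ, pow_succ]
    push_cast
    rw [add_mul, one_mul]
    exact degLT_mul_sub ih (h'.pow n) h hP

/-- Only the monomials of weight α₁ and α₂ act on the link. Composing f on the left with a slide and
then a shear removes these, apart from the diagonal terms, and what remains fixes every nearby
direction. Inverting these two factors gives the label. -/
theorem IsFlagWeight.exists_label (hα : IsFlagWeight α m p) {f : PolyAut k}
    (hf : f ∈ tameStab (valPt (1 : PolyAut k) α)) : ∃ (R : Polynomial k) (c : k),
      R.natDegree ≤ m / p ∧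
        ∀ x, IsNearby α x → (shear m p R * slide p c)⁻¹ * f ∈ stabAt k α x := by
  have hd := degLE_of_mem_tameStab hα.strict.pos hf
  have hp := hα.pos_p
  set u := coeff (Finsupp.single 2 1) (f.coords 2) with hu
  have hu0 : u ≠ 0 := coeff_single_coords_ne_zero hα.strict hd 2
  have h2 : DegLT α (α 2) (f.coords 2 - C u * X 2) := by
    obtain ⟨Q, hQ, he⟩ := (hd 2).exists_eq_add hα.strict
    rw [he, ← hu, add_sub_cancel_left]
    intro n hn
    have hn0 : ∀ i, n i = 0 := fun i => by
      by_contra h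
      have h1 : i ∈ Q.vars := (mem_vars_iff_mem_support _).2 ⟨n, hn, by simpa using h⟩
      have h3 := mem_supported.1 hQ h1
      have h4 : (2 : Fin 3) < i := h3
      omega
    simp [hn0, hα.pos2]
  have hC : ∀ (r : k) (i : Fin 3), DegLE α (α i) (C r * X i) := fun r i => by
    have := (degLE_C α r).mul (degLE_X α i)
    rwa [zero_add] at this
  have e2 : coeff (mon 0 p) (f.coords 2 ^ p) = u ^ p := by
    have h3 := degLT_pow_sub h2 (hd 2) (hC u 2) p
    have h4 := h3.coeff_eq_zero (n := mon 0 p) (by simp [sum_mon])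
    rw [coeff_sub, sub_eq_zero] at h4
    rw [h4, mul_pow, ← map_pow, show (X 2 : MvPolynomial (Fin 3) k) ^ p = X 1 ^ 0 * X 2 ^ p by simp,
      ← monomial_mon, coeff_monomial, if_pos rfl]
  -- The slide adds c f₃^p to f₂, and the coefficient of f₃^p at x₃^p is u^p.
  set c := -(coeff (mon 0 p) (f.coords 1) / u ^ p) with hc
  set g := slide p c * f with hg
  have hgm : g ∈ tameStab (valPt (1 : PolyAut k) α) := mul_mem (hα.slide_mem c) hf
  have hgd := degLE_of_mem_tameStab hα.strict.pos hgm
  have g1 : g.coords 1 = f.coords 1 + C c * f.coords 2 ^ p := by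
    rw [hg, PolyAut.coords_mul, slide_coords, PolyAut.pull_eq_aeval]
    simp [algebraMap_eq]
  have g2 : g.coords 2 = f.coords 2 := by
    rw [hg, PolyAut.coords_mul, slide_coords, PolyAut.pull_eq_aeval]
    simp
  have g1c : coeff (mon 0 p) (g.coords 1) = 0 := by
    rw [g1, coeff_add, coeff_C_mul, e2, hc]
    field_simp
    ring
  set v := coeff (Finsupp.single 1 1) (g.coords 1) with hv
  have hv0 : v ≠ 0 := coeff_single_coords_ne_zero hα.strict hgd 1
  have h1 : DegLT α (α 1) (g.coords 1 - C v * X 1) := by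
    obtain ⟨Q, hQ, he⟩ := (hgd 1).exists_eq_add hα.strict
    have hQe : g.coords 1 - C v * X 1 = Q := by
      rw [he, ← hv, add_sub_cancel_left]
    have hQd : DegLE α (α 1) Q := by
      rw [← hQe, sub_eq_add_neg, ← neg_mul, ← map_neg]
      exact (hgd 1).add (hC _ 1)
    rw [hQe]
    intro n hn
    have hn0 : ∀ i, i ≤ 1 → n i = 0 := fun i hi => by
      by_contra h
      have h1 : i ∈ Q.vars := (mem_vars_iff_mem_support _).2 ⟨n, hn, by simpa using h⟩
      have h3 := mem_supported.1 hQ h1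
      have h4 : (1 : Fin 3) < i := h3
      omega
    have hne : n = mon 0 (n 2) := by
      rw [← hn0 1 le_rfl]
      exact eq_mon (hn0 0 (by decide))
    refine lt_of_le_of_ne (hQd n hn) fun hs => mem_support_iff.1 hn ?_
    rw [hne, sum_mon, Nat.cast_zero, zero_mul, zero_add, hα.crit1_iff] at hs
    rw [hne, hs, ← hQe, coeff_sub, g1c, coeff_C_mul, coeff_X, if_neg, mul_zero, sub_zero]
    intro h
    have := DFunLike.congr_fun h 1
    simp [mon] at this
  -- In weight m only the leading parts v x₂ and u x₃ contribute to g₂^a g₃^b, so the system for the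
  -- coefficients of R is diagonal.
  have key : ∀ a b a' b', a * p + b = m → a' * p + b' = m →
      coeff (mon a' b') (g.coords 1 ^ a * g.coords 2 ^ b) = if a = a' then v ^ a * u ^ b else 0 := by
    intro a b a' b' hab hab'
    rw [g2]
    have h3 := degLT_mul_sub (degLT_pow_sub h1 (hgd 1) (hC v 1) a) ((hC v 1).pow a)
      ((hd 2).pow b) (degLT_pow_sub h2 (hd 2) (hC u 2) b)
    rw [hα.crit_iff.2 hab, ← hα.crit_iff.2 hab'] at h3
    have h4 := h3.coeff_eq_zero (n := mon a' b') (by rw [sum_mon])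
    rw [coeff_sub, sub_eq_zero] at h4
    rw [h4, mul_pow, mul_pow, ← map_pow, ← map_pow,
      show C (v ^ a) * X 1 ^ a * (C (u ^ b) * X 2 ^ b) =
        C (v ^ a * u ^ b) * (X 1 ^ a * X 2 ^ b : MvPolynomial (Fin 3) k) by rw [map_mul]; ring,
      ← monomial_mon, coeff_monomial]
    have : mon a b = mon a' b' ↔ a = a' := by
      constructor
      · intro h
        have := DFunLike.congr_fun h 1
        simpa [mon] using this
      · rintro rfl
        rw [show b = b' by omega]
    simp only [this]
  set R : Polynomial k := ∑ a ∈ Finset.range (m / p + 1), Polynomial.monomial a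
    (-(coeff (mon a (m - p * a)) (g.coords 0) / (v ^ a * u ^ (m - p * a)))) with hR
  have hRd : R.natDegree ≤ m / p := by
    refine Polynomial.natDegree_sum_le_of_forall_le _ _ fun a ha => ?_
    exact (Polynomial.natDegree_monomial_le _).trans (Nat.lt_succ_iff.1 (Finset.mem_range.1 ha))
  have hRc : ∀ a ∈ Finset.range (m / p + 1), R.coeff a =
      -(coeff (mon a (m - p * a)) (g.coords 0) / (v ^ a * u ^ (m - p * a))) := fun a ha => by
    simp only [hR, Polynomial.finsetSum_coeff, Polynomial.coeff_monomial]
    rw [Finset.sum_ite_eq' _ a, if_pos ha]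
  -- Inverting the product of shear and slide reverses its factors; restoring the order of the model
  -- costs a Taylor shift.
  refine ⟨Polynomial.taylor c (-R), -c, by rwa [Polynomial.natDegree_taylor,
    Polynomial.natDegree_neg], fun x hx => ?_⟩
  have hM : (shear m p (Polynomial.taylor c (-R)) * slide p (-c))⁻¹ = shear m p R * slide p c := by
    have := slide_mul_shear (-c) hp (R := -R) (m := m) (by rwa [Polynomial.natDegree_neg])
    rw [neg_neg c] at this
    rw [← this, mul_inv_rev, shear_inv, slide_inv, neg_neg, neg_neg]
  rw [hM, mul_assoc, ← hg]
  rw [mem_stabAt_iff hα.strict hx (mul_mem (hα.shear_mem R) hgm)]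
  have q0 : (shear m p R * g).coords 0 = g.coords 0 + g.pull (homog m p R) := by
    rw [PolyAut.coords_mul, shear_coords, PolyAut.pull_eq_aeval, PolyAut.pull_eq_aeval]
    simp
  have q1 : (shear m p R * g).coords 1 = g.coords 1 := by
    rw [PolyAut.coords_mul, shear_coords, PolyAut.pull_eq_aeval]
    simp
  refine ⟨fun a b hab hne => absurd ?_ hne, fun b hb hne => absurd ?_ hne⟩
  · rw [hα.crit_iff] at hab
    have hb : b = m - p * a := by rw [mul_comm]; omega
    have ha : a ∈ Finset.range (m / p + 1) :=
      Finset.mem_range.2 (Nat.lt_succ_iff.2 ((Nat.le_div_iff_mul_le hp).2 (by omega)))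
    rw [q0, coeff_add, pull_homog, coeff_sum, Finset.sum_eq_single_of_mem a ha]
    · rw [coeff_C_mul, hRc a ha, ← hb, key a b a b hab hab, if_pos rfl]
      field_simp
      ring
    · intro a' ha' hne'
      have := (Nat.le_div_iff_mul_le hp).1 (Nat.lt_succ_iff.1 (Finset.mem_range.1 ha'))
      rw [coeff_C_mul, key a' _ a b (by rw [mul_comm p]; omega) hab, if_neg hne', mul_zero]
  · rw [hα.crit1_iff] at hb
    rw [q1, hb, g1c]

end FlagWeight

/-! ### Legs and turns in terms of labels -/

section Labels

variable {k : Type*} [Field k] {α : Fin 3 → ℝ} {m p : ℕ}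

/-- At every direction, the apartment of `f` agrees with that of
`(x₁ + x₃ ^ m * R(x₂ / x₃ ^ p), x₂, x₃) * (x₁, x₂ + c x₃ ^ p, x₃)`. -/
structure HasLabel (α : Fin 3 → ℝ) (m p : ℕ) (f : PolyAut k) (R : Polynomial k) (c : k) :
    Prop where
  deg : R.natDegree ≤ m / p
  stab : ∀ x, IsNearby α x → (shear m p R * slide p c)⁻¹ * f ∈ stabAt k α x

theorem natDegree_sub_le_of_le_of_le {n : ℕ} {R S : Polynomial k} (hR : R.natDegree ≤ n)
    (hS : S.natDegree ≤ n) : (R - S).natDegree ≤ n :=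
  (Polynomial.natDegree_sub_le_of_le hR hS).trans (max_self n).le

theorem slide_mul_shear_coords (d : k) (Q : Polynomial k) :
    (slide p d * shear m p Q).coords = ![X 0 + homog m p Q, X 1 + C d * X 2 ^ p, X 2] := by
  funext i
  rw [PolyAut.coords_mul, slide_coords, PolyAut.pull_eq_aeval]
  fin_cases i <;> simp [shear_coords, algebraMap_eq]

theorem IsFlagWeight.model_inv_mul (hα : IsFlagWeight α m p) {R R' : Polynomial k}
    (hR : R.natDegree ≤ m / p) (hR' : R'.natDegree ≤ m / p) (c c' : k) :
    (shear m p R * slide p c)⁻¹ * (shear m p R' * slide p c') =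
      slide p (c' - c) * shear m p (Polynomial.taylor c' (R' - R)) := by
  have hd : (R' - R).natDegree ≤ m / p := natDegree_sub_le_of_le_of_le hR' hR
  calc _ = slide p (-c) * ((shear m p (-R) * shear m p R') * slide p c') := by
        rw [mul_inv_rev, shear_inv, slide_inv]; group
    _ = slide p (-c) * (slide p c' * shear m p (Polynomial.taylor c' (R' - R))) := by
        rw [shear_mul, neg_add_eq_sub, shear_mul_slide c' hα.pos_p hd]
    _ = _ := by rw [← mul_assoc, slide_mul, neg_add_eq_sub]

theorem IsFlagWeight.slide_mul_shear_mem_iff (hα : IsFlagWeight α m p) {d : k}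
    {Q : Polynomial k} (hQ : Q.natDegree ≤ m / p) {x : Fin 3 → ℝ} (hx : IsNearby α x) :
    slide p d * shear m p Q ∈ stabAt k α x ↔
      (∀ a, Q.coeff a ≠ 0 → 0 ≤ slopeForm α a x) ∧ (d ≠ 0 → 0 ≤ yCoord α x) := by
  rw [mem_stabAt_iff hα.strict hx (mul_mem (hα.slide_mem d) (hα.shear_mem Q)),
    slide_mul_shear_coords]
  have h0 : ∀ a b : ℕ, a * p + b = m → coeff (mon a b) (X 0 + homog m p Q) = Q.coeff a := by
    intro a b hab
    rw [coeff_add, coeff_homog Q hab hα.pos_p, coeff_X, if_neg, zero_add]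
    intro h
    have := DFunLike.congr_fun h 0
    simp [mon] at this
  have h1 : coeff (mon 0 p) (X 1 + C d * X 2 ^ p : MvPolynomial (Fin 3) k) = d := by
    rw [coeff_add, coeff_X, if_neg, zero_add,
      show C d * X 2 ^ p = C d * (X 1 ^ 0 * X 2 ^ p : MvPolynomial (Fin 3) k) by simp,
      ← monomial_mon, coeff_monomial, if_pos rfl]
    intro h
    have := DFunLike.congr_fun h 1
    simp [mon] at this
  simp only [hα.crit_iff, hα.crit1_iff]
  refine and_congr ⟨fun h a ha => ?_, fun h a b hab hne => ?_⟩ ⟨fun h hd => ?_, fun h b hb hne => ?_⟩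
  · have hle := (Nat.le_div_iff_mul_le hα.pos_p).1 ((Polynomial.le_natDegree_of_ne_zero ha).trans hQ)
    have hab : a * p + (m - a * p) = m := by omega
    exact h a _ hab (by rw [Matrix.cons_val_zero, h0 a _ hab]; exact ha)
  · rw [Matrix.cons_val_zero, h0 a b hab] at hne
    exact h a hne
  · exact h p rfl (by rw [Matrix.cons_val_one, Matrix.cons_val_zero, h1]; exact hd)
  · subst hb
    rw [Matrix.cons_val_one, Matrix.cons_val_zero, h1] at hne
    exact h hne

/-- Up to elements fixing every nearby direction, f⁻¹f' is a slide by c' - c followed by a shear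
along R' - R expanded at c'. Its critical monomials are therefore the nonzero Taylor coefficients,
together with x₃^p if c' ≠ c. -/
theorem IsFlagWeight.mem_stabAt_label_iff (hα : IsFlagWeight α m p) {f f' : PolyAut k}
    {R R' : Polynomial k} {c c' : k} (hf : HasLabel α m p f R c) (hf' : HasLabel α m p f' R' c')
    {x : Fin 3 → ℝ} (hx : IsNearby α x) :
    f⁻¹ * f' ∈ stabAt k α x ↔
      (∀ a, (Polynomial.taylor c' (R' - R)).coeff a ≠ 0 → 0 ≤ slopeForm α a x) ∧
        (c' ≠ c → 0 ≤ yCoord α x) := by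
  have hd : (Polynomial.taylor c' (R' - R)).natDegree ≤ m / p := by
    rw [Polynomial.natDegree_taylor]
    exact natDegree_sub_le_of_le_of_le hf'.deg hf.deg
  rw [← sub_ne_zero (a := c'), ← hα.slide_mul_shear_mem_iff hd hx,
    ← hα.model_inv_mul hf.deg hf'.deg]
  have h1 := hf.stab x hx
  have h2 := hf'.stab x hx
  constructor
  · intro h
    have := mul_mem (mul_mem h1 h) (inv_mem h2)
    convert this using 1
    group
  · intro h
    have := mul_mem (mul_mem (inv_mem h1) h) h2
    convert this using 1
    group

/-- In rank one less than that of a direction of slope `a`, on the same side. -/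
theorem nonneg_slopeForm_iff (hf : IsFlagged α) {t z : Fin 3 → ℝ} {a : ℕ}
    (ha : a ∈ critSlopes α) (ht : slopeForm α a t = 0) (hyt : yCoord α t ≠ 0)
    (hyz : yCoord α z ≠ 0) (hs : 0 < yCoord α z ↔ 0 < yCoord α t)
    (hh : heightAt α z + 1 = heightAt α t) {a' : ℕ} (ha' : a' ∈ critSlopes α) :
    0 ≤ slopeForm α a' z ↔ 0 < slopeForm α a' t := by
  classical
  obtain ⟨e1, -⟩ := hgt_of_ray (fl := IsFlagged α) hyt ha ht
  have hsec : ∀ b ∈ critSlopes α, xCoord α z - b * yCoord α z ≠ 0 := by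
    intro b hb h0
    obtain ⟨e2, -⟩ := hgt_of_ray (fl := IsFlagged α) hyz hb h0
    simp only [heightAt, e1, e2, if_pos hf] at hh
    omega
  have e3 := hgt_of_sector (fl := IsFlagged α) hsec fun _ => hyz
  simp only [heightAt, e1, e3, if_pos hf] at hh
  have hsub : ∀ b : ℕ, (0 < xCoord α z - b * yCoord α z → 0 < xCoord α t - b * yCoord α t) := by
    rcases nonneg_imp_or (x := xCoord α z) (x' := xCoord α t)
      (mul_pos_of_pos_iff hyz hyt hs) with h | h
    · exact fun b => (h b).2
    · have := (hgt_le_of_imp (D := critSlopes α) (fl := IsFlagged α) h hyt hyz).1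
      simp only [e1, e3, if_pos hf] at this
      omega
  have heq := Finset.eq_of_subset_of_card_le
    (Finset.monotone_filter_right (critSlopes α) fun b _ => hsub b) (by omega)
  have hmem := congrArg (a' ∈ ·) heq
  simp only [Finset.mem_filter, ha', true_and, eq_iff_iff] at hmem
  rw [slopeForm, slopeForm, ← hmem]
  exact ⟨fun h => lt_of_le_of_ne h (hsec a' ha').symm, le_of_lt⟩

theorem heightAt_le_iff (hf : IsFlagged α) {t x : Fin 3 → ℝ} {a : ℕ} (ha : a ∈ critSlopes α)
    (ht : slopeForm α a t = 0) (hyt : yCoord α t ≠ 0) (hx : IsSectorPt α x)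
    (hs : 0 < yCoord α x ↔ 0 < yCoord α t) :
    heightAt α x ≤ heightAt α t ↔ slopeForm α a x < 0 := by
  have hyx := hx.2 hf
  constructor
  · intro hle
    refine lt_of_le_of_ne (not_lt.1 fun hpos => ?_) (hx.1 a ha)
    rcases nonneg_imp_or (x := xCoord α x) (x' := xCoord α t)
      (mul_pos_of_pos_iff hyx hyt hs) with h | h
    · exact ht.not_gt ((h a).2 hpos)
    · have := (hgt_le_of_imp (D := critSlopes α) (fl := IsFlagged α) h hyt hyx).2 hle a ha
      rw [← slopeForm, ← slopeForm, ht, sign_zero, sign_pos hpos] at this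
      exact absurd this (by decide)
  · intro hneg
    by_contra hlt
    have := nonneg_of_hgt_le (D := critSlopes α) (fl := IsFlagged α)
      (mul_pos_of_pos_iff hyt hyx hs.symm) (not_le.1 hlt).le a ha ht.ge
    exact hneg.not_ge this

theorem Leg.exists_slope {g h : PolyAut k} {b : Prop} {d : ℕ} {t z : Fin 3 → ℝ}
    (L : Leg α g h b d t z) (hf : IsFlagged α) :
    ∃ a ∈ critSlopes α, slopeForm α a t = 0 ∧ yCoord α t ≠ 0 ∧ (0 < yCoord α t ↔ b) ∧
      (0 < yCoord α z ↔ b) ∧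
      ∀ a' ∈ critSlopes α, (0 ≤ slopeForm α a' z ↔ 0 < slopeForm α a' t) := by
  classical
  have F := L.fork
  have hlt := L.lt_top
  have ht := F.height_t
  have hz := F.height_z
  have hyt : yCoord α t ≠ 0 := y_ne_zero_of_hgt F.ray_t.2
    (by change 0 < heightAt α _; omega) (by change heightAt α _ < topAt α; omega)
  obtain ⟨a, ha, hs⟩ := F.ray_t.1.resolve_right fun h => hyt h.2
  obtain ⟨e1, -⟩ := hgt_of_ray (fl := IsFlagged α) hyt ha hs
  have h2 : 0 < heightAt α z := by
    rw [heightAt, e1, if_pos hf] at ht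
    omega
  have hyz : yCoord α z ≠ 0 := y_ne_zero_of_hgt F.off_z h2
    (by change heightAt α _ < topAt α; omega)
  have s1 := F.side_t (by omega) (by omega)
  have s2 := F.side_z h2 (by omega)
  exact ⟨a, ha, hs, hyt, s1, s2, fun a' ha' =>
    nonneg_slopeForm_iff hf ha hs hyt hyz (s2.trans s1.symm) (by omega) ha'⟩

theorem slopeForm_sub {t : Fin 3 → ℝ} {a : ℕ} (h : slopeForm α a t = 0) (a' : ℕ) :
    slopeForm α a' t = ((a : ℝ) - a') * yCoord α t := by
  rw [slopeForm] at h ⊢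
  linarith

/-- At a turn t of slope a the form of slope a' equals (a - a') y. For y < 0, fixing t forces c' = c
and kills the Taylor coefficients below a. Branching just below t forces the coefficient at a to be
nonzero, so the order of vanishing at c is exactly a. -/
theorem IsFlagWeight.leg_false (hα : IsFlagWeight α m p) {g h : PolyAut k} {d : ℕ}
    {t z : Fin 3 → ℝ} (L : Leg α g h False d t z) {R R' : Polynomial k} {c c' : k}
    (hg : HasLabel α m p g R c) (hh : HasLabel α m p h R' c') :
    c' = c ∧ ∃ a ∈ critSlopes α, slopeForm α a t = 0 ∧ yCoord α t < 0 ∧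
      Polynomial.X ^ a ∣ Polynomial.taylor c (R' - R) ∧
      (Polynomial.taylor c (R' - R)).coeff a ≠ 0 := by
  obtain ⟨a, ha, hs, hyt, st, sz, hz⟩ := L.exists_slope hα.flagged
  have hy : yCoord α t < 0 := lt_of_le_of_ne (not_lt.1 fun h => st.1 h) hyt
  obtain ⟨h1, h2⟩ := (hα.mem_stabAt_label_iff hg hh L.fork.near_t).1 L.fork.mem
  have hc : c' = c := by
    by_contra hne
    exact hy.not_ge (h2 hne)
  subst hc
  have hn := (hα.mem_stabAt_label_iff hg hh L.fork.near_z).not.1 L.fork.notMem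
  have hlow : ∀ a' < a, (Polynomial.taylor c' (R' - R)).coeff a' = 0 := by
    intro a' ha'
    by_contra hne
    have := h1 a' hne
    rw [slopeForm_sub hs] at this
    have : (0 : ℝ) < a - a' := sub_pos.2 (by exact_mod_cast ha')
    nlinarith
  refine ⟨rfl, a, ha, hs, hy, Polynomial.X_pow_dvd_iff.2 hlow, fun h0 => hn ⟨fun a' hne => ?_,
    fun h => absurd rfl h⟩⟩
  have hD : a' ∈ critSlopes α := by
    refine hα.mem_critSlopes_iff.2 ((Polynomial.le_natDegree_of_ne_zero hne).trans ?_)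
    rw [Polynomial.natDegree_taylor]
    exact natDegree_sub_le_of_le_of_le hh.deg hg.deg
  rw [hz a' hD, slopeForm_sub hs]
  have hlt : a < a' := by
    rcases lt_trichotomy a a' with h | h | h
    · exact h
    · exact absurd (h ▸ h0) hne
    · exact absurd (hlow a' h) hne
  have : (a : ℝ) - a' < 0 := sub_neg.2 (by exact_mod_cast hlt)
  nlinarith

/-- For y > 0 the inequalities reverse, and the coefficients above a vanish. The result is a degree,
which is independent of the centre of expansion, so c plays no role on this side. -/
theorem IsFlagWeight.leg_true (hα : IsFlagWeight α m p) {g h : PolyAut k} {d : ℕ}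
    {t z : Fin 3 → ℝ} (L : Leg α g h True d t z) {R R' : Polynomial k} {c c' : k}
    (hg : HasLabel α m p g R c) (hh : HasLabel α m p h R' c') :
    ∃ a ∈ critSlopes α, slopeForm α a t = 0 ∧ 0 < yCoord α t ∧ R' - R ≠ 0 ∧
      (R' - R).natDegree = a := by
  obtain ⟨a, ha, hs, hyt, st, sz, hz⟩ := L.exists_slope hα.flagged
  have hy : 0 < yCoord α t := st.2 trivial
  have h1 := ((hα.mem_stabAt_label_iff hg hh L.fork.near_t).1 L.fork.mem).1
  have hn := (hα.mem_stabAt_label_iff hg hh L.fork.near_z).not.1 L.fork.notMem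
  have hup : ∀ a', a < a' → (Polynomial.taylor c' (R' - R)).coeff a' = 0 := by
    intro a' ha'
    by_contra hne
    have := h1 a' hne
    rw [slopeForm_sub hs] at this
    have : (a : ℝ) - a' < 0 := sub_neg.2 (by exact_mod_cast ha')
    nlinarith
  have hle : (Polynomial.taylor c' (R' - R)).natDegree ≤ a :=
    Polynomial.natDegree_le_iff_coeff_eq_zero.2 hup
  have hne : (Polynomial.taylor c' (R' - R)).coeff a ≠ 0 := by
    intro h0
    refine hn ⟨fun a' hne => ?_, fun _ => (sz.2 trivial).le⟩
    have hle' : a' ≤ a := not_lt.1 fun h => hne (hup a' h)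
    have hlt : a' < a := lt_of_le_of_ne hle' fun h => hne (h ▸ h0)
    rw [hz a' (hα.mem_critSlopes_iff.2 (hle'.trans (hα.mem_critSlopes_iff.1 ha))), slopeForm_sub hs]
    have : (0 : ℝ) < a - a' := sub_pos.2 (by exact_mod_cast hlt)
    positivity
  refine ⟨a, ha, hs, hy, fun h0 => hne (by rw [h0, map_zero, Polynomial.coeff_zero]), ?_⟩
  rw [← Polynomial.natDegree_taylor (R' - R) c']
  exact le_antisymm hle (Polynomial.le_natDegree_of_ne_zero hne)

/-- Every slope form is negative at the bottom, so no Taylor coefficient of R' - R survives. -/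
theorem IsFlagWeight.eq_of_botRel (hα : IsFlagWeight α m p) {g h : PolyAut k}
    (H : BotRel α h g) {R R' : Polynomial k} {c c' : k}
    (hh : HasLabel α m p h R c) (hg : HasLabel α m p g R' c') : R' = R := by
  obtain ⟨r, hr, -, h0, hm⟩ := H
  have h1 := ((hα.mem_stabAt_label_iff hh hg hr).1 hm).1
  have hz : Polynomial.taylor c' (R' - R) = 0 := by
    ext a
    rw [Polynomial.coeff_zero]
    by_contra hne
    have hD : a ∈ critSlopes α := by
      refine hα.mem_critSlopes_iff.2 ((Polynomial.le_natDegree_of_ne_zero hne).trans ?_)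
      rw [Polynomial.natDegree_taylor]
      exact natDegree_sub_le_of_le_of_le hg.deg hh.deg
    exact ((of_hgt_eq_zero h0).1 a hD).not_ge (h1 a hne)
  exact sub_eq_zero.1 (Polynomial.taylor_injective c' (by rw [hz, map_zero]))

/-- The polynomials agree at the turn. Equal scalars would make the chart change trivial on the
link. -/
theorem IsFlagWeight.ne_of_legTurn (hα : IsFlagWeight α m p) {g h : PolyAut k}
    (H : LegTurn α h False g False) {R R' : Polynomial k} {c c' : k}
    (hh : HasLabel α m p h R c) (hg : HasLabel α m p g R' c') : c' ≠ c := by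
  intro hc
  obtain ⟨x, hx, -, hn⟩ := H.low id id
  refine hn ((hα.mem_stabAt_label_iff hh hg hx).2 ⟨fun a hne => ?_, fun h => absurd hc h⟩)
  rw [hα.eq_of_botRel H.bot hh hg, sub_self, map_zero, Polynomial.coeff_zero] at hne
  exact absurd rfl hne

theorem IsFlagWeight.linkPath_eq (hα : IsFlagWeight α m p) {g : PolyAut k} {R : Polynomial k}
    {c : k} (hg : HasLabel α m p g R c) (S : Set (Fin 3 → ℝ)) :
    linkPath α g S = linkPath α (shear m p R * slide p c) S := by
  have : ∀ ρ, IsOpenFace ρ → α ∈ closure ρ → cell (shear m p R * slide p c) ρ = cell g ρ := by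
    intro ρ hρ hc
    obtain ⟨x, hx⟩ := (hρ.isCellAt hc).nonempty
    exact cell_eq_cell hα.strict (hρ.isCellAt hc) hx
      (hg.stab x ((hρ.isCellAt hc).isNearby hx))
  ext e
  constructor
  · rintro ⟨ρ, h1, h2, h3, rfl⟩
    exact ⟨ρ, h1, h2, h3, (this ρ h1 h2).symm⟩
  · rintro ⟨ρ, h1, h2, h3, rfl⟩
    exact ⟨ρ, h1, h2, h3, this ρ h1 h2⟩

theorem translateCycle_linkPath (g h : PolyAut k) (S : Set (Fin 3 → ℝ)) :
    translateCycle g (linkPath α h S) = linkPath α (g * h) S := by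
  have hc : ∀ ρ : Set (Fin 3 → ℝ), (fun x => g • x) '' cell h ρ = cell (g * h) ρ := fun ρ => by
    rw [cell, cell, Set.image_image]
    rfl
  ext e
  constructor
  · rintro ⟨_, ⟨ρ, h1, h2, h3, rfl⟩, rfl⟩
    exact ⟨ρ, h1, h2, h3, hc ρ⟩
  · rintro ⟨ρ, h1, h2, h3, rfl⟩
    exact ⟨_, ⟨ρ, h1, h2, h3, rfl⟩, hc ρ⟩

theorem translateCycle_union (g : PolyAut k) (γ γ' : Set (Set (ValClass k))) :
    translateCycle g (γ ∪ γ') = translateCycle g γ ∪ translateCycle g γ' := Set.image_union _ _ _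

theorem IsFlagWeight.slopeForm_eq (hα : IsFlagWeight α m p) (a : ℕ) (x : Fin 3 → ℝ) :
    slopeForm α a x = x 0 - (a * x 1 + ((m : ℝ) - p * a) * x 2) ∧
      yCoord α x = x 1 - p * x 2 := by
  have h2 := hα.pos2.ne'
  rw [slopeForm, xCoord, yCoord, hα.h0, hα.h1, mul_div_cancel_right₀ _ h2,
    mul_div_cancel_right₀ _ h2]
  exact ⟨by ring, rfl⟩

theorem IsFlagWeight.mem_lowerSector (hα : IsFlagWeight α m p) {a : ℕ} {x : Fin 3 → ℝ} :
    x ∈ lowerSector m p a ↔ yCoord α x < 0 ∧ slopeForm α a x < 0 := by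
  rw [(hα.slopeForm_eq a x).1, (hα.slopeForm_eq a x).2, sub_neg, sub_neg]
  rfl

theorem IsFlagWeight.mem_upperSector (hα : IsFlagWeight α m p) {a : ℕ} {x : Fin 3 → ℝ} :
    x ∈ upperSector m p a ↔ 0 < yCoord α x ∧ slopeForm α a x < 0 := by
  rw [(hα.slopeForm_eq a x).1, (hα.slopeForm_eq a x).2, sub_neg, sub_pos]
  rfl

/-- Sectors of the link, on the side `b`, as unions of cells. -/
theorem IsFlagWeight.arm_eq_linkPath (hα : IsFlagWeight α m p) {t : Fin 3 → ℝ} {a : ℕ}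
    (ha : a ∈ critSlopes α) (ht : slopeForm α a t = 0) (hyt : yCoord α t ≠ 0) {b : Prop}
    (hb : 0 < yCoord α t ↔ b) {d : ℕ} (hd : heightAt α t = d) {S : Set (Fin 3 → ℝ)}
    (hS : ∀ x, IsSectorPt α x → (x ∈ S ↔ (0 < yCoord α x ↔ b) ∧ slopeForm α a x < 0))
    (g : PolyAut k) : arm α g b d = linkPath α g S := by
  have hf := hα.flagged
  have key : ∀ ρ, IsOpenFace ρ → α ∈ closure ρ → ∀ x ∈ ρ,
      ((heightAt α x ≤ d ∧ (0 < heightAt α x → heightAt α x < topAt α → (0 < yCoord α x ↔ b))) ↔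
        ρ ⊆ S) := by
    intro ρ hρ hc x hx
    have hxs := hρ.isSectorPt hα.strict.pos hx
    have hp := heightAt_pos_of_sector hf hxs
    constructor
    · rintro ⟨hle, hs⟩ y hy
      have hs' := hs hp.1 hp.2
      have h1 := (heightAt_le_iff hf ha ht hyt hxs (hs'.trans hb.symm)).1 (hle.trans hd.ge)
      have h2 := (hρ.isCellAt hc).sameSign hα.strict.pos hx hy
      refine (hS y (hρ.isSectorPt hα.strict.pos hy)).2
        ⟨(sign_eq_sign_iff.1 (h2.2 hf)).1.symm.trans hs', ?_⟩
      exact not_le.1 fun h => h1.not_ge ((sign_eq_sign_iff.1 (h2.1 a ha)).2.2 h)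
    · intro hsub
      obtain ⟨h1, h2⟩ := (hS x hxs).1 (hsub hx)
      exact ⟨((heightAt_le_iff hf ha ht hyt hxs (h1.trans hb.symm)).2 h2).trans hd.le,
        fun _ _ => h1⟩
  ext e
  constructor
  · rintro ⟨ρ, hρ, hc, rfl, x, hx, h⟩
    exact ⟨ρ, hρ, hc, (key ρ hρ hc x hx).1 h, rfl⟩
  · rintro ⟨ρ, hρ, hc, hsub, rfl⟩
    obtain ⟨x, hx⟩ := (hρ.isCellAt hc).nonempty
    exact ⟨ρ, hρ, hc, rfl, x, hx, (key ρ hρ hc x hx).2 hsub⟩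

theorem IsFlagWeight.arm_false (hα : IsFlagWeight α m p) {t : Fin 3 → ℝ} {a : ℕ}
    (ha : a ∈ critSlopes α) (ht : slopeForm α a t = 0) (hyt : yCoord α t < 0) {d : ℕ}
    (hd : heightAt α t = d) (g : PolyAut k) :
    arm α g False d = linkPath α g (lowerSector m p a) :=
  hα.arm_eq_linkPath ha ht hyt.ne (by simp [hyt.le]) hd (fun x hx => by
    rw [hα.mem_lowerSector, iff_false, not_lt]
    exact and_congr_left' ⟨le_of_lt, fun h => lt_of_le_of_ne h (hx.2 hα.flagged)⟩) g

theorem IsFlagWeight.arm_true (hα : IsFlagWeight α m p) {t : Fin 3 → ℝ} {a : ℕ}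
    (ha : a ∈ critSlopes α) (ht : slopeForm α a t = 0) (hyt : 0 < yCoord α t) {d : ℕ}
    (hd : heightAt α t = d) (g : PolyAut k) :
    arm α g True d = linkPath α g (upperSector m p a) :=
  hα.arm_eq_linkPath ha ht hyt.ne' (by simp [hyt]) hd (fun x hx => by
    rw [hα.mem_upperSector, iff_true]) g

/-- An open cell at [α] has constant signs, so it cannot be spread over both sectors. -/
theorem IsFlagWeight.linkPath_union (hα : IsFlagWeight α m p) {a a' : ℕ}
    (ha : a ∈ critSlopes α) (ha' : a' ∈ critSlopes α) (g : PolyAut k) :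
    linkPath α g (upperSector m p a ∪ lowerSector m p a') =
      linkPath α g (upperSector m p a) ∪ linkPath α g (lowerSector m p a') := by
  ext e
  constructor
  · rintro ⟨ρ, hρ, hc, hsub, rfl⟩
    obtain ⟨x, hx⟩ := (hρ.isCellAt hc).nonempty
    have hs := fun y hy => (hρ.isCellAt hc).sameSign hα.strict.pos hx (γ := y) hy
    have hneg : ∀ {u v : ℝ}, SignType.sign u = SignType.sign v → u < 0 → v < 0 := fun h h0 =>
      not_le.1 fun hv => h0.not_ge ((sign_eq_sign_iff.1 h).2.2 hv)
    rcases hsub hx with h | h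
    · rw [hα.mem_upperSector] at h
      refine Or.inl ⟨ρ, hρ, hc, fun y hy => hα.mem_upperSector.2 ⟨?_, ?_⟩, rfl⟩
      · exact (sign_eq_sign_iff.1 ((hs y hy).2 hα.flagged)).1.1 h.1
      · exact hneg ((hs y hy).1 a ha) h.2
    · rw [hα.mem_lowerSector] at h
      refine Or.inr ⟨ρ, hρ, hc, fun y hy => hα.mem_lowerSector.2 ⟨?_, ?_⟩, rfl⟩
      · exact hneg ((hs y hy).2 hα.flagged) h.1
      · exact hneg ((hs y hy).1 a' ha') h.2
  · rintro (⟨ρ, hρ, hc, hsub, rfl⟩ | ⟨ρ, hρ, hc, hsub, rfl⟩)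
    · exact ⟨ρ, hρ, hc, hsub.trans Set.subset_union_left, rfl⟩
    · exact ⟨ρ, hρ, hc, hsub.trans Set.subset_union_right, rfl⟩

end Labels

/-! ### Wronskian bounds for orders of vanishing -/

section Wronskian

/-- Linearly dependent polynomials have vanishing Wronskian, and conversely. -/
theorem exists_eq_C_mul_of_wronskian_eq_zero {k : Type*} [Field k] [CharZero k]
    {F G : Polynomial k} (hF : F ≠ 0) (hG : G ≠ 0) (hW : Polynomial.wronskian F G = 0) :
    ∃ r : k, r ≠ 0 ∧ G = Polynomial.C r * F := by
  classical
  have hcop : IsCoprime (F / gcd F G) (G / gcd F G) := isCoprime_div_gcd_div_gcd hG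
  set D := gcd F G with hD
  have hD0 : D ≠ 0 := gcd_ne_zero_of_right hG
  have e1 : F = D * (F / D) := (EuclideanDomain.mul_div_cancel' hD0 (gcd_dvd_left F G)).symm
  have e2 : G = D * (G / D) := (EuclideanDomain.mul_div_cancel' hD0 (gcd_dvd_right F G)).symm
  set a := F / D
  set b := G / D
  have hw : Polynomial.wronskian F G = D * D * Polynomial.wronskian a b := by
    rw [e1, e2]
    simp only [Polynomial.wronskian, Polynomial.derivative_mul]
    ring
  rw [hw] at hW
  obtain ⟨ha, hb⟩ := hcop.wronskian_eq_zero_iff.1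
    ((mul_eq_zero.1 hW).resolve_left (mul_ne_zero hD0 hD0))
  have ha' := Polynomial.eq_C_of_natDegree_eq_zero (Polynomial.derivative_eq_zero.1 ha)
  have hb' := Polynomial.eq_C_of_natDegree_eq_zero (Polynomial.derivative_eq_zero.1 hb)
  have ha0 : a.coeff 0 ≠ 0 := fun h => hF (by rw [e1, ha', h]; simp)
  have hb0 : b.coeff 0 ≠ 0 := fun h => hG (by rw [e2, hb', h]; simp)
  refine ⟨b.coeff 0 / a.coeff 0, div_ne_zero hb0 ha0, ?_⟩
  rw [e2, e1, hb', ha', Polynomial.coeff_C_zero, Polynomial.coeff_C_zero, mul_left_comm,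
    ← Polynomial.C_mul, div_mul_cancel₀ _ ha0]

/-- The trivial bound gives 2n - 1. Subtracting a multiple of F from G cancels the coefficient in
degree n and changes the Wronskian only by a nonzero scalar, which gains one more. -/
theorem natDegree_wronskian_add_two_le {k : Type*} [Field k] {F G : Polynomial k} {n : ℕ}
    (hF : F.natDegree ≤ n) (hG : G.natDegree ≤ n) (hW : Polynomial.wronskian F G ≠ 0) :
    (Polynomial.wronskian F G).natDegree + 2 ≤ 2 * n := by
  have key : ∀ H : Polynomial k, H.natDegree ≤ n → H.coeff n = 0 → H ≠ 0 → H.natDegree < n := by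
    intro H h1 h2 h3
    refine lt_of_le_of_ne h1 fun h => h3 ?_
    rw [← Polynomial.leadingCoeff_eq_zero, Polynomial.leadingCoeff, h, h2]
  by_cases h0 : F.coeff n = 0
  · have hF0 : F ≠ 0 := by
      rintro rfl
      exact hW (Polynomial.wronskian_zero_left G)
    have := key F hF h0 hF0
    have := Polynomial.natDegree_wronskian_lt_add hW
    omega
  · set H := Polynomial.C (F.coeff n) * G - Polynomial.C (G.coeff n) * F with hH
    have hw : Polynomial.wronskian F H = Polynomial.C (F.coeff n) * Polynomial.wronskian F G := by
      rw [hH]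
      simp only [Polynomial.wronskian, Polynomial.derivative_sub, Polynomial.derivative_C_mul]
      ring
    have hw0 : Polynomial.wronskian F H ≠ 0 := by
      rw [hw]
      exact mul_ne_zero (Polynomial.C_ne_zero.2 h0) hW
    have hH0 : H ≠ 0 := by
      intro h
      rw [h] at hw0
      exact hw0 (Polynomial.wronskian_zero_right F)
    have h1 : H.natDegree ≤ n := natDegree_sub_le_of_le_of_le
      ((Polynomial.natDegree_C_mul_le _ _).trans hG) ((Polynomial.natDegree_C_mul_le _ _).trans hF)
    have h2 := key H h1 (by
      rw [hH, Polynomial.coeff_sub, Polynomial.coeff_C_mul, Polynomial.coeff_C_mul]; ring) hH0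
    have h3 := Polynomial.natDegree_wronskian_lt_add hw0
    rw [hw, Polynomial.natDegree_C_mul h0] at h3
    omega

theorem dvd_wronskian {k : Type*} [Field k] {F G : Polynomial k} {c : k} {a : ℕ}
    (h : (Polynomial.X - Polynomial.C c) ^ a ∣ F) :
    (Polynomial.X - Polynomial.C c) ^ (a - 1) ∣ Polynomial.wronskian F G := by
  refine dvd_sub (Dvd.dvd.mul_right ((pow_dvd_pow _ (Nat.sub_le a 1)).trans h) _) ?_
  exact Dvd.dvd.mul_right (Polynomial.pow_sub_one_dvd_derivative_of_pow_dvd h) _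

theorem isCoprime_pow_X_sub_C {k : Type*} [Field k] {c c' : k} (h : c ≠ c') (a a' : ℕ) :
    IsCoprime ((Polynomial.X - Polynomial.C c) ^ a) ((Polynomial.X - Polynomial.C c') ^ a') :=
  (Polynomial.isCoprime_X_sub_C_of_isUnit_sub (sub_ne_zero.2 h).isUnit).pow

theorem natDegree_pow_X_sub_C {k : Type*} [Field k] (c : k) (a : ℕ) :
    ((Polynomial.X - Polynomial.C c) ^ a).natDegree = a := by
  rw [Polynomial.natDegree_pow, Polynomial.natDegree_X_sub_C, mul_one]

/-- Two polynomials with vanishing Wronskian have the same roots. -/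
theorem add_le_of_wronskian_eq_zero {k : Type*} [Field k] [CharZero k] {F G : Polynomial k}
    {n a a' : ℕ} {c c' : k} (hF : F ≠ 0) (hG : G ≠ 0) (hn : F.natDegree ≤ n) (hc : c ≠ c')
    (h : (Polynomial.X - Polynomial.C c) ^ a ∣ F) (h' : (Polynomial.X - Polynomial.C c') ^ a' ∣ G)
    (hW : Polynomial.wronskian F G = 0) : a + a' ≤ n := by
  obtain ⟨r, hr, rfl⟩ := exists_eq_C_mul_of_wronskian_eq_zero hF hG hW
  have h2 : (Polynomial.X - Polynomial.C c') ^ a' ∣ F :=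
    (Polynomial.isUnit_C.2 hr.isUnit).dvd_mul_left.1 h'
  have := Polynomial.natDegree_le_of_dvd ((isCoprime_pow_X_sub_C hc a a').mul_dvd h h2) hF
  rw [Polynomial.natDegree_mul (pow_ne_zero _ (Polynomial.X_sub_C_ne_zero c))
    (pow_ne_zero _ (Polynomial.X_sub_C_ne_zero c')),
    natDegree_pow_X_sub_C, natDegree_pow_X_sub_C] at this
  omega

/-- The orders of vanishing, at distinct points, of three polynomials with sum zero. -/
theorem add_add_le_of_sum_eq_zero {k : Type*} [Field k] [CharZero k] {F₁ F₂ F₃ : Polynomial k}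
    {n a₁ a₂ a₃ : ℕ} {c₁ c₂ c₃ : k} (h₁ : F₁ ≠ 0) (h₂ : F₂ ≠ 0) (n₁ : F₁.natDegree ≤ n)
    (n₂ : F₂.natDegree ≤ n) (hc : c₁ ≠ c₂) (hc' : c₂ ≠ c₃) (hc'' : c₁ ≠ c₃)
    (d₁ : (Polynomial.X - Polynomial.C c₁) ^ a₁ ∣ F₁)
    (d₂ : (Polynomial.X - Polynomial.C c₂) ^ a₂ ∣ F₂)
    (d₃ : (Polynomial.X - Polynomial.C c₃) ^ a₃ ∣ F₃) (hs : F₁ + F₂ + F₃ = 0) :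
    a₁ + a₂ ≤ n ∨ a₁ + a₂ + a₃ ≤ 2 * n + 1 := by
  -- If the Wronskian vanishes, the polynomials are proportional, and F₁ has both zeros.
  by_cases hW : Polynomial.wronskian F₁ F₂ = 0
  · exact Or.inl (add_le_of_wronskian_eq_zero h₁ h₂ n₁ hc d₁ d₂ hW)
  right
  -- Since the sum is zero, any two of the three polynomials have the same Wronskian up to sign.
  -- Each zero of order a_i contributes a_i - 1 to it, while its degree is at most 2n - 2.
  have e1 : (Polynomial.X - Polynomial.C c₁) ^ (a₁ - 1) ∣ Polynomial.wronskian F₁ F₂ :=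
    dvd_wronskian d₁
  have e2 : (Polynomial.X - Polynomial.C c₂) ^ (a₂ - 1) ∣ Polynomial.wronskian F₁ F₂ := by
    rw [← Polynomial.wronskian_neg_eq, dvd_neg]
    exact dvd_wronskian d₂
  have e3 : (Polynomial.X - Polynomial.C c₃) ^ (a₃ - 1) ∣ Polynomial.wronskian F₁ F₂ := by
    rw [Polynomial.wronskian_eq_of_sum_zero hs, ← Polynomial.wronskian_neg_eq, dvd_neg]
    exact dvd_wronskian d₃
  have e12 := (isCoprime_pow_X_sub_C hc (a₁ - 1) (a₂ - 1)).mul_dvd e1 e2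
  have e := ((isCoprime_pow_X_sub_C hc'' (a₁ - 1) (a₃ - 1)).mul_left
    (isCoprime_pow_X_sub_C hc' (a₂ - 1) (a₃ - 1))).mul_dvd e12 e3
  have hle := Polynomial.natDegree_le_of_dvd e hW
  have hne : ∀ (c : k) (a : ℕ), (Polynomial.X - Polynomial.C c) ^ a ≠ 0 := fun c a =>
    pow_ne_zero _ (Polynomial.X_sub_C_ne_zero c)
  rw [Polynomial.natDegree_mul (mul_ne_zero (hne _ _) (hne _ _)) (hne _ _),
    Polynomial.natDegree_mul (hne _ _) (hne _ _),
    natDegree_pow_X_sub_C, natDegree_pow_X_sub_C, natDegree_pow_X_sub_C] at hle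
  have := natDegree_wronskian_add_two_le n₁ n₂ hW
  omega

/-- The orders of vanishing of two polynomials whose sum has small degree. -/
theorem add_le_of_natDegree_sum_le {k : Type*} [Field k] [CharZero k] {F₁ F₂ F₃ : Polynomial k}
    {n d a₂ a₃ : ℕ} {c₂ c₃ : k} (h₂ : F₂ ≠ 0) (h₃ : F₃ ≠ 0) (n₁ : F₁.natDegree ≤ d)
    (n₂ : F₂.natDegree ≤ n) (hc : c₂ ≠ c₃) (d₂ : (Polynomial.X - Polynomial.C c₂) ^ a₂ ∣ F₂)
    (d₃ : (Polynomial.X - Polynomial.C c₃) ^ a₃ ∣ F₃) (hs : F₁ + F₂ + F₃ = 0) :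
    a₂ + a₃ ≤ n + d + 1 := by
  by_cases hW : Polynomial.wronskian F₂ F₃ = 0
  · have := add_le_of_wronskian_eq_zero h₂ h₃ n₂ hc d₂ d₃ hW
    omega
  have e2 : (Polynomial.X - Polynomial.C c₂) ^ (a₂ - 1) ∣ Polynomial.wronskian F₂ F₃ :=
    dvd_wronskian d₂
  have e3 : (Polynomial.X - Polynomial.C c₃) ^ (a₃ - 1) ∣ Polynomial.wronskian F₂ F₃ := by
    rw [← Polynomial.wronskian_neg_eq, dvd_neg]
    exact dvd_wronskian d₃
  have hle := Polynomial.natDegree_le_of_dvd ((isCoprime_pow_X_sub_C hc _ _).mul_dvd e2 e3) hW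
  rw [Polynomial.natDegree_mul (pow_ne_zero _ (Polynomial.X_sub_C_ne_zero _))
    (pow_ne_zero _ (Polynomial.X_sub_C_ne_zero _)),
    natDegree_pow_X_sub_C, natDegree_pow_X_sub_C] at hle
  -- The Wronskian is rewritten with F₁ as a factor, so that the small degree d enters the bound.
  rw [← Polynomial.wronskian_eq_of_sum_zero hs] at hle hW
  have := Polynomial.natDegree_wronskian_lt_add hW
  omega

theorem pow_X_sub_C_dvd {k : Type*} [Field k] {F : Polynomial k} {c : k} {a : ℕ}
    (h : Polynomial.X ^ a ∣ Polynomial.taylor c F) :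
    (Polynomial.X - Polynomial.C c) ^ a ∣ F := by
  have := map_dvd (Polynomial.taylorAlgHom (-c)) h
  rw [map_pow] at this
  change Polynomial.taylor (-c) Polynomial.X ^ a ∣
    Polynomial.taylor (-c) (Polynomial.taylor c F) at this
  rw [Polynomial.taylor_X, Polynomial.taylor_taylor, neg_add_cancel, Polynomial.taylor_zero,
    map_neg, ← sub_eq_add_neg] at this
  exact this

theorem eq_C_mul_X_sub_C {k : Type*} [Field k] {F : Polynomial k} {c : k} (hF : F.natDegree ≤ 1)
    (h : Polynomial.X ^ 1 ∣ Polynomial.taylor c F) :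
    F = Polynomial.C ((Polynomial.taylor c F).coeff 1) * (Polynomial.X - Polynomial.C c) := by
  have h0 := Polynomial.X_pow_dvd_iff.1 h 0 one_pos
  have h1 := Polynomial.eq_X_add_C_of_natDegree_le_one
    ((Polynomial.natDegree_taylor F c).le.trans hF)
  rw [h0, map_zero, add_zero] at h1
  apply Polynomial.taylor_injective c
  rw [Polynomial.taylor_mul, map_sub, Polynomial.taylor_X, Polynomial.taylor_C,
    Polynomial.taylor_C, add_sub_cancel_right]
  exact h1

end Wronskian

/-! ### Identification of the exceptional cycles -/

section Matching

variable {k : Type*} [Field k] {α : Fin 3 → ℝ} {m p : ℕ}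

theorem homog_X_pow_mul (hp : 0 < p) {a : ℕ} (ha : a ≤ m / p) (S : Polynomial k) :
    homog m p (Polynomial.X ^ a * S) = X 1 ^ a * homog (m - p * a) p S := by
  have hdiv : (m - p * a) / p = m / p - a := Nat.sub_mul_div_of_le _ _ _
    (by rw [mul_comm]; exact (Nat.le_div_iff_mul_le hp).1 ha)
  rw [homog_eq_sum, homog_eq_sum, hdiv, show m / p + 1 = a + (m / p - a + 1) by omega,
    Finset.sum_range_add, Finset.sum_eq_zero, zero_add, Finset.mul_sum]
  · refine Finset.sum_congr rfl fun i _ => ?_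
    rw [Polynomial.coeff_X_pow_mul', if_pos (Nat.le_add_right a i), Nat.add_sub_cancel_left,
      mul_add p, Nat.sub_sub]
    ring
  · intro i hi
    rw [Polynomial.coeff_X_pow_mul', if_neg (not_le.2 (Finset.mem_range.1 hi)), map_zero, zero_mul]

/-- Homogenisation turns X into x₂ and a nonzero constant term into a pure power of x₃. Exact order
a at 0 thus becomes exact divisibility by x₂^a. -/
theorem exists_X_pow_mul_eq_homog (hp : 0 < p) {a : ℕ} (ha : a ≤ m / p) {R : Polynomial k}
    (hR : Polynomial.X ^ a ∣ R) (hne : R.coeff a ≠ 0) : ∃ P : MvPolynomial (Fin 3) k,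
      (∀ d ∈ P.support, d 0 = 0 ∧ p * (a + d 1) + d 2 = m) ∧ ¬ X 1 ∣ P ∧
        X 1 ^ a * P = homog m p R := by
  classical
  obtain ⟨S, rfl⟩ := hR
  have hle : p * a ≤ m := by rw [mul_comm]; exact (Nat.le_div_iff_mul_le hp).1 ha
  refine ⟨homog (m - p * a) p S, fun d hd => ?_, ?_, (homog_X_pow_mul hp ha S).symm⟩
  · rw [homog_apply] at hd
    obtain ⟨i, hi, hd⟩ := Finset.mem_biUnion.1 (support_sum hd)
    rw [Finset.mem_singleton.1 (support_monomial_subset hd)]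
    have := (Nat.le_div_iff_mul_le hp).1 (Nat.lt_succ_iff.1 (Finset.mem_range.1 hi))
    rw [mul_comm] at this
    refine ⟨by simp [mon], ?_⟩
    simp [mon]
    rw [mul_add]
    omega
  · rintro ⟨Q, hQ⟩
    have h0 := coeff_homog S (m := m - p * a) (a := 0) (b := m - p * a) (by omega) hp
    rw [hQ, coeff_X_mul', if_neg (by simp [mon])] at h0
    rw [Polynomial.coeff_X_pow_mul', if_pos le_rfl, Nat.sub_self, ← h0] at hne
    exact hne rfl

/-- The automorphism `(x₁ + x₃ ^ m * R(x₂ / x₃ ^ p), x₂, x₃) * (x₁, x₂ + c x₃ ^ p, x₃)`. -/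
def model (m p : ℕ) (R : Polynomial k) (c : k) : PolyAut k := shear m p R * slide p c

theorem model_mul_slide (R : Polynomial k) (c d : k) :
    model m p R c * slide p d = model m p R (c + d) := by
  rw [model, model, mul_assoc, slide_mul]

theorem model_mul_shear (hp : 0 < p) (R : Polynomial k) (c : k) {F : Polynomial k}
    (hF : F.natDegree ≤ m / p) :
    model m p R c * shear m p (Polynomial.taylor c F) = model m p (R + F) c := by
  rw [model, model, mul_assoc, ← shear_mul_slide c hp hF, ← mul_assoc, shear_mul]

theorem IsFlagWeight.model_mem (hα : IsFlagWeight α m p) (R : Polynomial k) (c : k) :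
    model m p R c ∈ tameStab (valPt (1 : PolyAut k) α) :=
  mul_mem (hα.shear_mem R) (hα.slide_mem c)

theorem IsFlagWeight.eq_smul (hα : IsFlagWeight α m p) : α = α 2 • ![(m : ℝ), (p : ℝ), 1] := by
  funext i
  fin_cases i
  · simp [hα.h0, mul_comm]
  · simp [hα.h1, mul_comm]
  · simp

theorem IsFlagWeight.exists_hasLabel (hα : IsFlagWeight α m p) {f : PolyAut k}
    (hf : f ∈ tameStab (valPt (1 : PolyAut k) α)) : ∃ R c, HasLabel α m p f R c := by
  obtain ⟨R, c, h1, h2⟩ := hα.exists_label hf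
  exact ⟨R, c, h1, h2⟩

/-- The path in the apartment of a model automorphism, on the side `β₂ < p β₃`. -/
def lowerPath (α : Fin 3 → ℝ) (m p : ℕ) (R : Polynomial k) (c : k) (a : ℕ) :
    Set (Set (ValClass k)) :=
  linkPath α (model m p R c) (lowerSector m p a)

/-- The path in the apartment of a model automorphism, on the side `β₂ > p β₃`. -/
def upperPath (α : Fin 3 → ℝ) (m p : ℕ) (R : Polynomial k) (c : k) (a : ℕ) :
    Set (Set (ValClass k)) :=
  linkPath α (model m p R c) (upperSector m p a)

theorem IsFlagWeight.legEdges_false (hα : IsFlagWeight α m p) {g h : PolyAut k} {d : ℕ}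
    {t z : Fin 3 → ℝ} (L : Leg α g h False d t z) {R R' : Polynomial k} {c c' : k}
    (hg : HasLabel α m p g R c) (hh : HasLabel α m p h R' c') :
    c' = c ∧ ∃ a ≤ m / p, slopeForm α a t = 0 ∧ yCoord α t < 0 ∧
      Polynomial.X ^ a ∣ Polynomial.taylor c (R' - R) ∧
      (Polynomial.taylor c (R' - R)).coeff a ≠ 0 ∧
      legEdges α g h False d = lowerPath α m p R c a ∪ lowerPath α m p R' c a := by
  obtain ⟨rfl, a, ha, h1, h2, h3, h4⟩ := hα.leg_false L hg hh
  refine ⟨rfl, a, hα.mem_critSlopes_iff.1 ha, h1, h2, h3, h4, ?_⟩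
  rw [legEdges, hα.arm_false ha h1 h2 L.fork.height_t, hα.arm_false ha h1 h2 L.fork.height_t,
    hα.linkPath_eq hg, hα.linkPath_eq hh]
  rfl

/-- Translate so that the last label (P₁, c₂) becomes the identity. The labels run (P₁, c₂), (P₁,
c₁), (P₂, c₁), (P₂, c₂), (P₁, c₂), and h₀, …, h₃ are the slides and shears between consecutive ones.
-/
theorem IsFlagWeight.exists_isCycleA (hα : IsFlagWeight α m p) {P₁ P₂ : Polynomial k}
    {c₁ c₂ : k} {a₁ a₂ : ℕ} (hd : (P₂ - P₁).natDegree ≤ m / p) (hc : c₁ ≠ c₂)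
    (ha₁ : a₁ ≤ m / p) (ha₂ : a₂ ≤ m / p)
    (h₁ : Polynomial.X ^ a₁ ∣ Polynomial.taylor c₁ (P₂ - P₁))
    (n₁ : (Polynomial.taylor c₁ (P₂ - P₁)).coeff a₁ ≠ 0)
    (h₂ : Polynomial.X ^ a₂ ∣ Polynomial.taylor c₂ (P₁ - P₂))
    (n₂ : (Polynomial.taylor c₂ (P₁ - P₂)).coeff a₂ ≠ 0) :
    ∃ g ∈ tameStab (valPt (1 : PolyAut k) α), ∃ γ₀, IsCycleA α γ₀ ∧
      lowerPath α m p P₁ c₁ a₁ ∪ lowerPath α m p P₂ c₁ a₁ ∪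
        (lowerPath α m p P₂ c₂ a₂ ∪ lowerPath α m p P₁ c₂ a₂) = translateCycle g γ₀ := by
  have hp := hα.pos_p
  have hd' : (P₁ - P₂).natDegree ≤ m / p := by rwa [← Polynomial.natDegree_neg, neg_sub]
  obtain ⟨P', s', x', e'⟩ := exists_X_pow_mul_eq_homog hp ha₁ h₁ n₁
  obtain ⟨P, s, x, e⟩ := exists_X_pow_mul_eq_homog hp ha₂ h₂ n₂
  set k₀ : PolyAut k := slide p (-(c₂ - c₁)) with k0
  set k₁ := shear m p (Polynomial.taylor c₁ (P₂ - P₁)) with k1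
  set k₂ : PolyAut k := slide p (c₂ - c₁) with k2
  set k₃ := shear m p (Polynomial.taylor c₂ (P₁ - P₂)) with k3
  have m0 : model m p P₁ c₂ * k₀ = model m p P₁ c₁ := by
    rw [k0, model_mul_slide, neg_sub, add_sub_cancel]
  have m1 : model m p P₁ c₂ * (k₀ * k₁) = model m p P₂ c₁ := by
    rw [← mul_assoc, m0, k1, model_mul_shear hp _ _ hd, add_sub_cancel]
  have m2 : model m p P₁ c₂ * (k₀ * k₁ * k₂) = model m p P₂ c₂ := by
    rw [← mul_assoc, m1, k2, model_mul_slide, add_sub_cancel]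
  have m3 : model m p P₁ c₂ * (k₀ * k₁ * k₂ * k₃) = model m p P₁ c₂ := by
    rw [← mul_assoc, m2, k3, model_mul_shear hp _ _ hd', add_sub_cancel]
  refine ⟨model m p P₁ c₂, hα.model_mem _ _, _,
    ⟨m, p, a₂, a₁, α 2, c₂ - c₁, P, P', k₀, k₁, k₂, k₃, hα.pos2, hα.eq_smul,
      sub_ne_zero.2 hc.symm, s, x, s', x', ?_, ?_, ?_, ?_, mul_eq_left.1 m3, rfl⟩, ?_⟩
  · rw [k0, slide_coords, map_neg, neg_mul, ← sub_eq_add_neg]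
  · rw [k1, shear_coords, e']
  · rw [k2, slide_coords]
  · rw [k3, shear_coords, e]
  · simp only [translateCycle_union, translateCycle_linkPath, m0, m1, m2, m3, Set.union_assoc]
    rfl

theorem homog_C_mul_X (h : m / p = 1) (b : k) :
    homog m p (Polynomial.C b * Polynomial.X) = C b * X 1 * X 2 ^ (m - p) := by
  rw [homog_eq_sum, h, Finset.sum_range_succ, Finset.sum_range_one]
  simp [mul_assoc]

theorem homog_C (b : k) : homog m p (Polynomial.C b) = C b * X 2 ^ m := by
  rw [homog_eq_sum, Finset.sum_eq_single 0]
  · simp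
  · intro a _ ha
    simp [Polynomial.coeff_C, ha]
  · simp

theorem shear_C_mul_X_coords (h : m / p = 1) (b : k) :
    (shear m p (Polynomial.C b * Polynomial.X)).coords =
      ![X 0 + C b * X 1 * X 2 ^ (m - p), X 1, X 2] := by
  rw [shear_coords, homog_C_mul_X h]

theorem model_mul_shear_C_mul_X (hp : 0 < p) (h : m / p = 1) (R : Polynomial k) (b c : k) :
    model m p R c * shear m p (Polynomial.C b * Polynomial.X) =
      model m p (R + Polynomial.C b * (Polynomial.X - Polynomial.C c)) c := by
  rw [← model_mul_shear hp]
  · rw [Polynomial.taylor_mul, map_sub, Polynomial.taylor_X, Polynomial.taylor_C,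
      Polynomial.taylor_C, add_sub_cancel_right]
  · rw [h]
    exact (Polynomial.natDegree_C_mul_le _ _).trans (Polynomial.natDegree_X_sub_C c).le

/-- The three linear polynomials sum to zero, which gives two linear equations for b₁, b₂, b₃. As c₂
≠ c₃, the solutions form a line; its parameter is the b of the normal form. -/
theorem IsFlagWeight.exists_isCycleB (hα : IsFlagWeight α m p) (h1 : m / p = 1) (hm : m < 2 * p)
    {P₁ P₂ P₃ : Polynomial k} {c₁ c₂ c₃ b₁ b₂ b₃ : k} (h12 : c₁ ≠ c₂) (h23 : c₂ ≠ c₃)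
    (h13 : c₁ ≠ c₃) (hb : b₁ ≠ 0)
    (e₁ : P₂ - P₁ = Polynomial.C b₁ * (Polynomial.X - Polynomial.C c₁))
    (e₂ : P₃ - P₂ = Polynomial.C b₂ * (Polynomial.X - Polynomial.C c₂))
    (e₃ : P₁ - P₃ = Polynomial.C b₃ * (Polynomial.X - Polynomial.C c₃)) :
    ∃ g ∈ tameStab (valPt (1 : PolyAut k) α), ∃ γ₀, IsCycleB α γ₀ ∧
      lowerPath α m p P₁ c₁ 1 ∪ lowerPath α m p P₂ c₁ 1 ∪
        (lowerPath α m p P₂ c₂ 1 ∪ lowerPath α m p P₃ c₂ 1) ∪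
        (lowerPath α m p P₃ c₃ 1 ∪ lowerPath α m p P₁ c₃ 1) = translateCycle g γ₀ := by
  have hp := hα.pos_p
  have hlt := hα.lt
  have hs : Polynomial.C b₁ * (Polynomial.X - Polynomial.C c₁) +
      Polynomial.C b₂ * (Polynomial.X - Polynomial.C c₂) +
      Polynomial.C b₃ * (Polynomial.X - Polynomial.C c₃) = 0 := by
    rw [← e₁, ← e₂, ← e₃]
    ring
  have s0 : b₁ * -c₁ + b₂ * -c₂ + b₃ * -c₃ = 0 := by
    simpa using congrArg (Polynomial.eval 0) hs
  have s1 : b₁ + b₂ + b₃ = 0 := by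
    have := congrArg (Polynomial.eval 1) hs
    simp at this
    linear_combination this - s0
  have hc : c₃ - c₂ ≠ 0 := sub_ne_zero.2 h23.symm
  -- The constants of the normal form are c = c₃ - c₂ and c' = c₃ - c₁.
  obtain ⟨b, rfl⟩ : ∃ b, b₁ = -(b * (c₃ - c₂)) := ⟨-b₁ / (c₃ - c₂), by field_simp⟩
  have t2 : b₂ = b * (c₃ - c₁) := mul_right_cancel₀ hc (by linear_combination s0 + c₃ * s1)
  have t3 : b₃ = b * (c₃ - c₂ - (c₃ - c₁)) := by rw [t2] at s1; linear_combination s1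
  set k₀ : PolyAut k := slide p (-(c₃ - c₁)) with k0
  set k₁ := shear m p (Polynomial.C (-(b * (c₃ - c₂))) * Polynomial.X) with k1
  set k₂ : PolyAut k := slide p (c₃ - c₁ - (c₃ - c₂)) with k2
  set k₃ := shear m p (Polynomial.C (b * (c₃ - c₁)) * Polynomial.X) with k3
  set k₄ : PolyAut k := slide p (c₃ - c₂) with k4
  set k₅ := shear m p (Polynomial.C (b * (c₃ - c₂ - (c₃ - c₁))) * Polynomial.X) with k5
  have m0 : model m p P₁ c₃ * k₀ = model m p P₁ c₁ := by
    rw [k0, model_mul_slide, neg_sub, add_sub_cancel]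
  have m1 : model m p P₁ c₃ * (k₀ * k₁) = model m p P₂ c₁ := by
    rw [← mul_assoc, m0, k1, model_mul_shear_C_mul_X hp h1, ← e₁, add_sub_cancel]
  have m2 : model m p P₁ c₃ * (k₀ * k₁ * k₂) = model m p P₂ c₂ := by
    rw [← mul_assoc, m1, k2, model_mul_slide, sub_sub_sub_cancel_left, add_sub_cancel]
  have m3 : model m p P₁ c₃ * (k₀ * k₁ * k₂ * k₃) = model m p P₃ c₂ := by
    rw [← mul_assoc, m2, k3, model_mul_shear_C_mul_X hp h1, ← t2, ← e₂, add_sub_cancel]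
  have m4 : model m p P₁ c₃ * (k₀ * k₁ * k₂ * k₃ * k₄) = model m p P₃ c₃ := by
    rw [← mul_assoc, m3, k4, model_mul_slide, add_sub_cancel]
  have m5 : model m p P₁ c₃ * (k₀ * k₁ * k₂ * k₃ * k₄ * k₅) = model m p P₁ c₃ := by
    rw [← mul_assoc, m4, k5, model_mul_shear_C_mul_X hp h1, ← t3, ← e₃, add_sub_cancel]
  refine ⟨model m p P₁ c₃, hα.model_mem _ _, _,
    ⟨m, p, m - p, α 2, b, c₃ - c₂, c₃ - c₁, k₀, k₁, k₂, k₃, k₄, k₅, by omega, by omega, by omega,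
      hα.pos2, hα.eq_smul, hc, sub_ne_zero.2 h13.symm, ?_, ?_, ?_, ?_, ?_, ?_, ?_, ?_, rfl⟩, ?_⟩
  · rw [sub_sub_sub_cancel_left]
    exact sub_ne_zero.2 h12.symm
  · rintro rfl
    simp at hb
  · rw [k0, slide_coords, map_neg, neg_mul, ← sub_eq_add_neg]
  · rw [k1, shear_C_mul_X_coords h1, map_neg, neg_mul, neg_mul, ← sub_eq_add_neg]
  · rw [k2, slide_coords]
  · rw [k3, shear_C_mul_X_coords h1]
  · rw [k4, slide_coords]
  · rw [k5, shear_C_mul_X_coords h1]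
  · simp only [translateCycle_union, translateCycle_linkPath, m0, m1, m2, m3, m4, m5,
      Set.union_assoc]
    rfl

/-- The side y > 0 does not see the scalar c. The passage from (P₁, c₃) to (P₂, c₂) is therefore
made in one step, a slide together with a constant shear, and this is h₀. -/
theorem IsFlagWeight.exists_isCycleC (hα : IsFlagWeight α m p) (h1 : m / p = 1) (hm : m < 2 * p)
    {P₁ P₂ P₃ : Polynomial k} {c₂ c₃ b₁ b₂ b₃ : k} (h23 : c₂ ≠ c₃) (hb : b₂ ≠ 0)
    (e₁ : P₂ - P₁ = Polynomial.C b₁)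
    (e₂ : P₃ - P₂ = Polynomial.C b₂ * (Polynomial.X - Polynomial.C c₂))
    (e₃ : P₁ - P₃ = Polynomial.C b₃ * (Polynomial.X - Polynomial.C c₃)) :
    ∃ g ∈ tameStab (valPt (1 : PolyAut k) α), ∃ γ₀, IsCycleC α γ₀ ∧
      upperPath α m p P₁ c₃ 0 ∪ upperPath α m p P₂ c₂ 0 ∪
        (lowerPath α m p P₂ c₂ 1 ∪ lowerPath α m p P₃ c₂ 1) ∪
        (lowerPath α m p P₃ c₃ 1 ∪ lowerPath α m p P₁ c₃ 1) = translateCycle g γ₀ := by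
  have hp := hα.pos_p
  have hlt := hα.lt
  have hs : Polynomial.C b₁ + Polynomial.C b₂ * (Polynomial.X - Polynomial.C c₂) +
      Polynomial.C b₃ * (Polynomial.X - Polynomial.C c₃) = 0 := by
    rw [← e₁, ← e₂, ← e₃]
    ring
  have s0 : b₁ + b₂ * -c₂ + b₃ * -c₃ = 0 := by
    simpa using congrArg (Polynomial.eval 0) hs
  have s1 : b₃ = -b₂ := by
    have := congrArg (Polynomial.eval 1) hs
    simp at this
    linear_combination this - s0
  have t1 : b₁ = -(b₂ * (c₃ - c₂)) := by rw [s1] at s0; linear_combination s0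
  set k₀ : PolyAut k :=
    slide p (-(c₃ - c₂)) * shear m p (Polynomial.C (-(b₂ * (c₃ - c₂)))) with k0
  set k₁ := shear m p (Polynomial.C b₂ * Polynomial.X) with k1
  set k₂ : PolyAut k := slide p (c₃ - c₂) with k2
  set k₃ := shear m p (Polynomial.C (-b₂) * Polynomial.X) with k3
  have m0 : model m p P₁ c₃ * k₀ = model m p P₂ c₂ := by
    rw [k0, ← mul_assoc, model_mul_slide, neg_sub, add_sub_cancel, ← t1,
      ← Polynomial.taylor_C c₂ b₁, model_mul_shear hp _ _ (by simp), ← e₁, add_sub_cancel]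
  have m1 : model m p P₁ c₃ * (k₀ * k₁) = model m p P₃ c₂ := by
    rw [← mul_assoc, m0, k1, model_mul_shear_C_mul_X hp h1, ← e₂, add_sub_cancel]
  have m2 : model m p P₁ c₃ * (k₀ * k₁ * k₂) = model m p P₃ c₃ := by
    rw [← mul_assoc, m1, k2, model_mul_slide, add_sub_cancel]
  have m3 : model m p P₁ c₃ * (k₀ * k₁ * k₂ * k₃) = model m p P₁ c₃ := by
    rw [← mul_assoc, m2, k3, model_mul_shear_C_mul_X hp h1, ← s1, ← e₃, add_sub_cancel]
  have hu := fun g : PolyAut k => hα.linkPath_union (a := 0) (a' := 1)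
    (hα.mem_critSlopes_iff.2 (Nat.zero_le _)) (hα.mem_critSlopes_iff.2 h1.ge) g
  refine ⟨model m p P₁ c₃, hα.model_mem _ _, _,
    ⟨m, p, m - p, α 2, b₂, c₃ - c₂, k₀, k₁, k₂, k₃, by omega, by omega, by omega,
      hα.pos2, hα.eq_smul, sub_ne_zero.2 h23.symm, hb, ?_, ?_, ?_, ?_, rfl⟩, ?_⟩
  · rw [k0, slide_mul_shear_coords, homog_C]
    simp only [map_neg, neg_mul, ← sub_eq_add_neg]
  · rw [k1, shear_C_mul_X_coords h1]
  · rw [k2, slide_coords]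
  · rw [k3, shear_C_mul_X_coords h1, map_neg, neg_mul, neg_mul, ← sub_eq_add_neg]
  · simp only [translateCycle_union, translateCycle_linkPath, m0, m1, m2, m3, hu]
    simp only [lowerPath, upperPath]
    ac_rfl

theorem IsSteep.lt_of_neg (hα : IsFlagWeight α m p) {t : Fin 3 → ℝ} (h : IsSteep α t) {a : ℕ}
    (ha : slopeForm α a t = 0) (hy : yCoord α t < 0) : 5 * m < 6 * (a * p) := by
  obtain ⟨a', -, h0, ⟨-, h1⟩ | ⟨h2, -⟩⟩ := h
  · rw [slopeForm_sub ha] at h0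
    have : (a : ℝ) = a' := sub_eq_zero.1 ((mul_eq_zero.1 h0).resolve_right hy.ne)
    rw [relSlope, ← this, lt_div_iff₀ (hα.strict.pos 0), hα.h0, hα.h1] at h1
    have h2 := hα.pos2
    have h3 : (5 : ℝ) * m < 6 * (a * p) := by
      refine lt_of_mul_lt_mul_right ?_ h2.le
      linarith
    exact_mod_cast h3
  · exact absurd hy h2.not_gt

theorem IsSteep.lt_of_pos (hα : IsFlagWeight α m p) {t : Fin 3 → ℝ} (h : IsSteep α t) {a : ℕ}
    (ha : slopeForm α a t = 0) (hy : 0 < yCoord α t) : 6 * (a * p) < m := by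
  obtain ⟨a', -, h0, ⟨h2, -⟩ | ⟨-, h1⟩⟩ := h
  · exact absurd hy h2.not_gt
  · rw [slopeForm_sub ha] at h0
    have : (a : ℝ) = a' := sub_eq_zero.1 ((mul_eq_zero.1 h0).resolve_right hy.ne')
    rw [relSlope, ← this, div_lt_iff₀ (hα.strict.pos 0), hα.h0, hα.h1] at h1
    have h2 := hα.pos2
    have h3 : (6 : ℝ) * (a * p) < m := by
      refine lt_of_mul_lt_mul_right ?_ h2.le
      linarith
    exact_mod_cast h3

/-- No length estimate is needed: the two turns identify the polynomials and separate the scalars,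
which is all that type (a) requires. -/
theorem IsFlagWeight.isCycleA_of_isTwoLegs (hα : IsFlagWeight α m p)
    {γ : Set (Set (ValClass k))} (h : IsTwoLegs α γ) :
    ∃ g ∈ tameStab (valPt (1 : PolyAut k) α), ∃ γ₀, IsCycleA α γ₀ ∧ γ = translateCycle g γ₀ := by
  obtain ⟨g₁, h₁, g₂, h₂, d₁, d₂, t₁, z₁, t₂, z₂, L₁, L₂, T₁, T₂, rfl⟩ := h
  obtain ⟨P₁, c₁, G₁⟩ := hα.exists_hasLabel L₁.mem_left
  obtain ⟨Q₁, _, H₁⟩ := hα.exists_hasLabel L₁.mem_right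
  obtain ⟨P₂, c₂, G₂⟩ := hα.exists_hasLabel L₂.mem_left
  obtain ⟨Q₂, _, H₂⟩ := hα.exists_hasLabel L₂.mem_right
  obtain rfl := hα.eq_of_botRel T₁.bot H₁ G₂
  obtain rfl := hα.eq_of_botRel T₂.bot H₂ G₁
  obtain ⟨rfl, a₁, ha₁, -, -, x₁, n₁, e₁⟩ := hα.legEdges_false L₁ G₁ H₁
  obtain ⟨rfl, a₂, ha₂, -, -, x₂, n₂, e₂⟩ := hα.legEdges_false L₂ G₂ H₂
  rw [e₁, e₂]
  exact hα.exists_isCycleA (natDegree_sub_le_of_le_of_le H₁.deg G₁.deg)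
    (hα.ne_of_legTurn T₁ H₁ G₂).symm ha₁ ha₂ x₁ n₁ x₂ n₂

theorem IsFlagWeight.isCycleB_of_isThreeLegs [CharZero k] (hα : IsFlagWeight α m p)
    {γ : Set (Set (ValClass k))} (h : IsThreeLegs α False γ) :
    ∃ g ∈ tameStab (valPt (1 : PolyAut k) α), ∃ γ₀, IsCycleB α γ₀ ∧ γ = translateCycle g γ₀ := by
  obtain ⟨g₁, h₁, g₂, h₂, g₃, h₃, d₁, d₂, d₃, t₁, z₁, t₂, z₂, t₃, z₃, L₁, L₂, L₃, S₁, S₂, S₃,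
    T₁, T₂, T₃, rfl⟩ := h
  obtain ⟨P₁, c₁, G₁⟩ := hα.exists_hasLabel L₁.mem_left
  obtain ⟨Q₁, _, H₁⟩ := hα.exists_hasLabel L₁.mem_right
  obtain ⟨P₂, c₂, G₂⟩ := hα.exists_hasLabel L₂.mem_left
  obtain ⟨Q₂, _, H₂⟩ := hα.exists_hasLabel L₂.mem_right
  obtain ⟨P₃, c₃, G₃⟩ := hα.exists_hasLabel L₃.mem_left
  obtain ⟨Q₃, _, H₃⟩ := hα.exists_hasLabel L₃.mem_right
  obtain rfl := hα.eq_of_botRel T₁.bot H₁ G₂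
  obtain rfl := hα.eq_of_botRel T₂.bot H₂ G₃
  obtain rfl := hα.eq_of_botRel T₃.bot H₃ G₁
  obtain ⟨rfl, a₁, ha₁, f₁, y₁, x₁, n₁, e₁⟩ := hα.legEdges_false L₁ G₁ H₁
  obtain ⟨rfl, a₂, ha₂, f₂, y₂, x₂, n₂, e₂⟩ := hα.legEdges_false L₂ G₂ H₂
  obtain ⟨rfl, a₃, ha₃, f₃, y₃, x₃, n₃, e₃⟩ := hα.legEdges_false L₃ G₃ H₃
  have s₁ := S₁.lt_of_neg hα f₁ y₁
  have s₂ := S₂.lt_of_neg hα f₂ y₂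
  have s₃ := S₃.lt_of_neg hα f₃ y₃
  have c12 := (hα.ne_of_legTurn T₁ H₁ G₂).symm
  have c23 := (hα.ne_of_legTurn T₂ H₂ G₃).symm
  have c13 := hα.ne_of_legTurn T₃ H₃ G₁
  have D₁ := natDegree_sub_le_of_le_of_le H₁.deg G₁.deg
  have D₂ := natDegree_sub_le_of_le_of_le H₂.deg G₂.deg
  have D₃ := natDegree_sub_le_of_le_of_le H₃.deg G₃.deg
  have hp := hα.pos_p
  have hA : m / p * p ≤ m := Nat.div_mul_le_self m p
  have hsum := add_add_le_of_sum_eq_zero (fun h => n₁ (by simp [h])) (fun h => n₂ (by simp [h]))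
    D₁ D₂ c12 c23 c13 (pow_X_sub_C_dvd x₁) (pow_X_sub_C_dvd x₂) (pow_X_sub_C_dvd x₃) (by ring)
  -- Steepness gives a_i p > 5m/6. The first alternative would give 5m/3 < m; the second gives 5m/2
  -- < 2m + p.
  have hm : m < 2 * p := by
    rcases hsum with h | h
    · have := Nat.mul_le_mul_right p h
      rw [add_mul] at this
      omega
    · have := Nat.mul_le_mul_right p h
      rw [add_mul, add_mul, add_mul, mul_assoc] at this
      omega
  have hone : m / p = 1 := Nat.div_eq_of_lt_le (by linarith [hα.lt]) (by linarith)
  have hslope : ∀ a, a ≤ m / p → 5 * m < 6 * (a * p) → a = 1 := by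
    intro a h1 h2
    rw [hone] at h1
    interval_cases a
    · omega
    · rfl
  obtain rfl := hslope a₁ ha₁ s₁
  obtain rfl := hslope a₂ ha₂ s₂
  obtain rfl := hslope a₃ ha₃ s₃
  rw [hone] at D₁ D₂ D₃
  rw [e₁, e₂, e₃]
  exact hα.exists_isCycleB hone hm c12 c23 c13 n₁ (eq_C_mul_X_sub_C D₁ x₁)
    (eq_C_mul_X_sub_C D₂ x₂) (eq_C_mul_X_sub_C D₃ x₃)

/-- The leg on y > 0 changes the polynomial by one of small degree d, while the other two legs
contribute zeros of high order at distinct points. The Wronskian bound then forces d = 0 and both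
zeros to be simple. -/
theorem IsFlagWeight.isCycleC_of_isThreeLegs [CharZero k] (hα : IsFlagWeight α m p)
    {γ : Set (Set (ValClass k))} (h : IsThreeLegs α True γ) :
    ∃ g ∈ tameStab (valPt (1 : PolyAut k) α), ∃ γ₀, IsCycleC α γ₀ ∧ γ = translateCycle g γ₀ := by
  obtain ⟨g₁, h₁, g₂, h₂, g₃, h₃, d₁, d₂, d₃, t₁, z₁, t₂, z₂, t₃, z₃, L₁, L₂, L₃, S₁, S₂, S₃,
    T₁, T₂, T₃, rfl⟩ := h
  obtain ⟨P₁, _, G₁⟩ := hα.exists_hasLabel L₁.mem_left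
  obtain ⟨Q₁, _, H₁⟩ := hα.exists_hasLabel L₁.mem_right
  obtain ⟨P₂, _, G₂⟩ := hα.exists_hasLabel L₂.mem_left
  obtain ⟨Q₂, c₂, H₂⟩ := hα.exists_hasLabel L₂.mem_right
  obtain ⟨P₃, _, G₃⟩ := hα.exists_hasLabel L₃.mem_left
  obtain ⟨Q₃, c₃, H₃⟩ := hα.exists_hasLabel L₃.mem_right
  obtain rfl := hα.eq_of_botRel T₁.bot H₁ G₂
  obtain rfl := hα.eq_of_botRel T₂.bot H₂ G₃
  obtain rfl := hα.eq_of_botRel T₃.bot H₃ G₁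
  obtain ⟨d, hd, f₁, y₁, -, n₁⟩ := hα.leg_true L₁ G₁ H₁
  obtain ⟨rfl, a₂, ha₂, f₂, y₂, x₂, n₂, e₂⟩ := hα.legEdges_false L₂ G₂ H₂
  obtain ⟨rfl, a₃, ha₃, f₃, y₃, x₃, n₃, e₃⟩ := hα.legEdges_false L₃ G₃ H₃
  have s₁ := S₁.lt_of_pos hα f₁ y₁
  have s₂ := S₂.lt_of_neg hα f₂ y₂
  have s₃ := S₃.lt_of_neg hα f₃ y₃
  have c23 := (hα.ne_of_legTurn T₂ H₂ G₃).symm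
  have D₂ := natDegree_sub_le_of_le_of_le H₂.deg G₂.deg
  have D₃ := natDegree_sub_le_of_le_of_le H₃.deg G₃.deg
  have hp := hα.pos_p
  have hA : m / p * p ≤ m := Nat.div_mul_le_self m p
  have hsum := add_le_of_natDegree_sum_le (fun h => n₂ (by simp [h])) (fun h => n₃ (by simp [h]))
    n₁.le D₂ c23 (pow_X_sub_C_dvd x₂) (pow_X_sub_C_dvd x₃) (by ring)
  -- Here d p < m/6 and a₂ p, a₃ p > 5m/6, so the bound yields 5m/3 < m + m/6 + p.
  have hm : m < 2 * p := by
    have := Nat.mul_le_mul_right p hsum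
    rw [add_mul, add_mul, add_mul] at this
    omega
  have hone : m / p = 1 := Nat.div_eq_of_lt_le (by linarith [hα.lt]) (by linarith)
  have hslope : ∀ a, a ≤ m / p → 5 * m < 6 * (a * p) → a = 1 := by
    intro a h1 h2
    rw [hone] at h1
    interval_cases a
    · omega
    · rfl
  obtain rfl := hslope a₂ ha₂ s₂
  obtain rfl := hslope a₃ ha₃ s₃
  obtain rfl : d = 0 := by
    by_contra h
    have := Nat.mul_le_mul_right p (Nat.one_le_iff_ne_zero.2 h)
    omega
  rw [hone] at D₂ D₃
  -- On y > 0 the arms of g₁ and h₃ coincide, since the two charts agree at the bottom. This lets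
  -- the upper path continue the lower one in the same apartment, as in type (c).
  have u₁ : arm α g₁ True d₁ = upperPath α m p P₁ c₃ 0 := by
    rw [← T₃.bot.arm_eq hα.strict (fun _ => trivial),
      hα.arm_true hd f₁ y₁ L₁.fork.height_t, hα.linkPath_eq H₃]
    rfl
  have u₂ : arm α h₁ True d₁ = upperPath α m p P₂ c₂ 0 := by
    rw [T₁.bot.arm_eq hα.strict (fun _ => trivial),
      hα.arm_true hd f₁ y₁ L₁.fork.height_t, hα.linkPath_eq G₂]
    rfl
  rw [e₂, e₃, legEdges, u₁, u₂]
  exact hα.exists_isCycleC hone hm c23 n₂ (Polynomial.eq_C_of_natDegree_eq_zero n₁)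
    (eq_C_mul_X_sub_C D₂ x₂) (eq_C_mul_X_sub_C D₃ x₃)

end Matching

end

/-! ### The constant ε₀ and the conclusion -/

theorem mainTheorem7 (k : Type*) [Field k] [CharZero k] :
    ∃ ε₀ : ℝ, 0 < ε₀ ∧
      ∀ α : Fin 3 → ℝ, α ∈ vertexWeights → α 1 < α 0 → α 2 < α 1 →
        ∀ (γ : Set (Set (ValClass k))) (L : ℝ), IsLinkCycle α γ L → L < 2 * Real.pi + ε₀ →
          (∃ f ∈ tameStab (valPt (1 : PolyAut k) α), γ = apartmentLink α f) ∨
          (∃ f ∈ tameStab (valPt (1 : PolyAut k) α), ∃ g ∈ tameStab (valPt (1 : PolyAut k) α),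
            γ = (apartmentLink α f ∪ apartmentLink α g) \ (apartmentLink α f ∩ apartmentLink α g)) ∨
          (∃ g ∈ tameStab (valPt (1 : PolyAut k) α), ∃ γ₀, IsCycleA α γ₀ ∧ γ = translateCycle g γ₀) ∨
          (∃ g ∈ tameStab (valPt (1 : PolyAut k) α), ∃ γ₀, IsCycleB α γ₀ ∧ γ = translateCycle g γ₀) ∨
          (∃ g ∈ tameStab (valPt (1 : PolyAut k) α), ∃ γ₀, IsCycleC α γ₀ ∧ γ = translateCycle g γ₀) := by
  have hlt : Real.pi / 3 < Real.arccos (9 / 25) := by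
    rw [← Real.arccos_cos (x := Real.pi / 3) (by positivity) (by linarith [Real.pi_pos]),
      Real.cos_pi_div_three]
    exact Real.strictAntiOn_arccos (by norm_num) (by norm_num) (by norm_num)
  have hle : Real.arccos (9 / 25) ≤ Real.pi / 2 := Real.arccos_le_pi_div_two.2 (by norm_num)
  -- This is the excess over 2π of two excursions of minimal length 2π/3 and one of length 2
  -- arccos(9/25), the threshold for steepness.
  refine ⟨2 * (Real.arccos (9 / 25) - Real.pi / 3), by linarith, ?_⟩
  intro α hv h01 h12 γ L hγ hL
  have hα : StrictWeight α := ⟨hv.1.1, h01, h12⟩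
  obtain ⟨hD, hne⟩ := critSlopes_of_mem_vertexWeights hα hv
  obtain ⟨N, f, σ, q, w, W, rfl, rfl⟩ := exists_linkWalk hα hv hγ
  rw [← W.sum_stepLength 0] at hL
  by_cases hf : IsFlagged α
  · obtain ⟨m, p, hm⟩ := exists_isFlagWeight hα hf hne
    rcases W.flagged_cases hα hne hf hL with h | h | h | h | h
    · exact Or.inl h
    · exact Or.inr (Or.inl h)
    · exact Or.inr (Or.inr (Or.inl (hm.isCycleA_of_isTwoLegs h)))
    · exact Or.inr (Or.inr (Or.inr (Or.inl (hm.isCycleB_of_isThreeLegs h))))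
    · exact Or.inr (Or.inr (Or.inr (Or.inr (hm.isCycleC_of_isThreeLegs h))))
  -- The unflagged case tolerates any length below 8π/3, and ε₀ ≤ π/3.
  · have hL' : partLength w 0 (2 * N) < 8 * Real.pi / 3 := by
      refine hL.trans_le ?_
      linarith [Real.pi_pos]
    rcases W.unflagged_cases hα (hD.resolve_left hf) hf hL' with h | h
    · exact Or.inl h
    · exact Or.inr (Or.inl h)
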